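/- Let $\mathbf T^3=(\mathbf R/\mathbf Z)^3$ and fix $s\in(\frac52,3]$, $r\in(0,1]$. Write $\langle v\rangle=(1+|v|^2)^{1/2}$, $\langle\nabla\rangle=(1-\Delta)^{1/2}$. For $u=u(x,v)$ on $\mathbf T^3\times\mathbf R^3$ put $$\|u\|_{\mathfrak E}^2=\|\langle v\rangle^{15}u\|_{L^2_{x,v}}^2+\|\langle v\rangle^{10}\langle\nabla_x\rangle^su\|_{L^2_{x,v}}^2+\|\langle\nabla_v\rangle^ru\|_{L^2_{x,v}}^2,\qquad \|u\|_{\mathfrak E'}^2=\|\langle v\rangle^{10}u\|_{L^2_{x,v}}^2+\|\langle v\rangle^{5}\langle\nabla_x\rangle^su\|_{L^2_{x,v}}^2,$$ and $\mathfrak E_T=L^\infty([0,T];\mathfrak E)$, $\mathfrak E'_T=L^\infty([0,T];\mathfrak E')$. For given real-valued $G=G(t,x,v)$ and $\beta_{in}>0$, consider the Poincaré–Poisson system for $(\beta(t),\phi(t,x))$: $$\frac{d}{dt}\Big\{\frac{3}{2\beta}+\iint_{\mathbf T^3\times\mathbf R^3}\frac{|v|^2}{2}G\,dx\,dv+\frac1{8\pi}\int_{\mathbf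 T^3}|\nabla_x\phi|^2dx\Big\}=0,\qquad \beta(0)=\beta_{in},\qquad -\Delta_x\phi=4\pi\Big(\int_{\mathbf R^3}G\,dv-e^{\beta\phi}\Big).\tag{PP}$$ A solution on $[0,T]$ means a pair $(\beta,\phi)\in C([0,T];\mathbf R_+\times H^{s+2}(\mathbf T^3))$, with $\mathbf R_+=(0,\infty)$, satisfying (PP). Here $T>0$ is finite throughout. **(i)** Suppose $G\in C([0,T];\mathfrak E')$, $\inf_x\int_{\mathbf R^3}G(t,x,v)\,dv>0$ for every $t\in[0,T]$, and $\beta_{in}>0$. Then there is $T^*\in(0,T]$ such that (PP) has a unique solution on $[0,T^*]$. More precisely, for every $M>0$ there is a constant $C$ depending only on $M,s,r$ such that the following holds for every $T>0$ and every such $G$, $\beta_{in}$. If $$|\ln\beta_{in}|+\Big\|\frac1{\int G\,dv}\Big\|_{L^\infty([0,T]\times\mathbf T^3)}+\|G\|_{\mathfrak E_T}\le M\tag{1}$$ and $$\sup_{t\in[0,T]}\iint_{\mathbf T^3\times\mathbf R^3}\frac{|v|^2}2\,(G(t,\cdot)-G(0,\cdot))\,dx\,dv\le e^{-M},\tag{2}$$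 then (PP) has a unique solution on all of $[0,T]$, and $$\|\ln\beta\|_{L^\infty([0,T])}+\|\phi\|_{L^\infty([0,T];H^{s+2})}\le C.$$ **(ii)** For every $M>0$ there is a constant $C$ depending only on $M,s,r$ such that the following holds for every $T>0$. For $\alpha\in\{1,2\}$ let $G^\alpha\in C([0,T];\mathfrak E')\cap\mathfrak E_T$, $\beta^\alpha_{in}>0$, and let $(\beta^\alpha,\phi^\alpha)$ be a solution of (PP) on $[0,T]$ with $G=G^\alpha$ and $\beta_{in}=\beta_{in}^\alpha$. Assume that (1) holds for each $(\beta^\alpha_{in},G^\alpha)$, and that for each $\alpha$ either (2) holds for $G^\alpha$ or $\|\ln\beta^\alpha\|_{L^\infty([0,T])}\le M$. Then, with $\delta G=G^2-G^1$ and similarly for the other quantities, $$\|\delta\beta\|_{L^\infty([0,T])}+\|\delta\phi\|_{L^\infty([0,T];H^{s+2})}\le C\big(\|\delta G\|_{\mathfrak E'_T}+|\delta\beta_{in}|\big).$$ **(iii)** Let $G\in C([0,T];\mathfrak E')$ with $\inf_x\int_{\mathbf R^3}G(t,x,v)\,dv>0$ for every $t\in[0,T]$, let $\beta_{in}>0$,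 and let $(\beta,\phi)$ be a solution of (PP) on $[0,T]$. If moreover $G$ is smooth on $[0,T]\times\mathbf T^3\times\mathbf R^3$ and $e^{p|v|^2}\nabla_{t,x,v}^qG\in L^\infty([0,T]\times\mathbf T^3\times\mathbf R^3)$ for all $p\ge0$ and $q\in\mathbf N_0$, then $\beta\in C^\infty([0,T])$ and $\phi\in C^\infty([0,T]\times\mathbf T^3)$. -/

import Mathlib

open MeasureTheory Set Filter Topology
open scoped ENNReal NNReal ContDiff

noncomputable section

namespace PoincarePoisson

/-! ### The domain -/

/-- The velocity space `ℝ³` with its Euclidean norm (also used for lifts of the torus). -/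
abbrev R3 : Type := EuclideanSpace ℝ (Fin 3)

/-- The torus `𝐓³ = (ℝ / ℤ)³`. -/
abbrev T3 : Type := UnitAddTorus (Fin 3)

/-- Lebesgue (Haar) measure `dx` on the torus, of total mass one. -/
abbrev dx : Measure T3 := Measure.pi fun _ => AddCircle.haarAddCircle

/-- The covering map `ℝ³ → 𝐓³`. -/
def proj (y : R3) : T3 := fun i => ((y i : ℝ) : UnitAddCircle)

/-! ### Calculus on the torus -/

/-- A function on the torus is smooth if its periodic lift to `ℝ³` is. -/
def SmoothOnTorus (χ : T3 → ℝ) : Prop := ContDiff ℝ ∞ fun y : R3 => χ (proj y)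

/-- The classical partial derivative `∂_{x_j} χ`. -/
def partialT (j : Fin 3) (χ : T3 → ℝ) (x : T3) : ℝ :=
  deriv (fun h : ℝ => χ (x + Pi.single j (h : UnitAddCircle))) 0

/-- The classical Laplacian `Δ_x χ`. -/
def laplacianT (χ : T3 → ℝ) (x : T3) : ℝ := ∑ j, partialT j (partialT j χ) x

/-- `w ∈ L²(𝐓³)` is the weak partial derivative `∂_{x_j} u`. -/
def IsWeakPartial (j : Fin 3) (u w : T3 → ℝ) : Prop :=
  MemLp w 2 dx ∧
    ∀ χ : T3 → ℝ, SmoothOnTorus χ → ∫ x, u x * partialT j χ x ∂dx = -∫ x, w x * χ x ∂dx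

open Classical in
/-- The weak partial derivative `∂_{x_j} u` (it is unique up to null sets; it exists in `L²` for
every `u ∈ H¹`, and the value `0` is used where it does not exist). -/
def weakPartial (j : Fin 3) (u : T3 → ℝ) : T3 → ℝ :=
  if h : ∃ w, IsWeakPartial j u w then h.choose else 0

/-- `-Δ_x u = f` on the torus in the sense of distributions. -/
def SolvesPoisson (u f : T3 → ℝ) : Prop :=
  ∀ χ : T3 → ℝ, SmoothOnTorus χ → -∫ x, u x * laplacianT χ x ∂dx = ∫ x, f x * χ x ∂dx

/-! ### Sobolev norms on the torus -/

/-- The `k`-th Fourier coefficient of a real function on the torus. -/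
def coeffT (u : T3 → ℝ) (k : Fin 3 → ℤ) : ℂ :=
  UnitAddTorus.mFourierCoeff (fun x => (u x : ℂ)) k

/-- The symbol of `⟨∇_x⟩²  = 1 - Δ_x`, that is `1 + |2πk|²`. -/
def symbolX (k : Fin 3 → ℤ) : ℝ := 1 + ∑ i, (2 * Real.pi * (k i : ℝ)) ^ 2

/-- `‖u‖_{H^σ}² = ‖⟨∇_x⟩^σ u‖_{L²}²`, computed on the Fourier side. -/
def sobSq (σ : ℝ) (u : T3 → ℝ) : ℝ≥0∞ :=
  ∑' k : Fin 3 → ℤ, ENNReal.ofReal (symbolX k ^ σ) * ‖coeffT u k‖ₑ ^ 2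

/-- The norm of `H^σ(𝐓³)`. -/
def sobNorm (σ : ℝ) (u : T3 → ℝ) : ℝ≥0∞ := sobSq σ u ^ (1 / 2 : ℝ)

/-- Membership in `H^σ(𝐓³)`, for `σ ≥ 0`. -/
def MemSob (σ : ℝ) (u : T3 → ℝ) : Prop := MemLp u 2 dx ∧ sobNorm σ u < ⊤

/-! ### The spaces `𝔈` and `𝔈'` of functions of `(x, v)` -/

/-- The exponents `m_j = 5 (j + 1)`. -/
def mExp (j : ℕ) : ℕ := 5 * (j + 1)

/-- The weight `⟨v⟩^{2m} = (1 + |v|²)^m`. -/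
def weightSq (m : ℕ) (v : R3) : ℝ≥0∞ := ENNReal.ofReal ((1 + ‖v‖ ^ 2) ^ m)

/-- `‖⟨v⟩^m u‖_{L²_{x,v}}²`. -/
def momentSq (m : ℕ) (u : T3 → R3 → ℝ) : ℝ≥0∞ :=
  ∫⁻ x, ∫⁻ v, weightSq m v * ‖u x v‖ₑ ^ 2 ∂volume ∂dx

/-- `‖⟨v⟩^m ⟨∇_x⟩^s u‖_{L²_{x,v}}²`. -/
def spaceDerivSq (m : ℕ) (s : ℝ) (u : T3 → R3 → ℝ) : ℝ≥0∞ :=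
  ∫⁻ v, weightSq m v * sobSq s (fun x => u x v)

/-- `‖⟨∇_v⟩^r u‖_{L²_{x,v}}²`, computed on the Fourier side: `⟨∇_v⟩²` has the symbol `1 + |2πξ|²`
for the Fourier transform `∫ e^{-2πi v·ξ} u(v) dv`. -/
def velocityDerivSq (r : ℝ) (u : T3 → R3 → ℝ) : ℝ≥0∞ :=
  ∫⁻ x, ∫⁻ ξ : R3, ENNReal.ofReal ((1 + (2 * Real.pi * ‖ξ‖) ^ 2) ^ r) *
    ‖FourierTransform.fourier (fun v : R3 => (u x v : ℂ)) ξ‖ₑ ^ 2 ∂volume ∂dx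

/-- The norm of `𝔈`. -/
def normE (s r : ℝ) (u : T3 → R3 → ℝ) : ℝ≥0∞ :=
  (momentSq (mExp 2) u + spaceDerivSq (mExp 1) s u + velocityDerivSq r u) ^ (1 / 2 : ℝ)

/-- The norm of `𝔈'`. -/
def normE' (s : ℝ) (u : T3 → R3 → ℝ) : ℝ≥0∞ :=
  (momentSq (mExp 1) u + spaceDerivSq (mExp 0) s u) ^ (1 / 2 : ℝ)

/-- Membership in `𝔈'`. -/
def MemE' (s : ℝ) (u : T3 → R3 → ℝ) : Prop :=
  AEStronglyMeasurable (fun z : T3 × R3 => u z.1 z.2) (dx.prod volume) ∧ normE' s u < ⊤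

/-! ### Functions of time -/

/-- The (essential) supremum over `t ∈ [0,T]`. The norm of `L^∞([0,T]; X)` is
`timeSup T fun t => ‖u t‖_X`. -/
def timeSup (T : ℝ) (f : ℝ → ℝ≥0∞) : ℝ≥0∞ := essSup f (volume.restrict (Icc 0 T))

/-- `φ ∈ C([0,T]; H^σ(𝐓³))`. -/
def ContSob (σ T : ℝ) (φ : ℝ → T3 → ℝ) : Prop :=
  (∀ t ∈ Icc 0 T, MemSob σ (φ t)) ∧
    ∀ t₀ ∈ Icc 0 T, Tendsto (fun t => sobNorm σ (φ t - φ t₀)) (𝓝[Icc 0 T] t₀) (𝓝 0)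

/-- `G ∈ C([0,T]; 𝔈')`. -/
def ContE' (s T : ℝ) (G : ℝ → T3 → R3 → ℝ) : Prop :=
  (∀ t ∈ Icc 0 T, MemE' s (G t)) ∧
    ∀ t₀ ∈ Icc 0 T, Tendsto (fun t => normE' s (G t - G t₀)) (𝓝[Icc 0 T] t₀) (𝓝 0)

/-! ### The Poincaré–Poisson system -/

/-- The density `∫ u dv`. -/
def density (u : T3 → R3 → ℝ) (x : T3) : ℝ := ∫ v, u x v

/-- The kinetic energy `∬ (|v|²/2) u dx dv`. -/
def kinetic (u : T3 → R3 → ℝ) : ℝ :=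
  ∫ z : T3 × R3, ‖z.2‖ ^ 2 / 2 * u z.1 z.2 ∂(dx.prod volume)

/-- The field energy `(1/8π) ∫ |∇_x φ|² dx`. -/
def fieldEnergy (φ : T3 → ℝ) : ℝ :=
  1 / (8 * Real.pi) * ∫ x, ∑ j, weakPartial j φ x ^ 2 ∂dx

/-- `(β, φ) ∈ C([0,T]; ℝ₊ × H^{s+2}(𝐓³))` solves on `[0,T]` the Poincaré–Poisson system with
the given `G` and the initial value `βin`. -/
structure IsSolution (s T : ℝ) (G : ℝ → T3 → R3 → ℝ) (βin : ℝ)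
    (β : ℝ → ℝ) (φ : ℝ → T3 → ℝ) : Prop where
  beta_pos : ∀ t ∈ Icc 0 T, 0 < β t
  beta_cont : ContinuousOn β (Icc 0 T)
  phi_cont : ContSob (s + 2) T φ
  energy : ∀ t ∈ Icc 0 T,
    HasDerivWithinAt (fun τ => 3 / (2 * β τ) + kinetic (G τ) + fieldEnergy (φ τ)) 0 (Icc 0 T) t
  init : β 0 = βin
  poisson : ∀ t ∈ Icc 0 T,
    SolvesPoisson (φ t) fun x => 4 * Real.pi * (density (G t) x - Real.exp (β t * φ t x))

/-- There is exactly one solution on `[0,T]` (`φ t` being a class of functions modulo null sets),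
and it satisfies `P`. -/
def ExistsUniqueSolution (s T : ℝ) (G : ℝ → T3 → R3 → ℝ) (βin : ℝ)
    (P : (ℝ → ℝ) → (ℝ → T3 → ℝ) → Prop) : Prop :=
  ∃ (β : ℝ → ℝ) (φ : ℝ → T3 → ℝ), IsSolution s T G βin β φ ∧ P β φ ∧
    ∀ (β' : ℝ → ℝ) (φ' : ℝ → T3 → ℝ), IsSolution s T G βin β' φ' →
      ∀ t ∈ Icc 0 T, β' t = β t ∧ φ' t =ᵐ[dx] φ t

/-- `inf_x ∫ G dv > 0` at every time of `[0,T]`. -/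
def PositiveDensity (T : ℝ) (G : ℝ → T3 → R3 → ℝ) : Prop :=
  ∀ t ∈ Icc 0 T, ∃ c > 0, ∀ᵐ x ∂dx, c ≤ density (G t) x

/-- `‖1 / ∫ G dv‖_{L^∞([0,T] × 𝐓³)}`, with `1 / 0 = ∞`. -/
def invDensitySup (T : ℝ) (G : ℝ → T3 → R3 → ℝ) : ℝ≥0∞ :=
  timeSup T fun t => essSup (fun x => ‖density (G t) x‖ₑ⁻¹) dx

/-- `|ln βin| + ‖1 / ∫ G dv‖_{L^∞([0,T] × 𝐓³)} + ‖G‖_{L^∞([0,T]; 𝔈)} ≤ M`. -/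
def Bootstrap (s r T M : ℝ) (G : ℝ → T3 → R3 → ℝ) (βin : ℝ) : Prop :=
  ‖Real.log βin‖ₑ + invDensitySup T G + timeSup T (fun t => normE s r (G t)) ≤ ENNReal.ofReal M

/-- `sup_{t ∈ [0,T]} ∬ (|v|²/2) (G(t) - G(0)) dx dv ≤ e^{-M}`. -/
def SmallKineticChange (T M : ℝ) (G : ℝ → T3 → R3 → ℝ) : Prop :=
  ∀ t ∈ Icc 0 T, kinetic (G t - G 0) ≤ Real.exp (-M)

/-! ### Smoothness on `[0,T]` -/

/-- `G` is smooth on `[0,T] × 𝐓³ × ℝ³`, and `e^{p|v|²} ∇_{t,x,v}^q G` is bounded there for all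
`p ≥ 0` and all `q ∈ ℕ`. -/
def GaussianDecay (T : ℝ) (G : ℝ → T3 → R3 → ℝ) : Prop :=
  let D : Set (ℝ × R3 × R3) := Icc 0 T ×ˢ univ
  let Gl : ℝ × R3 × R3 → ℝ := fun z => G z.1 (proj z.2.1) z.2.2
  ContDiffOn ℝ ∞ Gl D ∧
    ∀ (p : ℝ) (q : ℕ), 0 ≤ p → ∃ C : ℝ, ∀ z ∈ D,
      Real.exp (p * ‖z.2.2‖ ^ 2) * ‖iteratedFDerivWithin ℝ q Gl D z‖ ≤ C

/-- `φ ∈ C^∞([0,T] × 𝐓³)`, for `φ` given up to null sets in `x` at each time. -/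
def SmoothPotential (T : ℝ) (φ : ℝ → T3 → ℝ) : Prop :=
  ∃ ψ : ℝ → T3 → ℝ,
    ContDiffOn ℝ ∞ (fun z : ℝ × R3 => ψ z.1 (proj z.2)) (Icc 0 T ×ˢ univ) ∧
      ∀ t ∈ Icc 0 T, φ t =ᵐ[dx] ψ t

end PoincarePoisson

end

/-!
At each time the system is a stationary problem. The conservation law prescribes the energy
`e = 3/(2β) + (1/8π) ∫ |∇φ|²` in terms of its initial value and of the kinetic energy of `G`, and
`φ` solves the Poisson–Boltzmann equation `-Δφ = 4π (n - e^{βφ})` with the density `n = ∫ G dv`.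
Density and kinetic energy are continuous linear functions of `G ∈ 𝔈'` with values in `H^s` and `ℝ`
(`exists_density_le`, `exists_kinetic_le`), so that everything reduces to the map `(n, e) ↦ (β, φ)`.
As `s > 3/2`, all functions of `x` are replaced by their continuous representatives, and the Laplacian
acts on Fourier coefficients (`IsNegLap`, `IsPot`, `solvesPoisson_iff_isPot`, `fieldEnergy_eq`).

The stationary problem rests on an identity for two solutions (`IsPot.energy_identity`). With `ψ = βφ`,
the charge `ρ = n - e^ψ`, the field energy `F = ½ ∫ φρ`, and `δ` for differences,
`δβ δF = ∫ δψ δn - ∫ δψ δ(e^ψ) - ½(β₁ + β₂) ∫ δφ δρ`.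
The last two integrals are nonnegative, the first of them being at least a multiple of `‖δψ‖²`, since
the maximum principle bounds `e^ψ` by the extreme values of `n` (`IsPot.exp_le`, `IsPot.le_exp`). For a
fixed density the field energy thus decreases in `β`, and so does `3/(2β)`, strictly. This gives
uniqueness and Lipschitz stability of `β` and of `ψ` in `L²` (`exists_potential_stability`,
`exists_energy_stability`). Elliptic regularity, used in the scale of the Wiener norms
`∑ ⟨2πk⟩^{2m} |û_k|`, for which composition with the exponential is elementary, improves stability to
`H^{s+2}` (`IsBddPot.sobNorm_sub_le`, `exists_lipschitz`); comparison with the solution `φ = 0`, `n = 1`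
gives the a priori bounds (`exists_potential_bound`). For existence, the equation at a fixed `β` is a
contraction after truncation (`exists_isPot`), the energy depends continuously on `β` and lies between
`3/(2β)` and a multiple of `1/β`, and the intermediate value theorem finds `β` for every positive
energy (`exists_stationary`).

Hence the system is solvable as long as the prescribed energy stays positive
(`exists_solution`). This is so for a short time by continuity, and on all of `[0,T]` if the kinetic
energy grows by at most `e^{-M}`, because the initial energy is at least
`3/(2β_in) ≥ (3/2) e^{-M}`. Continuity in time and the estimates of the differences are the Lipschitz
estimate of the stationary problem (`exists_unique_short`, `exists_unique_long`,
`exists_lipschitz_data`).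

For smooth `G`, the density, considered together with its translates in space as a curve in the space
of continuous functions, depends smoothly on time and on the translation
(`RapidDecay.contDiffOn_momentC`), and so does the kinetic energy. In the unknown `(β, lφ - Δφ)` the
stationary problem is a smooth map between Banach spaces. Its derivative is invertible, by a Neumann
series for the equation at a fixed temperature and by the infinitesimal form of the above
monotonicity for the temperature, and the inverse function theorem shows that `(β, φ)` is a smooth
function of `(n, e)` (`exists_smooth_solution_map`). The smoothness of the translates of `φ` is its
smoothness in `x` (`IsSolution.smooth`).
-/

open MeasureTheory Set Filter Topology
open scoped ENNReal NNReal ContDiff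

noncomputable section

namespace PoincarePoisson

/-! ### Fourier coefficients of functions on the torus -/

/-- The real Banach algebra of continuous functions on the torus. -/
abbrev CT : Type := C(T3, ℝ)

/-- The symbol `|2πk|²` of `-Δ_x`. -/
def lam (k : Fin 3 → ℤ) : ℝ := ∑ i, (2 * Real.pi * (k i : ℝ)) ^ 2

lemma symbolX_eq (k : Fin 3 → ℤ) : symbolX k = 1 + lam k := rfl

lemma lam_nonneg (k : Fin 3 → ℤ) : 0 ≤ lam k := Finset.sum_nonneg fun _ _ => sq_nonneg _

lemma one_le_symbolX (k : Fin 3 → ℤ) : 1 ≤ symbolX k := by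
  rw [symbolX_eq]; linarith [lam_nonneg k]

lemma symbolX_pos (k : Fin 3 → ℤ) : 0 < symbolX k := by linarith [one_le_symbolX k]

lemma norm_mFourier_apply (k : Fin 3 → ℤ) (x : T3) : ‖UnitAddTorus.mFourier k x‖ = 1 := by
  simp only [UnitAddTorus.mFourier, ContinuousMap.coe_mk, fourier_apply, norm_prod,
    Circle.norm_coe, Finset.prod_const_one]

lemma coeffT_eq (u : T3 → ℝ) (k : Fin 3 → ℤ) :
    coeffT u k = ∫ x, UnitAddTorus.mFourier (-k) x * (u x : ℂ) ∂dx := rfl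

lemma coeffT_congr {u w : T3 → ℝ} (h : u =ᵐ[dx] w) (k : Fin 3 → ℤ) : coeffT u k = coeffT w k := by
  rw [coeffT_eq, coeffT_eq]
  refine integral_congr_ae ?_
  filter_upwards [h] with x hx
  rw [hx]

lemma integrable_mFourier_mul {u : T3 → ℝ} (hu : Integrable u dx) (k : Fin 3 → ℤ) :
    Integrable (fun x => UnitAddTorus.mFourier k x * (u x : ℂ)) dx := by
  refine (hu.ofReal (𝕜 := ℂ)).bdd_mul (c := 1) ?_ ?_
  · exact (UnitAddTorus.mFourier k).continuous.aestronglyMeasurable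
  · exact Eventually.of_forall fun x => (norm_mFourier_apply k x).le

lemma coeffT_add {u w : T3 → ℝ} (hu : Integrable u dx) (hw : Integrable w dx) (k : Fin 3 → ℤ) :
    coeffT (fun x => u x + w x) k = coeffT u k + coeffT w k := by
  simp only [coeffT_eq]
  rw [← integral_add (integrable_mFourier_mul hu _) (integrable_mFourier_mul hw _)]
  congr 1; ext x; push_cast; ring

lemma coeffT_sub {u w : T3 → ℝ} (hu : Integrable u dx) (hw : Integrable w dx) (k : Fin 3 → ℤ) :
    coeffT (fun x => u x - w x) k = coeffT u k - coeffT w k := by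
  simp only [coeffT_eq]
  rw [← integral_sub (integrable_mFourier_mul hu _) (integrable_mFourier_mul hw _)]
  congr 1; ext x; push_cast; ring

lemma coeffT_const_mul (c : ℝ) (u : T3 → ℝ) (k : Fin 3 → ℤ) :
    coeffT (fun x => c * u x) k = c * coeffT u k := by
  simp only [coeffT_eq]
  rw [← integral_const_mul]
  congr 1; ext x; push_cast; ring

lemma coeffT_neg_index (u : T3 → ℝ) (k : Fin 3 → ℤ) :
    coeffT u (-k) = (starRingEnd ℂ) (coeffT u k) := by
  simp only [coeffT_eq]
  rw [← integral_conj]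
  congr 1; ext x
  rw [map_mul, ← UnitAddTorus.mFourier_neg, Complex.conj_ofReal]

lemma norm_coeffT_le (u : CT) (k : Fin 3 → ℤ) : ‖coeffT u k‖ ≤ ‖u‖ := by
  rw [coeffT_eq]
  refine (norm_integral_le_of_norm_le_const (C := ‖u‖) (Eventually.of_forall fun x => ?_)).trans ?_
  · rw [norm_mul, norm_mFourier_apply, one_mul, Complex.norm_real]
    exact u.norm_coe_le_norm x
  · simp

lemma CT.integrable (u : CT) : Integrable u dx :=
  u.continuous.integrable_of_hasCompactSupport (HasCompactSupport.of_compactSpace _)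

lemma CT.memLp (u : CT) : MemLp u 2 dx :=
  u.continuous.memLp_of_hasCompactSupport (HasCompactSupport.of_compactSpace _)

/-- The `k`-th Fourier coefficient as a bounded linear functional. -/
def coeffL (k : Fin 3 → ℤ) : CT →L[ℝ] ℂ :=
  LinearMap.mkContinuous
    { toFun := fun u => coeffT u k
      map_add' := fun u w => coeffT_add u.integrable w.integrable k
      map_smul' := fun c u => (coeffT_const_mul c u k).trans (Complex.real_smul).symm } 1 fun u => by simpa using norm_coeffT_le u k

@[simp] lemma coeffL_apply (k : Fin 3 → ℤ) (u : CT) : coeffL k u = coeffT u k := rfl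

lemma coeffT_const (c : ℝ) (k : Fin 3 → ℤ) :
    coeffT (fun _ => c) k = if k = 0 then (c : ℂ) else 0 := by
  have h := (orthonormal_iff_ite.mp (UnitAddTorus.orthonormal_mFourier (d := Fin 3))) k 0
  rw [ContinuousMap.inner_toLp] at h
  have h' : ∫ x, UnitAddTorus.mFourier (-k) x ∂dx = if k = 0 then (1 : ℂ) else 0 := by
    rw [← h]
    refine integral_congr_ae (Eventually.of_forall fun x => ?_)
    simp [UnitAddTorus.mFourier_zero, UnitAddTorus.mFourier_neg]
  rw [coeffT_eq, integral_mul_const, h']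
  split_ifs <;> simp

/-- Parseval's identity for two real functions in `L²(𝐓³)`. -/
lemma hasSum_coeffT_mul {u w : T3 → ℝ} (hu : MemLp u 2 dx) (hw : MemLp w 2 dx) :
    HasSum (fun k => (starRingEnd ℂ) (coeffT u k) * coeffT w k) ((∫ x, u x * w x ∂dx : ℝ) : ℂ) := by
  have hu' : MemLp (fun x => (u x : ℂ)) 2 dx := hu.ofReal
  have hw' : MemLp (fun x => (w x : ℂ)) 2 dx := hw.ofReal
  have h := UnitAddTorus.hasSum_prod_mFourierCoeff (d := Fin 3) (hu'.toLp _) (hw'.toLp _)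
  have e1 : ∀ {v : T3 → ℝ} (hv : MemLp (fun x => (v x : ℂ)) 2 dx) (k : Fin 3 → ℤ),
      UnitAddTorus.mFourierCoeff (hv.toLp _) k = coeffT v k := fun hv k =>
    integral_congr_ae (by filter_upwards [hv.coeFn_toLp] with x hx; rw [hx])
  simp only [e1] at h
  convert h using 1
  rw [← integral_complex_ofReal]
  refine integral_congr_ae ?_
  filter_upwards [hu'.coeFn_toLp, hw'.coeFn_toLp] with x h1 h2
  rw [h1, h2]; simp

lemma hasSum_sq_coeffT {u : T3 → ℝ} (hu : MemLp u 2 dx) :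
    HasSum (fun k => ‖coeffT u k‖ ^ 2) (∫ x, u x ^ 2 ∂dx) := by
  have h := Complex.hasSum_re (hasSum_coeffT_mul hu hu)
  simp only [Complex.ofReal_re, ← pow_two] at h
  convert h using 2 with k
  rw [Complex.conj_mul']
  norm_cast

/-- A square integrable function is determined by its Fourier coefficients. -/
lemma ae_eq_of_coeffT_eq {u w : T3 → ℝ} (hu : MemLp u 2 dx) (hw : MemLp w 2 dx)
    (h : ∀ k, coeffT u k = coeffT w k) : u =ᵐ[dx] w := by
  have hd : MemLp (fun x => u x - w x) 2 dx := hu.sub hw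
  have h1 := hasSum_sq_coeffT hd
  have h2 : ∀ k, coeffT (fun x => u x - w x) k = 0 := fun k => by
    rw [coeffT_sub (hu.integrable one_le_two) (hw.integrable one_le_two), h, sub_self]
  simp only [h2, norm_zero, ne_eq, OfNat.ofNat_ne_zero, not_false_eq_true, zero_pow] at h1
  have h3 : ∫ x, (u x - w x) ^ 2 ∂dx = 0 := h1.unique hasSum_zero
  rw [integral_eq_zero_iff_of_nonneg (fun x => sq_nonneg _) hd.integrable_sq] at h3
  filter_upwards [h3] with x hx
  have : (u x - w x) ^ 2 = 0 := hx
  have := pow_eq_zero_iff (two_ne_zero) |>.1 this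
  linarith

lemma CT.ext_of_coeffT {u w : CT} (h : ∀ k, coeffT u k = coeffT w k) : u = w := by
  have := ae_eq_of_coeffT_eq u.memLp w.memLp h
  exact DFunLike.coe_injective (u.continuous.ae_eq_iff_eq (μ := dx) w.continuous |>.1 this)

/-- The Fourier series of a continuous function with summable coefficients converges to it. -/
lemma CT.hasSum_series {u : CT} (h : Summable fun k => ‖coeffT u k‖) (x : T3) :
    HasSum (fun k => coeffT u k * UnitAddTorus.mFourier k x) (u x : ℂ) := by
  let f : C(T3, ℂ) := ⟨fun x => (u x : ℂ), Complex.continuous_ofReal.comp u.continuous⟩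
  exact UnitAddTorus.hasSum_mFourier_series_apply_of_summable (f := f) (.of_norm h) x

/-- A summable Hermitian family is the family of Fourier coefficients of a real continuous
function. -/
lemma exists_CT_of_coeff {c : (Fin 3 → ℤ) → ℂ} (hc : Summable fun k => ‖c k‖)
    (hh : ∀ k, c (-k) = (starRingEnd ℂ) (c k)) : ∃ u : CT, ∀ k, coeffT u k = c k := by
  have hs : Summable fun k => c k • UnitAddTorus.mFourier k := by
    refine .of_norm ?_
    simpa [norm_smul, UnitAddTorus.mFourier_norm] using hc
  obtain ⟨f, hf⟩ := hs
  have hfx : ∀ x, HasSum (fun k => c k * UnitAddTorus.mFourier k x) (f x) := fun x => by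
    simpa using (ContinuousMap.evalCLM ℂ x).hasSum hf
  have hreal : ∀ x, (starRingEnd ℂ) (f x) = f x := fun x => by
    have h1 : HasSum (fun k => (starRingEnd ℂ) (c k * UnitAddTorus.mFourier k x))
      ((starRingEnd ℂ) (f x)) := Complex.hasSum_conj.2 (by simpa using hfx x)
    have h2 := (Equiv.neg (Fin 3 → ℤ)).hasSum_iff.2 h1
    refine h2.unique ?_
    convert hfx x using 2 with k
    simp [hh, UnitAddTorus.mFourier_neg]
  refine ⟨⟨fun x => (f x).re, Complex.continuous_re.comp f.continuous⟩, fun k => ?_⟩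
  have e : ∀ x, (((f x).re : ℝ) : ℂ) = f x := fun x => Complex.conj_eq_iff_re.1 (hreal x)
  let T := ContinuousMap.toLp (E := ℂ) 2 dx ℂ
  have h1 : HasSum (fun k => c k • T (UnitAddTorus.mFourier k)) (T f) := by
    simpa using T.hasSum hf
  have h2 := (innerSL ℂ (T (UnitAddTorus.mFourier k))).hasSum h1
  have ho := orthonormal_iff_ite.mp (UnitAddTorus.orthonormal_mFourier (d := Fin 3)) k
  have h3 : HasSum (fun l => if l = k then c k else 0) (inner ℂ (T (UnitAddTorus.mFourier k)) (T f)) := by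
    refine h2.congr_fun fun l => ?_
    rw [innerSL_apply_apply, inner_smul_right]
    have := ho l
    change inner ℂ (T (UnitAddTorus.mFourier k)) (T (UnitAddTorus.mFourier l)) = _ at this
    rw [this]
    by_cases hkl : l = k
    · simp [hkl]
    · simp [hkl, Ne.symm hkl]
  have h4 := h3.unique (hasSum_ite_eq k (c k))
  rw [ContinuousMap.inner_toLp] at h4
  rw [← h4, coeffT_eq]
  refine integral_congr_ae (Eventually.of_forall fun x => ?_)
  simp [e, UnitAddTorus.mFourier_neg, mul_comm]

/-! ### Wiener norms and Sobolev norms -/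

lemma summable_one_add_sq_rpow {q : ℝ} (hq : 1 / 2 < q) :
    Summable fun m : ℤ => (1 + (2 * Real.pi * (m : ℝ)) ^ 2) ^ (-q) := by
  have h1 : Summable fun m : ℤ => |(m : ℝ)| ^ (-(2 * q)) :=
    Real.summable_abs_int_rpow (by linarith)
  refine Summable.of_norm_bounded_eventually h1 ?_
  rw [Filter.eventually_cofinite]
  refine (Set.finite_singleton (0 : ℤ)).subset fun m hm => ?_
  by_contra hm0
  apply hm
  have hm' : (0 : ℝ) < |(m : ℝ)| := abs_pos.2 (by exact_mod_cast hm0)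
  rw [Real.norm_of_nonneg (by positivity)]
  have e : |(m : ℝ)| ^ (-(2 * q)) = (|(m : ℝ)| ^ 2) ^ (-q) := by
    rw [← Real.rpow_natCast, ← Real.rpow_mul hm'.le]; congr 1; push_cast; ring
  rw [e]
  refine Real.rpow_le_rpow_of_nonpos (by positivity) ?_ (by linarith)
  rw [sq_abs]
  have : (1 : ℝ) ≤ (2 * Real.pi) ^ 2 := by nlinarith [Real.pi_gt_three]
  nlinarith [sq_nonneg (m : ℝ)]

/-- On `ℤ³` the sum `∑ ⟨2πk⟩^{-2p}` is finite for `p > 3/2`. -/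
lemma summable_symbolX_rpow {p : ℝ} (hp : 3 / 2 < p) :
    Summable fun k : Fin 3 → ℤ => symbolX k ^ (-p) := by
  let e : ℤ × ℤ × ℤ ≃ (Fin 3 → ℤ) :=
    { toFun := fun a => ![a.1, a.2.1, a.2.2]
      invFun := fun k => (k 0, k 1, k 2)
      left_inv := fun a => by simp
      right_inv := fun k => by ext i; fin_cases i <;> simp }
  rw [← e.summable_iff]
  have h1 := summable_one_add_sq_rpow (q := p / 3) (by linarith)
  have h0 : ∀ m : ℤ, 0 ≤ (1 + (2 * Real.pi * (m : ℝ)) ^ 2) ^ (-(p / 3)) := fun m => by positivity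
  have h2 := h1.mul_of_nonneg (h1.mul_of_nonneg h1 h0 h0) h0 (fun _ => mul_nonneg (h0 _) (h0 _))
  refine Summable.of_nonneg_of_le (fun a => Real.rpow_nonneg (symbolX_pos _).le _) (fun a => ?_) h2
  set A := 1 + (2 * Real.pi * (a.1 : ℝ)) ^ 2 with hA
  set B := 1 + (2 * Real.pi * (a.2.1 : ℝ)) ^ 2 with hB
  set C := 1 + (2 * Real.pi * (a.2.2 : ℝ)) ^ 2 with hC
  have hs : symbolX (e a) = 1 + ((A - 1) + (B - 1) + (C - 1)) := by
    simp [symbolX, e, Fin.sum_univ_three, hA, hB, hC]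
  have hA1 : 1 ≤ A := by rw [hA]; nlinarith [sq_nonneg (2 * Real.pi * (a.1 : ℝ))]
  have hB1 : 1 ≤ B := by rw [hB]; nlinarith [sq_nonneg (2 * Real.pi * (a.2.1 : ℝ))]
  have hC1 : 1 ≤ C := by rw [hC]; nlinarith [sq_nonneg (2 * Real.pi * (a.2.2 : ℝ))]
  have hp3 : -(p / 3) ≤ 0 := by linarith
  have hS : ∀ D, 1 ≤ D → D ≤ symbolX (e a) →
      symbolX (e a) ^ (-(p / 3)) ≤ D ^ (-(p / 3)) := fun D h1 h2 =>
    Real.rpow_le_rpow_of_nonpos (by linarith) h2 hp3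
  have e1 : symbolX (e a) ^ (-p) = symbolX (e a) ^ (-(p / 3)) *
      (symbolX (e a) ^ (-(p / 3)) * symbolX (e a) ^ (-(p / 3))) := by
    rw [← Real.rpow_add (symbolX_pos _), ← Real.rpow_add (symbolX_pos _)]; congr 1; ring
  change symbolX (e a) ^ (-p) ≤ _
  have hn := Real.rpow_nonneg (symbolX_pos (e a)).le (-(p / 3))
  rw [e1]
  have a1 := hS A hA1 (by linarith)
  have b1 := hS B hB1 (by linarith)
  have c1 := hS C hC1 (by linarith)
  gcongr

lemma tsum_symbolX_rpow_lt_top {p : ℝ} (hp : 3 / 2 < p) :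
    ∑' k : Fin 3 → ℤ, ENNReal.ofReal (symbolX k ^ (-p)) < ⊤ := by
  rw [← ENNReal.ofReal_tsum_of_nonneg (fun k => Real.rpow_nonneg (symbolX_pos _).le _)
    (summable_symbolX_rpow hp)]
  exact ENNReal.ofReal_lt_top

/-- The weighted Wiener norm `∑_k ⟨2πk⟩^{2m} |û_k|`. -/
def wien (m : ℝ) (u : T3 → ℝ) : ℝ≥0∞ :=
  ∑' k : Fin 3 → ℤ, ENNReal.ofReal (symbolX k ^ m) * ‖coeffT u k‖ₑ

lemma ofReal_symbolX_rpow_add (k : Fin 3 → ℤ) (a b : ℝ) :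
    ENNReal.ofReal (symbolX k ^ (a + b)) =
      ENNReal.ofReal (symbolX k ^ a) * ENNReal.ofReal (symbolX k ^ b) := by
  rw [Real.rpow_add (symbolX_pos _), ENNReal.ofReal_mul (Real.rpow_nonneg (symbolX_pos _).le _)]

lemma ofReal_symbolX_rpow_mono (k : Fin 3 → ℤ) {a b : ℝ} (h : a ≤ b) :
    ENNReal.ofReal (symbolX k ^ a) ≤ ENNReal.ofReal (symbolX k ^ b) :=
  ENNReal.ofReal_le_ofReal (Real.rpow_le_rpow_of_exponent_le (one_le_symbolX k) h)

lemma wien_mono {a b : ℝ} (h : a ≤ b) (u : T3 → ℝ) : wien a u ≤ wien b u :=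
  ENNReal.tsum_le_tsum fun k => mul_le_mul_left (ofReal_symbolX_rpow_mono k h) _

lemma sobNorm_sq (σ : ℝ) (u : T3 → ℝ) : sobNorm σ u ^ 2 = sobSq σ u := by
  rw [sobNorm, ← ENNReal.rpow_natCast, ← ENNReal.rpow_mul]; norm_num

/-- Cauchy–Schwarz for sums in `ℝ≥0∞`. -/
lemma ENNReal_tsum_mul_sq_le {ι : Type*} (f g : ι → ℝ≥0∞) :
    (∑' i, f i * g i) ^ 2 ≤ (∑' i, f i ^ 2) * ∑' i, g i ^ 2 := by
  let _ : MeasurableSpace ι := ⊤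
  have h := ENNReal.lintegral_mul_le_Lp_mul_Lq (Measure.count : Measure ι)
    Real.HolderConjugate.two_two (f := f) (g := g) measurable_from_top.aemeasurable
    measurable_from_top.aemeasurable
  simp only [Pi.mul_apply, ENNReal.rpow_two] at h
  rw [MeasureTheory.lintegral_count, MeasureTheory.lintegral_count,
    MeasureTheory.lintegral_count] at h
  calc _ ≤ _ := pow_le_pow_left₀ (zero_le) h 2
    _ = _ := by
      rw [mul_pow, ← ENNReal.rpow_natCast, ← ENNReal.rpow_natCast, ← ENNReal.rpow_mul,
        ← ENNReal.rpow_mul]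
      norm_num

/-- The constant of the embedding of `H^σ` into the Wiener space of order `m`, meaningful only where
the sum is finite, that is for `σ - 2m > 3/2`. -/
def embConst (m σ : ℝ) : ℝ≥0 :=
  ((∑' k : Fin 3 → ℤ, ENNReal.ofReal (symbolX k ^ (-(σ - 2 * m)))) ^ (1 / 2 : ℝ)).toNNReal

/-- By Cauchy–Schwarz, `H^σ` embeds into the Wiener space of order `m` if `σ - 2m > 3/2`. -/
lemma wien_le_sobNorm {m σ : ℝ} (h : 3 / 2 < σ - 2 * m) (u : T3 → ℝ) :
    wien m u ≤ embConst m σ * sobNorm σ u := by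
  have hC : (embConst m σ : ℝ≥0∞) ^ 2 =
      ∑' k : Fin 3 → ℤ, ENNReal.ofReal (symbolX k ^ (-(σ - 2 * m))) := by
    rw [embConst, ENNReal.coe_toNNReal, ← ENNReal.rpow_natCast, ← ENNReal.rpow_mul]
    · norm_num
    · exact ENNReal.rpow_ne_top_of_nonneg (by norm_num) (tsum_symbolX_rpow_lt_top h).ne
  have h1 := ENNReal_tsum_mul_sq_le
    (fun k : Fin 3 → ℤ => ENNReal.ofReal (symbolX k ^ (m - σ / 2)))
    (fun k => ENNReal.ofReal (symbolX k ^ (σ / 2)) * ‖coeffT u k‖ₑ)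
  have e1 : ∑' k : Fin 3 → ℤ, ENNReal.ofReal (symbolX k ^ (m - σ / 2)) *
      (ENNReal.ofReal (symbolX k ^ (σ / 2)) * ‖coeffT u k‖ₑ) = wien m u := by
    refine tsum_congr fun k => ?_
    rw [← mul_assoc, ← ofReal_symbolX_rpow_add]; congr 4; ring
  have e2 : ∑' k : Fin 3 → ℤ, (ENNReal.ofReal (symbolX k ^ (σ / 2)) * ‖coeffT u k‖ₑ) ^ 2 =
      sobSq σ u := by
    refine tsum_congr fun k => ?_
    rw [mul_pow, sq (ENNReal.ofReal _), ← ofReal_symbolX_rpow_add]; congr 4; ring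
  have e3 : ∑' k : Fin 3 → ℤ, (ENNReal.ofReal (symbolX k ^ (m - σ / 2))) ^ 2 =
      (embConst m σ : ℝ≥0∞) ^ 2 := by
    rw [hC]
    refine tsum_congr fun k => ?_
    rw [sq (ENNReal.ofReal _), ← ofReal_symbolX_rpow_add]; congr 2; ring
  rw [e1, e2, e3, ← sobNorm_sq, ← mul_pow] at h1
  exact (ENNReal.pow_le_pow_left_iff (two_ne_zero)).1 h1

/-- The embedding `ℓ¹ ⊆ ℓ²` on the Fourier side. -/
lemma sobNorm_le_wien {m σ : ℝ} (h : σ ≤ 2 * m) (u : T3 → ℝ) : sobNorm σ u ≤ wien m u := by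
  rw [← ENNReal.pow_le_pow_left_iff (two_ne_zero), sobNorm_sq]
  calc sobSq σ u ≤ ∑' k, (ENNReal.ofReal (symbolX k ^ m) * ‖coeffT u k‖ₑ) ^ 2 := by
        refine ENNReal.tsum_le_tsum fun k => ?_
        rw [mul_pow, sq (ENNReal.ofReal _), ← ofReal_symbolX_rpow_add]
        exact mul_le_mul_left (ofReal_symbolX_rpow_mono k (by linarith)) _
    _ ≤ ∑' k, wien m u * (ENNReal.ofReal (symbolX k ^ m) * ‖coeffT u k‖ₑ) := by
        refine ENNReal.tsum_le_tsum fun k => ?_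
        rw [sq]
        exact mul_le_mul_left (ENNReal.le_tsum k) _
    _ = wien m u ^ 2 := by rw [ENNReal.tsum_mul_left, sq, wien]

lemma summable_coeffT_of_wien {m : ℝ} (hm : 0 ≤ m) {u : T3 → ℝ} (h : wien m u ≠ ⊤) :
    Summable fun k => ‖coeffT u k‖ := by
  have h0 : wien 0 u ≠ ⊤ := ne_top_of_le_ne_top h (wien_mono hm u)
  simp only [wien, Real.rpow_zero, ENNReal.ofReal_one, one_mul] at h0
  have := ENNReal.summable_toReal h0
  simpa using this

lemma enorm_le_wien (u : CT) : ‖u‖ₑ ≤ wien 0 u := by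
  by_cases h : wien 0 u = ⊤
  · rw [h]; exact le_top
  have hs := summable_coeffT_of_wien le_rfl h
  have hw : wien 0 u = ENNReal.ofReal (∑' k, ‖coeffT u k‖) := by
    rw [ENNReal.ofReal_tsum_of_nonneg (fun _ => norm_nonneg _) hs]
    simp [wien]
  rw [hw, ← ofReal_norm]
  refine ENNReal.ofReal_le_ofReal ((ContinuousMap.norm_le _ (tsum_nonneg fun _ => norm_nonneg _)).2
    fun x => ?_)
  have h2 := CT.hasSum_series hs x
  rw [← Complex.norm_real, ← h2.tsum_eq]
  have e : ∀ k, ‖coeffT u k * UnitAddTorus.mFourier k x‖ = ‖coeffT u k‖ := fun k => by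
    rw [norm_mul, norm_mFourier_apply, mul_one]
  refine (norm_tsum_le_tsum_norm (by simpa only [e] using hs)).trans (by simp only [e]; rfl)

/-! ### Products and exponentials in the Wiener algebras -/

/-- Peetre's inequality, which makes the Wiener spaces of order `m ≥ 0` algebras. -/
lemma symbolX_le_mul (k l : Fin 3 → ℤ) : symbolX k ≤ 2 * (symbolX l * symbolX (k - l)) := by
  have h : lam k ≤ 2 * lam l + 2 * lam (k - l) := by
    simp only [lam, Finset.mul_sum, ← Finset.sum_add_distrib]
    refine Finset.sum_le_sum fun i _ => ?_
    push_cast [Pi.sub_apply]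
    nlinarith [sq_nonneg (2 * Real.pi * (l i : ℝ) - 2 * Real.pi * ((k i : ℝ) - l i))]
  simp only [symbolX_eq]
  nlinarith [lam_nonneg l, lam_nonneg (k - l), mul_nonneg (lam_nonneg l) (lam_nonneg (k - l))]

lemma coeffT_mul {u : CT} (hu : Summable fun k => ‖coeffT u k‖) (w : CT) (k : Fin 3 → ℤ) :
    HasSum (fun l => coeffT u l * coeffT w (k - l)) (coeffT (u * w : CT) k) := by
  let F : (Fin 3 → ℤ) → T3 → ℂ := fun l x =>
    coeffT u l * (UnitAddTorus.mFourier (-(k - l)) x * (w x : ℂ))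
  have hF : ∀ l, Integrable (F l) dx := fun l =>
    (integrable_mFourier_mul w.integrable _).const_mul _
  have hs : Summable fun l => ∫ x, ‖F l x‖ ∂dx := by
    refine Summable.of_nonneg_of_le (fun l => integral_nonneg fun _ => norm_nonneg _) (fun l => ?_)
      (hu.mul_right ‖w‖)
    refine (integral_mono (hF l).norm (integrable_const (‖coeffT u l‖ * ‖w‖)) fun x => ?_).trans ?_
    · simp only [F]
      rw [norm_mul, norm_mul, norm_mFourier_apply, one_mul, Complex.norm_real]
      exact mul_le_mul_of_nonneg_left (w.norm_coe_le_norm x) (norm_nonneg _)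
    · simp
  have h := hasSum_integral_of_summable_integral_norm hF hs
  have e1 : (fun l => coeffT u l * coeffT w (k - l)) = fun l => ∫ x, F l x ∂dx := by
    ext l
    rw [integral_const_mul]; rfl
  have e2 : coeffT (u * w : CT) k = ∫ x, ∑' l, F l x ∂dx := by
    rw [coeffT_eq]
    refine integral_congr_ae (Eventually.of_forall fun x => ?_)
    have h1 := (CT.hasSum_series hu x).mul_left (UnitAddTorus.mFourier (-k) x * (w x : ℂ))
    have h2 : HasSum (fun l => F l x) (UnitAddTorus.mFourier (-k) x * (w x : ℂ) * (u x : ℂ)) := by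
      refine h1.congr_fun fun l => ?_
      simp only [F]
      have : -(k - l) = -k + l := by abel
      rw [this, UnitAddTorus.mFourier_add]; ring
    simp only
    rw [h2.tsum_eq]
    simp; ring
  rw [e1, e2]
  exact h

lemma wien_mul_le {m : ℝ} (hm : 0 ≤ m) {u : CT} (hu : wien m u ≠ ⊤) (w : CT) :
    wien m (u * w : CT) ≤ ENNReal.ofReal (2 ^ m) * (wien m u * wien m w) := by
  have hs := summable_coeffT_of_wien hm hu
  have h1 : ∀ k, ENNReal.ofReal (symbolX k ^ m) * ‖coeffT (u * w : CT) k‖ₑ ≤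
      ∑' l, ENNReal.ofReal (2 ^ m) * ((ENNReal.ofReal (symbolX l ^ m) * ‖coeffT u l‖ₑ) *
        (ENNReal.ofReal (symbolX (k - l) ^ m) * ‖coeffT w (k - l)‖ₑ)) := fun k => by
    rw [← (coeffT_mul hs w k).tsum_eq]
    refine (mul_le_mul_right (enorm_tsum_le_tsum_enorm) _).trans ?_
    rw [← ENNReal.tsum_mul_left]
    refine ENNReal.tsum_le_tsum fun l => ?_
    have h2 : ENNReal.ofReal (symbolX k ^ m) ≤ ENNReal.ofReal (2 ^ m) *
        (ENNReal.ofReal (symbolX l ^ m) * ENNReal.ofReal (symbolX (k - l) ^ m)) := by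
      have p1 := (symbolX_pos l).le
      have p2 := (symbolX_pos (k - l)).le
      rw [← ENNReal.ofReal_mul (by positivity), ← ENNReal.ofReal_mul (by positivity),
        ← Real.mul_rpow p1 p2, ← Real.mul_rpow (by norm_num) (by positivity)]
      exact ENNReal.ofReal_le_ofReal
        (Real.rpow_le_rpow (symbolX_pos k).le (symbolX_le_mul k l) hm)
    rw [enorm_mul]
    calc _ ≤ _ := mul_le_mul_left h2 _
      _ = _ := by ring
  refine (ENNReal.tsum_le_tsum h1).trans (le_of_eq ?_)
  rw [ENNReal.tsum_comm]
  simp only [ENNReal.tsum_mul_left]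
  congr 1
  have h3 : ∀ l, ∑' k, ENNReal.ofReal (symbolX (k - l) ^ m) * ‖coeffT w (k - l)‖ₑ = wien m w :=
    fun l => (Equiv.subRight l).tsum_eq fun k => ENNReal.ofReal (symbolX k ^ m) * ‖coeffT w k‖ₑ
  simp only [h3]
  rw [ENNReal.tsum_mul_right]; rfl

/-- The pointwise exponential of a continuous function. -/
def expC (u : CT) : CT := ⟨fun x => Real.exp (u x), Real.continuous_exp.comp u.continuous⟩

@[simp] lemma expC_apply (u : CT) (x : T3) : expC u x = Real.exp (u x) := rfl

lemma expC_eq_exp (u : CT) : expC u = NormedSpace.exp u := by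
  ext x
  have h := NormedSpace.map_exp (ContinuousMap.evalAlgHom ℝ ℝ x : C(T3, ℝ) →ₐ[ℝ] ℝ)
    (continuous_eval_const x) u
  have h' : (NormedSpace.exp u) x = NormedSpace.exp (u x) := h
  rw [h', expC_apply, Real.exp_eq_exp_ℝ]

lemma expC_sub (u w : CT) : expC w - expC u = expC u * (expC (w - u) - 1) := by
  ext x
  simp only [ContinuousMap.sub_apply, ContinuousMap.mul_apply, expC_apply,
    mul_sub, ← Real.exp_add, mul_one]
  congr 2; ring

lemma hasSum_expC_sub_one (u : CT) :
    HasSum (fun n : ℕ => (((n + 1).factorial : ℝ)⁻¹) • u ^ (n + 1)) (expC u - 1) := by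
  have h := NormedSpace.exp_series_hasSum_exp' (𝕂 := ℝ) u
  rw [← hasSum_nat_add_iff' 1] at h
  rw [expC_eq_exp]
  simpa using h

lemma wien_pow_le {m : ℝ} (hm : 0 ≤ m) {u : CT} (hu : wien m u ≠ ⊤) (n : ℕ) :
    wien m (u ^ (n + 1) : CT) ≤ (ENNReal.ofReal (2 ^ m) * wien m u) ^ n * wien m u := by
  induction n with
  | zero => simp
  | succ n ih =>
    rw [pow_succ' u (n + 1)]
    calc _ ≤ _ := wien_mul_le hm hu _
      _ ≤ ENNReal.ofReal (2 ^ m) * (wien m u * ((ENNReal.ofReal (2 ^ m) * wien m u) ^ n * wien m u)) := by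
        gcongr
      _ = _ := by ring

lemma wien_hasSum_le {m : ℝ} {f : ℕ → CT} {u : CT} (h : HasSum f u) :
    wien m u ≤ ∑' n, wien m (f n) := by
  simp only [wien]
  rw [ENNReal.tsum_comm]
  refine ENNReal.tsum_le_tsum fun k => ?_
  rw [ENNReal.tsum_mul_left]
  refine mul_le_mul_right ?_ _
  have h1 := (coeffL k).hasSum h
  simp only [coeffL_apply] at h1
  rw [← h1.tsum_eq]
  exact enorm_tsum_le_tsum_enorm

lemma wien_smul (m c : ℝ) (u : CT) : wien m (c • u : CT) = ‖c‖ₑ * wien m u := by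
  simp only [wien]
  rw [← ENNReal.tsum_mul_left]
  refine tsum_congr fun k => ?_
  have : coeffT (c • u : CT) k = c * coeffT u k := coeffT_const_mul c u k
  rw [this, enorm_mul]
  have : ‖(c : ℂ)‖ₑ = ‖c‖ₑ := by rw [← ofReal_norm, ← ofReal_norm, Complex.norm_real]
  rw [this]; ring

lemma wien_add_le (m : ℝ) (u w : CT) : wien m (u + w : CT) ≤ wien m u + wien m w := by
  simp only [wien]
  rw [← ENNReal.tsum_add]
  refine ENNReal.tsum_le_tsum fun k => ?_
  have : coeffT (u + w : CT) k = coeffT u k + coeffT w k := (coeffL k).map_add u w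
  rw [this, ← mul_add]
  exact mul_le_mul_right (enorm_add_le _ _) _

/-- On bounded sets of the Wiener algebra, `u ↦ e^u - 1` is bounded by a multiple of the norm. -/
lemma wien_expC_sub_one_le {m : ℝ} (hm : 0 ≤ m) (B : ℝ≥0) : ∃ C : ℝ≥0, ∀ u : CT,
    wien m u ≤ B → wien m (expC u - 1 : CT) ≤ C * wien m u := by
  refine ⟨Real.toNNReal (Real.exp (2 ^ m * B)), fun u hu => ?_⟩
  have hu' : wien m u ≠ ⊤ := ne_top_of_le_ne_top ENNReal.coe_ne_top hu
  refine (wien_hasSum_le (hasSum_expC_sub_one u)).trans ?_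
  have h1 : ∀ n : ℕ, wien m ((((n + 1).factorial : ℝ)⁻¹) • u ^ (n + 1) : CT) ≤
      ENNReal.ofReal ((2 ^ m * B) ^ n / n.factorial) * wien m u := fun n => by
    rw [wien_smul, div_eq_inv_mul, ENNReal.ofReal_mul (by positivity), mul_assoc]
    gcongr
    · rw [Real.enorm_of_nonneg (by positivity)]
      refine ENNReal.ofReal_le_ofReal ?_
      gcongr
      exact Nat.le_succ n
    · refine (wien_pow_le hm hu' n).trans ?_
      rw [ENNReal.ofReal_pow (by positivity), ENNReal.ofReal_mul (by positivity),
        ENNReal.ofReal_coe_nnreal]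
      gcongr
  refine (ENNReal.tsum_le_tsum h1).trans ?_
  rw [ENNReal.tsum_mul_right, ← ENNReal.ofReal_tsum_of_nonneg (fun n => by positivity)
    (Real.summable_pow_div_factorial _)]
  have : ∑' n : ℕ, (2 ^ m * (B : ℝ)) ^ n / n.factorial = Real.exp (2 ^ m * B) := by
    rw [Real.exp_eq_exp_ℝ, NormedSpace.exp_eq_tsum_div]
  rw [this]; rfl

lemma wien_one (m : ℝ) : wien m (1 : CT) = 1 := by
  have h : ∀ k, coeffT (1 : CT) k = if k = 0 then 1 else 0 := fun k => by
    exact (coeffT_const 1 k).trans (by simp)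
  simp only [wien, h]
  rw [tsum_eq_single 0 fun k hk => by simp [hk]]
  simp [symbolX]

lemma wien_expC_le {m : ℝ} (hm : 0 ≤ m) (B : ℝ≥0) : ∃ C : ℝ≥0, ∀ u : CT,
    wien m u ≤ B → wien m (expC u) ≤ C := by
  obtain ⟨C, hC⟩ := wien_expC_sub_one_le hm B
  refine ⟨C * B + 1, fun u hu => ?_⟩
  have h := wien_add_le m (expC u - 1) 1
  rw [sub_add_cancel, wien_one] at h
  refine h.trans ?_
  push_cast
  gcongr
  exact (hC u hu).trans (by gcongr)

/-- The exponential is Lipschitz on bounded sets of the Wiener algebra. -/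
lemma wien_expC_sub_le {m : ℝ} (hm : 0 ≤ m) (B : ℝ≥0) : ∃ C : ℝ≥0, ∀ u w : CT,
    wien m u ≤ B → wien m (w - u : CT) ≤ B →
      wien m (expC w - expC u : CT) ≤ C * wien m (w - u : CT) := by
  obtain ⟨C1, hC1⟩ := wien_expC_sub_one_le hm B
  obtain ⟨C2, hC2⟩ := wien_expC_le hm B
  refine ⟨Real.toNNReal (2 ^ m) * (C2 * C1), fun u w hu hw => ?_⟩
  rw [expC_sub]
  refine (wien_mul_le hm (ne_top_of_le_ne_top ENNReal.coe_ne_top (hC2 u hu)) _).trans ?_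
  push_cast
  rw [mul_assoc, mul_assoc]
  have h2 := hC2 u hu
  have h1 := hC1 _ hw
  change ENNReal.ofReal (2 ^ m) * _ ≤ _
  exact mul_le_mul_right (mul_le_mul' h2 h1) _

/-! ### The maximum principle -/

lemma mFourier_add_apply (k : Fin 3 → ℤ) (x y : T3) : UnitAddTorus.mFourier k (x + y) =
    UnitAddTorus.mFourier k x * UnitAddTorus.mFourier k y := by
  simp only [UnitAddTorus.mFourier, ContinuousMap.coe_mk, ← Finset.prod_mul_distrib]
  refine Finset.prod_congr rfl fun i _ => ?_
  simp only [fourier_apply, Pi.add_apply, smul_add, AddCircle.toCircle_add, Circle.coe_mul]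

lemma mFourier_single_apply (k : Fin 3 → ℤ) (j : Fin 3) (h : ℝ) :
    UnitAddTorus.mFourier k (Pi.single j (h : UnitAddCircle)) =
      Complex.exp ((2 * Real.pi * k j * h : ℝ) * Complex.I) := by
  simp only [UnitAddTorus.mFourier, ContinuousMap.coe_mk]
  rw [Finset.prod_eq_single j]
  · rw [Pi.single_eq_same, fourier_coe_apply]
    congr 1; push_cast; ring
  · intro i _ hi
    rw [Pi.single_eq_of_ne hi, fourier_eval_zero]
  · simp

/-- The symmetric second difference of `e^{iθ}`, written with `sinc` so that the limit of the
difference quotient can be read off. -/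
lemma exp_second_difference (a h : ℝ) :
    Complex.exp ((a * h : ℝ) * Complex.I) + Complex.exp ((a * (-h) : ℝ) * Complex.I) - 2 =
      ((-(h ^ 2 * (a ^ 2 * Real.sinc (a * h / 2) ^ 2)) : ℝ) : ℂ) := by
  have h1 : Complex.exp ((a * h : ℝ) * Complex.I) + Complex.exp ((a * (-h) : ℝ) * Complex.I) =
      ((2 * Real.cos (a * h) : ℝ) : ℂ) := by
    have := Complex.two_cos ((a * h : ℝ) : ℂ)
    push_cast at this ⊢
    rw [this]; congr 2; ring
  rw [h1]
  have h2 : Real.cos (a * h) = 1 - 2 * Real.sin (a * h / 2) ^ 2 := by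
    have := Real.cos_sq' (a * h / 2)
    have h3 := Real.cos_two_mul (a * h / 2)
    rw [show 2 * (a * h / 2) = a * h by ring] at h3
    linarith
  have h3 : Real.sin (a * h / 2) = a * h / 2 * Real.sinc (a * h / 2) := by
    by_cases h0 : a * h / 2 = 0
    · simp [h0]
    · rw [Real.sinc_of_ne_zero h0, mul_div_cancel₀ _ h0]
  have h4 : 2 * Real.cos (a * h) - 2 = -(h ^ 2 * (a ^ 2 * Real.sinc (a * h / 2) ^ 2)) := by
    rw [h2, h3]; ring
  rw [← h4]; push_cast; ring

/-- At a maximum point of `u` one has `-Δu ≥ 0`; here `g = -Δu` is given through its Fourier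
coefficients. -/
lemma neg_laplacian_nonneg_of_isMax {u g : CT} (hu : wien 1 u ≠ ⊤)
    (hg : ∀ k, coeffT g k = lam k * coeffT u k) {x₀ : T3} (hx : ∀ x, u x ≤ u x₀) : 0 ≤ g x₀ := by
  have hs := summable_coeffT_of_wien zero_le_one hu
  have hs1 : Summable fun k => lam k * ‖coeffT u k‖ := by
    have h := ENNReal.summable_toReal hu
    refine Summable.of_nonneg_of_le (fun k => mul_nonneg (lam_nonneg k) (norm_nonneg _))
      (fun k => ?_) h
    rw [ENNReal.toReal_mul, Real.rpow_one, ENNReal.toReal_ofReal (symbolX_pos k).le, symbolX_eq]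
    simp only [toReal_enorm]
    nlinarith [norm_nonneg (coeffT u k)]
  let S : (Fin 3 → ℤ) → ℝ → ℝ := fun k h =>
    ∑ j, (2 * Real.pi * k j) ^ 2 * Real.sinc (2 * Real.pi * k j * h / 2) ^ 2
  have hS0 : ∀ k h, 0 ≤ S k h := fun k h => Finset.sum_nonneg fun j _ => by positivity
  have hS1 : ∀ k h, S k h ≤ lam k := fun k h => Finset.sum_le_sum fun j _ => by
    refine mul_le_of_le_one_right (sq_nonneg _) ?_
    rw [sq_le_one_iff_abs_le_one]
    exact Real.abs_sinc_le_one _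
  -- the sum over the axes of the second differences of `u` at `x₀` with step `h` is `-h² Φ h`, and the
  -- continuous function `Φ` takes the value `g x₀` at `0`
  let Φ : ℝ → ℂ := fun h => ∑' k, (S k h : ℂ) * (coeffT u k * UnitAddTorus.mFourier k x₀)
  have hb : ∀ k h, ‖(S k h : ℂ) * (coeffT u k * UnitAddTorus.mFourier k x₀)‖ ≤
      lam k * ‖coeffT u k‖ := fun k h => by
    rw [norm_mul, norm_mul, norm_mFourier_apply, mul_one, Complex.norm_real,
      Real.norm_of_nonneg (hS0 k h)]
    exact mul_le_mul_of_nonneg_right (hS1 k h) (norm_nonneg _)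
  have hΦc : Continuous Φ := by
    refine continuous_tsum (fun k => ?_) hs1 hb
    refine Continuous.mul (Complex.continuous_ofReal.comp ?_) continuous_const
    refine continuous_finsetSum _ fun j _ => continuous_const.mul ((Real.continuous_sinc.comp ?_).pow 2)
    fun_prop
  have hΦ : ∀ h, ((∑ j : Fin 3, (u (x₀ + Pi.single j ((h : ℝ) : UnitAddCircle)) +
      u (x₀ + Pi.single j ((-h : ℝ) : UnitAddCircle)) - 2 * u x₀) : ℝ) : ℂ) =
      -(h : ℂ) ^ 2 * Φ h := fun h => by
    have h1 := CT.hasSum_series hs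
    have h2 : ∀ j : Fin 3, HasSum (fun k => coeffT u k * UnitAddTorus.mFourier k x₀ *
        ((-(h ^ 2 * ((2 * Real.pi * k j) ^ 2 *
          Real.sinc (2 * Real.pi * k j * h / 2) ^ 2)) : ℝ) : ℂ))
        ((u (x₀ + Pi.single j ((h : ℝ) : UnitAddCircle)) : ℂ) +
          u (x₀ + Pi.single j ((-h : ℝ) : UnitAddCircle)) - 2 * u x₀) := fun j => by
      have h3 := ((h1 (x₀ + Pi.single j ((h : ℝ) : UnitAddCircle))).add
        (h1 (x₀ + Pi.single j ((-h : ℝ) : UnitAddCircle)))).sub ((h1 x₀).mul_left 2)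
      refine h3.congr_fun fun k => ?_
      rw [← exp_second_difference, mFourier_add_apply, mFourier_add_apply, mFourier_single_apply,
        mFourier_single_apply]
      ring
    have h4 := hasSum_sum fun (j : Fin 3) (_ : j ∈ Finset.univ) => h2 j
    push_cast
    rw [← h4.tsum_eq, ← tsum_mul_left]
    refine tsum_congr fun k => ?_
    simp only [S]
    push_cast
    rw [← Finset.mul_sum, Finset.sum_neg_distrib, ← Finset.mul_sum]
    ring
  have hpos : ∀ h, h ≠ 0 → 0 ≤ (Φ h).re := fun h h0 => by
    have h1 := congrArg Complex.re (hΦ h)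
    have h2 : (-(h : ℂ) ^ 2 * Φ h).re = -(h ^ 2 * (Φ h).re) := by
      have : -(h : ℂ) ^ 2 = ((-h ^ 2 : ℝ) : ℂ) := by push_cast; ring
      rw [this, Complex.re_ofReal_mul]; ring
    rw [h2, Complex.ofReal_re] at h1
    have h3 : ∑ j : Fin 3, (u (x₀ + Pi.single j ((h : ℝ) : UnitAddCircle)) +
        u (x₀ + Pi.single j ((-h : ℝ) : UnitAddCircle)) - 2 * u x₀) ≤ 0 :=
      Finset.sum_nonpos fun j _ => by
        linarith [hx (x₀ + Pi.single j ((h : ℝ) : UnitAddCircle)),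
          hx (x₀ + Pi.single j ((-h : ℝ) : UnitAddCircle))]
    have h4 : 0 < h ^ 2 := by positivity
    by_contra hneg
    push Not at hneg
    nlinarith
  have h0 : 0 ≤ (Φ 0).re := by
    have ht : Tendsto (fun h => (Φ h).re) (𝓝[≠] 0) (𝓝 (Φ 0).re) :=
      ((Complex.continuous_re.comp hΦc).tendsto 0).mono_left nhdsWithin_le_nhds
    exact ge_of_tendsto ht (eventually_nhdsWithin_of_forall hpos)
  have e : Φ 0 = g x₀ := by
    have hsg : Summable fun k => ‖coeffT g k‖ := by
      refine hs1.congr fun k => ?_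
      rw [hg, norm_mul, Complex.norm_real, Real.norm_of_nonneg (lam_nonneg k)]
    rw [← (CT.hasSum_series hsg x₀).tsum_eq]
    refine tsum_congr fun k => ?_
    rw [hg]
    simp [S, lam]
    ring
  rw [e, Complex.ofReal_re] at h0
  exact h0

/-! ### Trigonometric polynomials -/

lemma integral_mFourier (k : Fin 3 → ℤ) :
    ∫ x, UnitAddTorus.mFourier k x ∂dx = if k = 0 then 1 else 0 := by
  have h := coeffT_const 1 (-k)
  rw [coeffT_eq, neg_neg] at h
  simpa using h

lemma two_mul_re_mFourier (k : Fin 3 → ℤ) (x : T3) :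
    (2 : ℂ) * ((UnitAddTorus.mFourier k x).re : ℂ) =
      UnitAddTorus.mFourier k x + UnitAddTorus.mFourier (-k) x := by
  rw [UnitAddTorus.mFourier_neg, Complex.add_conj]
  push_cast; ring

lemma two_mul_im_mFourier (k : Fin 3 → ℤ) (x : T3) :
    (2 : ℂ) * ((UnitAddTorus.mFourier k x).im : ℂ) =
      -Complex.I * (UnitAddTorus.mFourier k x - UnitAddTorus.mFourier (-k) x) := by
  rw [UnitAddTorus.mFourier_neg, Complex.sub_conj]
  push_cast
  linear_combination (2 * ((UnitAddTorus.mFourier k x).im : ℂ)) * Complex.I_sq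

/-- The real part of a continuous complex function. -/
def reC (f : C(T3, ℂ)) : CT := ⟨fun x => (f x).re, Complex.continuous_re.comp f.continuous⟩

/-- The imaginary part of a continuous complex function. -/
def imC (f : C(T3, ℂ)) : CT := ⟨fun x => (f x).im, Complex.continuous_im.comp f.continuous⟩

@[simp] lemma reC_apply (f : C(T3, ℂ)) (x : T3) : reC f x = (f x).re := rfl
@[simp] lemma imC_apply (f : C(T3, ℂ)) (x : T3) : imC f x = (f x).im := rfl

lemma integrable_C (f : C(T3, ℂ)) : Integrable f dx :=
  f.continuous.integrable_of_hasCompactSupport (HasCompactSupport.of_compactSpace _)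

lemma wien_ne_top_of_finite {m : ℝ} {u : T3 → ℝ} (s : Finset (Fin 3 → ℤ))
    (h : ∀ k ∉ s, coeffT u k = 0) : wien m u ≠ ⊤ := by
  rw [wien, tsum_eq_sum (s := s) fun k hk => by simp [h k hk]]
  exact ENNReal.sum_ne_top.2 fun k _ => ENNReal.mul_ne_top ENNReal.ofReal_ne_top enorm_ne_top

lemma wien_reC_mFourier_ne_top (m : ℝ) (k : Fin 3 → ℤ) :
    wien m (reC (UnitAddTorus.mFourier k)) ≠ ⊤ := by
  refine wien_ne_top_of_finite {k, -k} fun l hl => ?_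
  have h : (2 : ℂ) * coeffT (reC (UnitAddTorus.mFourier k)) l = 0 := by
    rw [coeffT_eq, ← integral_const_mul]
    have e : ∀ x, (2 : ℂ) * (UnitAddTorus.mFourier (-l) x *
        ((reC (UnitAddTorus.mFourier k) x : ℝ) : ℂ)) =
        UnitAddTorus.mFourier (k - l) x + UnitAddTorus.mFourier (-k - l) x := fun x => by
      rw [sub_eq_add_neg, sub_eq_add_neg, UnitAddTorus.mFourier_add, UnitAddTorus.mFourier_add,
        reC_apply]
      linear_combination (UnitAddTorus.mFourier (-l) x) * two_mul_re_mFourier k x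
    simp only [e]
    rw [integral_add (integrable_C _) (integrable_C _), integral_mFourier, integral_mFourier]
    simp only [Finset.mem_insert, Finset.mem_singleton, not_or] at hl
    rw [if_neg (sub_ne_zero.2 (Ne.symm hl.1)), if_neg (sub_ne_zero.2 (Ne.symm hl.2)), add_zero]
  simpa using h

lemma wien_imC_mFourier_ne_top (m : ℝ) (k : Fin 3 → ℤ) :
    wien m (imC (UnitAddTorus.mFourier k)) ≠ ⊤ := by
  refine wien_ne_top_of_finite {k, -k} fun l hl => ?_
  have h : (2 : ℂ) * coeffT (imC (UnitAddTorus.mFourier k)) l = 0 := by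
    rw [coeffT_eq, ← integral_const_mul]
    have e : ∀ x, (2 : ℂ) * (UnitAddTorus.mFourier (-l) x *
        ((imC (UnitAddTorus.mFourier k) x : ℝ) : ℂ)) =
        -Complex.I * (UnitAddTorus.mFourier (k - l) x - UnitAddTorus.mFourier (-k - l) x) :=
        fun x => by
      rw [sub_eq_add_neg k, sub_eq_add_neg (-k), UnitAddTorus.mFourier_add, UnitAddTorus.mFourier_add,
        imC_apply]
      linear_combination (UnitAddTorus.mFourier (-l) x) * two_mul_im_mFourier k x
    simp only [e]
    rw [integral_const_mul, integral_sub (integrable_C _) (integrable_C _), integral_mFourier,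
      integral_mFourier]
    simp only [Finset.mem_insert, Finset.mem_singleton, not_or] at hl
    rw [if_neg (sub_ne_zero.2 (Ne.symm hl.1)), if_neg (sub_ne_zero.2 (Ne.symm hl.2)), sub_zero,
      mul_zero]
  simpa using h

/-- Functions with finite Wiener norm are uniformly dense. -/
lemma exists_wien_approx (m : ℝ) (f : CT) {ε : ℝ} (hε : 0 < ε) :
    ∃ p : CT, wien m p ≠ ⊤ ∧ ∀ x, |p x - f x| < ε := by
  let F : C(T3, ℂ) := ⟨fun x => (f x : ℂ), Complex.continuous_ofReal.comp f.continuous⟩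
  have hF : F ∈ (Submodule.span ℂ (range (UnitAddTorus.mFourier (d := Fin 3)))).topologicalClosure := by
    rw [UnitAddTorus.span_mFourier_closure_eq_top]; trivial
  obtain ⟨q, hq, hqF⟩ := Metric.mem_closure_iff.1 hF ε hε
  refine ⟨reC q, ?_, fun x => ?_⟩
  · have key : wien m (reC q) ≠ ⊤ ∧ wien m (imC q) ≠ ⊤ := by
      refine Submodule.span_induction (p := fun q _ => wien m (reC q) ≠ ⊤ ∧ wien m (imC q) ≠ ⊤)
        ?_ ?_ ?_ ?_ hq
      · rintro _ ⟨k, rfl⟩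
        exact ⟨wien_reC_mFourier_ne_top m k, wien_imC_mFourier_ne_top m k⟩
      · have h0 : wien m (0 : CT) ≠ ⊤ := wien_ne_top_of_finite ∅ fun k _ => (coeffL k).map_zero
        exact ⟨h0, h0⟩
      · intro a b _ _ ha hb
        have e1 : reC (a + b) = reC a + reC b := by ext; simp
        have e2 : imC (a + b) = imC a + imC b := by ext; simp
        rw [e1, e2]
        exact ⟨ne_top_of_le_ne_top (ENNReal.add_ne_top.2 ⟨ha.1, hb.1⟩) (wien_add_le m _ _),
          ne_top_of_le_ne_top (ENNReal.add_ne_top.2 ⟨ha.2, hb.2⟩) (wien_add_le m _ _)⟩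
      · intro c a _ ha
        have e1 : reC (c • a) = c.re • reC a + (-c.im) • imC a := by ext; simp; ring
        have e2 : imC (c • a) = c.re • imC a + c.im • reC a := by ext; simp
        have hm : ∀ (d : ℝ) (w : CT), wien m w ≠ ⊤ → wien m (d • w : CT) ≠ ⊤ := fun d w hw => by
          rw [wien_smul]; exact ENNReal.mul_ne_top enorm_ne_top hw
        rw [e1, e2]
        exact ⟨ne_top_of_le_ne_top (ENNReal.add_ne_top.2 ⟨hm _ _ ha.1, hm _ _ ha.2⟩)
            (wien_add_le m _ _),
          ne_top_of_le_ne_top (ENNReal.add_ne_top.2 ⟨hm _ _ ha.2, hm _ _ ha.1⟩)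
            (wien_add_le m _ _)⟩
    exact key.1
  · rw [dist_comm, dist_eq_norm] at hqF
    have h1 := (q - F).norm_coe_le_norm x
    have h2 : reC q x - f x = ((q - F) x).re := by simp [F]
    rw [h2]
    exact ((Complex.abs_re_le_norm _).trans h1).trans_lt hqF

/-! ### The resolvent of the Laplacian on continuous functions -/

lemma sobSq_zero {u : T3 → ℝ} (hu : MemLp u 2 dx) :
    sobSq 0 u = ENNReal.ofReal (∫ x, u x ^ 2 ∂dx) := by
  have h := hasSum_sq_coeffT hu
  rw [← h.tsum_eq, ENNReal.ofReal_tsum_of_nonneg (fun _ => sq_nonneg _) h.summable]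
  refine tsum_congr fun k => ?_
  rw [Real.rpow_zero, ENNReal.ofReal_one, one_mul, ENNReal.ofReal_pow (norm_nonneg _), ofReal_norm]

lemma integral_sq_le_norm_sq (u : CT) : ∫ x, u x ^ 2 ∂dx ≤ ‖u‖ ^ 2 := by
  have h : ∀ x, u x ^ 2 ≤ ‖u‖ ^ 2 := fun x => by
    rw [← sq_abs]; exact pow_le_pow_left₀ (abs_nonneg _) (u.norm_coe_le_norm x) 2
  refine (integral_mono u.memLp.integrable_sq (integrable_const (‖u‖ ^ 2)) h).trans (by simp)

lemma sobNorm_zero_le (u : CT) : sobNorm 0 u ≤ ‖u‖ₑ := by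
  rw [← ENNReal.pow_le_pow_left_iff (two_ne_zero), sobNorm_sq, sobSq_zero u.memLp, ← ofReal_norm,
    ← ENNReal.ofReal_pow (norm_nonneg _)]
  exact ENNReal.ofReal_le_ofReal (integral_sq_le_norm_sq u)

lemma sobNorm_zero_eq {u : T3 → ℝ} (hu : MemLp u 2 dx) :
    sobNorm 0 u = ENNReal.ofReal (Real.sqrt (∫ x, u x ^ 2 ∂dx)) := by
  rw [sobNorm, sobSq_zero hu, ENNReal.ofReal_rpow_of_nonneg
    (integral_nonneg fun _ => sq_nonneg _) (by norm_num), Real.sqrt_eq_rpow]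

lemma coeff_div_le {l : ℝ} (hl : 0 < l) (z : ℂ) (k : Fin 3 → ℤ) :
    ‖z / ((l + lam k : ℝ) : ℂ)‖ ≤ max 1 l⁻¹ * (symbolX k ^ (-1 : ℝ) * ‖z‖) := by
  have h0 := lam_nonneg k
  have hp : 0 < l + lam k := by linarith
  rw [norm_div, Complex.norm_real, Real.norm_of_nonneg hp.le, div_eq_inv_mul, ← mul_assoc,
    Real.rpow_neg_one]
  refine mul_le_mul_of_nonneg_right ?_ (norm_nonneg _)
  have h1 : symbolX k ≤ max 1 l⁻¹ * (l + lam k) := by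
    rw [symbolX_eq, mul_add]
    have a : 1 ≤ max 1 l⁻¹ * l := by
      calc (1 : ℝ) = l⁻¹ * l := (inv_mul_cancel₀ hl.ne').symm
        _ ≤ _ := mul_le_mul_of_nonneg_right (le_max_right _ _) hl.le
    have b : lam k ≤ max 1 l⁻¹ * lam k := le_mul_of_one_le_left h0 (le_max_left _ _)
    linarith
  rw [inv_le_comm₀ hp (by have := symbolX_pos k; positivity), mul_inv, inv_inv, inv_mul_le_iff₀ (by positivity)]
  exact h1

lemma wien_neg_one_ne_top (f : CT) : wien (-1) f ≠ ⊤ := by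
  refine ne_top_of_le_ne_top ?_ (wien_le_sobNorm (m := -1) (σ := 0) (by norm_num) f)
  exact ENNReal.mul_ne_top ENNReal.coe_ne_top (ne_top_of_le_ne_top enorm_ne_top (sobNorm_zero_le f))

lemma exists_resolvent {l : ℝ} (hl : 0 < l) (f : CT) :
    ∃ u : CT, ∀ k, coeffT u k = coeffT f k / ((l + lam k : ℝ) : ℂ) := by
  refine exists_CT_of_coeff ?_ fun k => ?_
  · have h := ENNReal.summable_toReal (wien_neg_one_ne_top f)
    refine Summable.of_nonneg_of_le (fun k => norm_nonneg _) (fun k => coeff_div_le hl _ k) ?_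
    refine Summable.mul_left _ (h.congr fun k => ?_)
    rw [ENNReal.toReal_mul, ENNReal.toReal_ofReal (Real.rpow_nonneg (symbolX_pos _).le _),
      toReal_enorm]
  · have : lam (-k) = lam k := by simp [lam]
    rw [coeffT_neg_index, map_div₀, Complex.conj_ofReal, this]

/-- The resolvent `(l - Δ)⁻¹` applied to a continuous function. -/
def resFun {l : ℝ} (hl : 0 < l) (f : CT) : CT := (exists_resolvent hl f).choose

lemma coeffT_resFun {l : ℝ} (hl : 0 < l) (f : CT) (k : Fin 3 → ℤ) :
    coeffT (resFun hl f) k = coeffT f k / ((l + lam k : ℝ) : ℂ) :=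
  (exists_resolvent hl f).choose_spec k

lemma l_add_lam_ne {l : ℝ} (hl : 0 < l) (k : Fin 3 → ℤ) : ((l + lam k : ℝ) : ℂ) ≠ 0 := by
  have := lam_nonneg k
  exact Complex.ofReal_ne_zero.2 (by linarith)

lemma wien_resFun_le {l : ℝ} (hl : 0 < l) (m : ℝ) (f : CT) :
    wien (m + 1) (resFun hl f) ≤ ENNReal.ofReal (max 1 l⁻¹) * wien m f := by
  rw [wien, wien, ← ENNReal.tsum_mul_left]
  refine ENNReal.tsum_le_tsum fun k => ?_
  rw [coeffT_resFun, ← ofReal_norm, ← ofReal_norm]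
  have hS := Real.rpow_nonneg (symbolX_pos k).le
  rw [← ENNReal.ofReal_mul (hS _), ← ENNReal.ofReal_mul (hS _), ← ENNReal.ofReal_mul (by positivity)]
  refine ENNReal.ofReal_le_ofReal ?_
  refine (mul_le_mul_of_nonneg_left (coeff_div_le hl _ k) (hS _)).trans (le_of_eq ?_)
  have : symbolX k ^ (m + 1) * symbolX k ^ (-1 : ℝ) = symbolX k ^ m := by
    rw [← Real.rpow_add (symbolX_pos k)]; congr 1; ring
  rw [← this]; ring

lemma exists_norm_resFun_le {l : ℝ} (hl : 0 < l) : ∃ C : ℝ, ∀ f : CT, ‖resFun hl f‖ ≤ C * ‖f‖ := by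
  refine ⟨max 1 l⁻¹ * embConst (-1) 0, fun f => ?_⟩
  have h1 := (enorm_le_wien (resFun hl f)).trans ((neg_add_cancel (1 : ℝ)) ▸ wien_resFun_le hl (-1) f)
  have h2 := h1.trans (mul_le_mul_right ((wien_le_sobNorm (m := -1) (σ := 0) (by norm_num) f).trans
    (mul_le_mul_right (sobNorm_zero_le f) _)) _)
  rw [← ofReal_norm, ← ofReal_norm, ← ENNReal.ofReal_coe_nnreal (p := embConst (-1) 0),
    ← ENNReal.ofReal_mul (by positivity), ← ENNReal.ofReal_mul (by positivity),
    ENNReal.ofReal_le_ofReal_iff (by positivity)] at h2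
  rwa [mul_assoc]

/-- The resolvent `(l - Δ)⁻¹` as a bounded operator on the space of continuous functions. -/
def res {l : ℝ} (hl : 0 < l) : CT →L[ℝ] CT :=
  LinearMap.mkContinuous
    { toFun := resFun hl
      map_add' := fun f g => CT.ext_of_coeffT fun k => by
        rw [← coeffL_apply, ← coeffL_apply, map_add]
        simp only [coeffL_apply]
        rw [coeffT_resFun, coeffT_resFun, coeffT_resFun, ← add_div]
        congr 1
        exact (coeffL k).map_add f g
      map_smul' := fun c f => CT.ext_of_coeffT fun k => by
        rw [← coeffL_apply, ← coeffL_apply, map_smul]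
        simp only [coeffL_apply, RingHom.id_apply]
        rw [coeffT_resFun, coeffT_resFun, ← smul_div_assoc]
        congr 1
        exact (coeffL k).map_smul c f }
    (exists_norm_resFun_le hl).choose (exists_norm_resFun_le hl).choose_spec

lemma coeffT_res {l : ℝ} (hl : 0 < l) (f : CT) (k : Fin 3 → ℤ) :
    coeffT (res hl f) k = coeffT f k / ((l + lam k : ℝ) : ℂ) := coeffT_resFun hl f k

lemma lam_mul_coeffT_res {l : ℝ} (hl : 0 < l) (f : CT) (k : Fin 3 → ℤ) :
    lam k * coeffT (res hl f) k = coeffT (f - l • res hl f : CT) k := by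
  have h : coeffT (f - l • res hl f : CT) k = coeffT f k - l * coeffT (res hl f) k := by
    have := (coeffL k).map_sub f (l • res hl f)
    rw [map_smul] at this
    simpa using this
  rw [h, coeffT_res]
  have := l_add_lam_ne hl k
  field_simp
  push_cast
  ring

lemma eq_res_of_coeff {l : ℝ} (hl : 0 < l) {u f : CT}
    (h : ∀ k, lam k * coeffT u k = coeffT f k) : u = res hl (l • u + f) := by
  refine CT.ext_of_coeffT fun k => ?_
  have e : coeffT (l • u + f : CT) k = l * coeffT u k + coeffT f k := by
    have := (coeffL k).map_add (l • u) f
    rw [map_smul] at this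
    simpa using this
  rw [coeffT_res, e, ← h, eq_div_iff (l_add_lam_ne hl k)]
  push_cast; ring

/-- The resolvent is positive, in the form of an upper bound. -/
lemma res_le {l : ℝ} (hl : 0 < l) {f : CT} {b : ℝ} (hf : ∀ x, f x ≤ b) (x : T3) :
    res hl f x ≤ b / l := by
  -- if `p` is regular, then so is the resolvent, and the maximum principle applies to it; the general
  -- case follows by approximation
  have hreg : ∀ (p : CT) (c : ℝ), wien 0 p ≠ ⊤ → (∀ x, p x ≤ c) → ∀ x, res hl p x ≤ c / l := by
    intro p c hp hc x
    obtain ⟨x₀, hx₀⟩ := (res hl p).continuous.exists_forall_ge_of_hasCompactSupport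
      (HasCompactSupport.of_compactSpace _)
    have hw : wien 1 (res hl p) ≠ ⊤ := by
      have h1 := wien_resFun_le hl 0 p
      rw [zero_add] at h1
      exact ne_top_of_le_ne_top (ENNReal.mul_ne_top ENNReal.ofReal_ne_top hp) h1
    have h2 := neg_laplacian_nonneg_of_isMax hw (fun k => (lam_mul_coeffT_res hl p k).symm) hx₀
    have h3 : 0 ≤ p x₀ - l * res hl p x₀ := h2
    refine (hx₀ x).trans ?_
    rw [le_div_iff₀ hl]
    linarith [hc x₀]
  refine le_of_forall_pos_le_add fun δ hδ => ?_
  set N := ‖res hl‖ with hN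
  have hN0 : 0 ≤ N := (res hl).opNorm_nonneg
  obtain ⟨p, hp, hpf⟩ := exists_wien_approx 0 f (ε := δ / (1 / l + N + 1)) (by positivity)
  set ε := δ / (1 / l + N + 1) with hε
  have hε0 : 0 < ε := by positivity
  have h1 := hreg p (b + ε) hp (fun y => by linarith [(abs_lt.1 (hpf y)).2, hf y]) x
  have h2 : ‖p - f‖ ≤ ε := (ContinuousMap.norm_le _ hε0.le).2 fun y => (hpf y).le
  have h3 : |res hl p x - res hl f x| ≤ N * ε := by
    have h4 := ((res hl) (p - f)).norm_coe_le_norm x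
    rw [map_sub] at h4
    refine h4.trans ?_
    rw [← map_sub]
    exact ((res hl).le_opNorm _).trans (mul_le_mul_of_nonneg_left h2 hN0)
  have h5 : ε * (1 / l + N + 1) = δ := by rw [hε]; field_simp
  have h6 : (b + ε) / l = b / l + ε * (1 / l) := by ring
  have := (abs_le.1 h3).1
  nlinarith

lemma le_res {l : ℝ} (hl : 0 < l) {f : CT} {a : ℝ} (hf : ∀ x, a ≤ f x) (x : T3) :
    a / l ≤ res hl f x := by
  have h := res_le hl (f := -f) (b := -a) (fun y => by simpa using hf y) x
  rw [map_neg] at h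
  have h' : -(res hl f x) ≤ -a / l := h
  rw [neg_div] at h'
  linarith

lemma norm_res_apply_le {l : ℝ} (hl : 0 < l) (f : CT) : ‖res hl f‖ ≤ ‖f‖ / l := by
  refine (ContinuousMap.norm_le _ (by positivity)).2 fun x => ?_
  rw [Real.norm_eq_abs, abs_le]
  have h := fun x => abs_le.1 (f.norm_coe_le_norm x)
  constructor
  · rw [← neg_div]; exact le_res hl (fun x => (h x).1) x
  · exact res_le hl (fun x => (h x).2) x

/-! ### The `L²` pairing and the Dirichlet form -/

/-- The `L²` pairing of two continuous functions. -/
def ip (u w : CT) : ℝ := ∫ x, u x * w x ∂dx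

lemma integrable_mul (u w : CT) : Integrable (fun x => u x * w x) dx := (u * w : CT).integrable

lemma ip_comm (u w : CT) : ip u w = ip w u := by simp only [ip, mul_comm]

lemma ip_add_left (u v w : CT) : ip (u + v) w = ip u w + ip v w := by
  simp only [ip]
  rw [← integral_add (integrable_mul _ _) (integrable_mul _ _)]
  congr 1; ext x; simp [add_mul]

lemma ip_sub_left (u v w : CT) : ip (u - v) w = ip u w - ip v w := by
  simp only [ip]
  rw [← integral_sub (integrable_mul _ _) (integrable_mul _ _)]
  congr 1; ext x; simp [sub_mul]

lemma ip_smul_left (c : ℝ) (u w : CT) : ip (c • u) w = c * ip u w := by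
  simp only [ip]
  rw [← integral_const_mul]
  congr 1; ext x; simp [mul_assoc]

lemma ip_add_right (u v w : CT) : ip w (u + v) = ip w u + ip w v := by
  rw [ip_comm, ip_add_left, ip_comm u, ip_comm v]

lemma ip_sub_right (u v w : CT) : ip w (u - v) = ip w u - ip w v := by
  rw [ip_comm, ip_sub_left, ip_comm u, ip_comm v]

lemma ip_smul_right (c : ℝ) (u w : CT) : ip w (c • u) = c * ip w u := by
  rw [ip_comm, ip_smul_left, ip_comm u]

lemma ip_mono {u v w z : CT} (h : ∀ x, u x * v x ≤ w x * z x) : ip u v ≤ ip w z :=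
  integral_mono (integrable_mul _ _) (integrable_mul _ _) h

lemma ip_self_nonneg (u : CT) : 0 ≤ ip u u := integral_nonneg fun _ => mul_self_nonneg _

/-- The `L²` norm of a continuous function. -/
def nrm (u : CT) : ℝ := Real.sqrt (ip u u)

lemma nrm_nonneg (u : CT) : 0 ≤ nrm u := Real.sqrt_nonneg _

lemma nrm_sq (u : CT) : nrm u ^ 2 = ip u u := Real.sq_sqrt (ip_self_nonneg u)

lemma abs_ip_le (u w : CT) : |ip u w| ≤ nrm u * nrm w := by
  have h : ∀ t : ℝ, 0 ≤ ip w w * (t * t) + 2 * ip u w * t + ip u u := fun t => by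
    have := ip_self_nonneg (u + t • w)
    rw [ip_add_left, ip_add_right, ip_add_right, ip_smul_left, ip_smul_left, ip_smul_right,
      ip_smul_right, ip_comm w u] at this
    linarith
  have hd := discrim_le_zero h
  rw [discrim] at hd
  rw [nrm, nrm, ← Real.sqrt_mul (ip_self_nonneg u)]
  refine Real.abs_le_sqrt ?_
  nlinarith

lemma nrm_le_norm (u : CT) : nrm u ≤ ‖u‖ := by
  refine Real.sqrt_le_iff.2 ⟨norm_nonneg _, ?_⟩
  have := integral_sq_le_norm_sq u
  simpa only [ip, ← sq] using this

lemma nrm_add_le (u w : CT) : nrm (u + w) ≤ nrm u + nrm w := by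
  refine Real.sqrt_le_iff.2 ⟨add_nonneg (nrm_nonneg _) (nrm_nonneg _), ?_⟩
  rw [ip_add_left, ip_add_right, ip_add_right, ip_comm w u, ← nrm_sq, ← nrm_sq]
  nlinarith [(abs_le.1 (abs_ip_le u w)).2]

lemma nrm_smul (c : ℝ) (u : CT) : nrm (c • u) = |c| * nrm u := by
  rw [nrm, ip_smul_left, ip_smul_right, ← mul_assoc, Real.sqrt_mul (mul_self_nonneg c),
    Real.sqrt_mul_self_eq_abs, nrm]

lemma nrm_le_of_abs_le {u w : CT} {c : ℝ} (hc : 0 ≤ c) (h : ∀ x, |u x| ≤ c * |w x|) :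
    nrm u ≤ c * nrm w := by
  have e : c * nrm w = nrm (c • w) := by rw [nrm_smul, abs_of_nonneg hc]
  rw [e]
  refine Real.sqrt_le_sqrt (ip_mono fun x => ?_)
  have h1 := h x
  have h2 : c * |w x| = |c * w x| := by rw [abs_mul, abs_of_nonneg hc]
  rw [h2] at h1
  have := sq_le_sq.2 h1
  simpa [sq] using this

lemma eq_zero_of_nrm_eq_zero {u : CT} (h : nrm u = 0) : u = 0 := by
  have h1 : ∫ x, u x ^ 2 ∂dx = 0 := by
    have := nrm_sq u
    rw [h] at this
    simpa [ip, sq] using this.symm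
  rw [integral_eq_zero_iff_of_nonneg (fun x => sq_nonneg _) u.memLp.integrable_sq] at h1
  have h2 : (u : T3 → ℝ) =ᵐ[dx] (0 : CT) := by
    filter_upwards [h1] with x hx
    exact pow_eq_zero_iff two_ne_zero |>.1 hx
  exact DFunLike.coe_injective (u.continuous.ae_eq_iff_eq (μ := dx) (0 : CT).continuous |>.1 h2)

lemma sobNorm_zero_eq_nrm (u : CT) : sobNorm 0 u = ENNReal.ofReal (nrm u) := by
  rw [sobNorm_zero_eq u.memLp, nrm, ip]; simp only [sq]

/-- `-Δu = g`, expressed by Fourier coefficients. -/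
def IsNegLap (u g : CT) : Prop := ∀ k, lam k * coeffT u k = coeffT g k

lemma coeffT_sub' (u w : CT) (k) : coeffT (u - w : CT) k = coeffT u k - coeffT w k :=
  (coeffL k).map_sub u w

lemma coeffT_add' (u w : CT) (k) : coeffT (u + w : CT) k = coeffT u k + coeffT w k :=
  (coeffL k).map_add u w

lemma coeffT_smul' (c : ℝ) (u : CT) (k) : coeffT (c • u : CT) k = c * coeffT u k :=
  coeffT_const_mul c u k

lemma IsNegLap.sub {u g w h : CT} (h1 : IsNegLap u g) (h2 : IsNegLap w h) :
    IsNegLap (u - w) (g - h) := fun k => by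
  rw [coeffT_sub', coeffT_sub', mul_sub, h1 k, h2 k]

lemma IsNegLap.smul {u g : CT} (h : IsNegLap u g) (c : ℝ) : IsNegLap (c • u) (c • g) := fun k => by
  rw [coeffT_smul', coeffT_smul', ← h k]; ring

lemma isNegLap_res {l : ℝ} (hl : 0 < l) (f : CT) : IsNegLap (res hl f) (f - l • res hl f) :=
  lam_mul_coeffT_res hl f

/-- Symmetry of the Laplacian. -/
lemma IsNegLap.ip_eq {u g w h : CT} (h1 : IsNegLap u g) (h2 : IsNegLap w h) :
    ip u h = ip g w := by
  have e1 := hasSum_coeffT_mul u.memLp h.memLp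
  have e2 := hasSum_coeffT_mul g.memLp w.memLp
  have e3 := e1.unique (e2.congr_fun fun k => by
    rw [← h1 k, ← h2 k, map_mul, Complex.conj_ofReal]; ring)
  exact Complex.ofReal_injective e3

/-- The Dirichlet form `∫ u (-Δu)` on the Fourier side. -/
lemma IsNegLap.hasSum {u g : CT} (h : IsNegLap u g) :
    HasSum (fun k => lam k * ‖coeffT u k‖ ^ 2) (ip u g) := by
  have e1 := Complex.hasSum_re (hasSum_coeffT_mul u.memLp g.memLp)
  rw [Complex.ofReal_re] at e1
  refine e1.congr_fun fun k => ?_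
  rw [← h k, mul_left_comm, Complex.conj_mul', Complex.re_ofReal_mul]
  norm_cast

lemma IsNegLap.ip_nonneg {u g : CT} (h : IsNegLap u g) : 0 ≤ ip u g :=
  h.hasSum.nonneg fun k => mul_nonneg (lam_nonneg k) (sq_nonneg _)

/-- Elliptic regularity in the Wiener scale. It is an identity, because the weight `⟨2πk⟩²` is the
symbol of `1 - Δ`. -/
lemma IsNegLap.wien_succ {u g : CT} (h : IsNegLap u g) (m : ℝ) :
    wien (m + 1) u = wien m (u + g : CT) := by
  refine tsum_congr fun k => ?_
  rw [coeffT_add', ← h k, ofReal_symbolX_rpow_add, Real.rpow_one, mul_assoc]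
  congr 1
  have : coeffT u k + lam k * coeffT u k = (symbolX k : ℂ) * coeffT u k := by
    rw [symbolX_eq]; push_cast; ring
  rw [this, enorm_mul, ← ofReal_norm (symbolX k : ℂ), Complex.norm_real,
    Real.norm_of_nonneg (symbolX_pos k).le]

/-- Elliptic regularity in the Sobolev scale, again an identity. -/
lemma IsNegLap.sobSq_add_two {u g : CT} (h : IsNegLap u g) (s : ℝ) :
    sobSq (s + 2) u = sobSq s (u + g : CT) := by
  refine tsum_congr fun k => ?_
  rw [coeffT_add', ← h k, ofReal_symbolX_rpow_add, mul_assoc]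
  congr 1
  have : coeffT u k + lam k * coeffT u k = (symbolX k : ℂ) * coeffT u k := by
    rw [symbolX_eq]; push_cast; ring
  rw [this, enorm_mul, ← ofReal_norm (symbolX k : ℂ), Complex.norm_real,
    Real.norm_of_nonneg (symbolX_pos k).le, mul_pow, ← ENNReal.ofReal_pow (symbolX_pos k).le]
  norm_num

/-! ### The Poisson–Boltzmann equation at a fixed inverse temperature -/

/-- The charge `n - e^{βφ}`. -/
def charge (β : ℝ) (φ n : CT) : CT := n - expC (β • φ)

/-- `-Δφ = 4π (n - e^{βφ})`. -/
def IsPot (β : ℝ) (φ n : CT) : Prop := IsNegLap φ ((4 * Real.pi) • charge β φ n)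

/-- The field energy `(1/8π) ∫ |∇φ|² = ½ ∫ φ (n - e^{βφ})` of a solution. -/
def potEnergy (β : ℝ) (φ n : CT) : ℝ := 1 / 2 * ip φ (charge β φ n)

lemma charge_apply (β : ℝ) (φ n : CT) (x : T3) :
    charge β φ n x = n x - Real.exp (β * φ x) := rfl

/-- A continuous solution lies in the Wiener space of order `1`: the charge is square integrable, so
that `φ` is in `H²` and hence in the Wiener algebra, and then so are `e^{βφ}` and the charge. -/
lemma IsPot.wien_ne_top {β : ℝ} {φ n : CT} (h : IsPot β φ n) (hn : wien 0 n ≠ ⊤) :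
    wien 1 φ ≠ ⊤ := by
  have h0 : wien 0 φ ≠ ⊤ := by
    rw [show (0 : ℝ) = -1 + 1 by norm_num, IsNegLap.wien_succ h]
    exact wien_neg_one_ne_top _
  have h1 := IsNegLap.wien_succ h 0
  rw [zero_add] at h1
  rw [h1]
  refine ne_top_of_le_ne_top ?_ (wien_add_le _ _ _)
  refine ENNReal.add_ne_top.2 ⟨h0, ?_⟩
  rw [wien_smul]
  refine ENNReal.mul_ne_top enorm_ne_top ?_
  have e : charge β φ n = n + (-1 : ℝ) • expC (β • φ) := by
    rw [charge, neg_smul, one_smul, sub_eq_add_neg]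
  rw [e]
  refine ne_top_of_le_ne_top ?_ (wien_add_le _ _ _)
  refine ENNReal.add_ne_top.2 ⟨hn, ?_⟩
  rw [wien_smul]
  refine ENNReal.mul_ne_top enorm_ne_top ?_
  have h2 : wien 0 (β • φ : CT) ≠ ⊤ := by
    rw [wien_smul]; exact ENNReal.mul_ne_top enorm_ne_top h0
  obtain ⟨C, hC⟩ := wien_expC_le le_rfl (wien 0 (β • φ : CT)).toNNReal
  exact ne_top_of_le_ne_top ENNReal.coe_ne_top (hC _ (ENNReal.coe_toNNReal h2).ge)

/-- The maximum principle: at a maximum point of `φ` the charge is nonnegative. -/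
lemma IsPot.exp_le {β : ℝ} (hβ : 0 < β) {φ n : CT} (h : IsPot β φ n) (hn : wien 0 n ≠ ⊤) {N : ℝ}
    (hN : ∀ x, n x ≤ N) (x : T3) : Real.exp (β * φ x) ≤ N := by
  obtain ⟨x₀, hx₀⟩ := φ.continuous.exists_forall_ge_of_hasCompactSupport
    (HasCompactSupport.of_compactSpace _)
  have h1 := neg_laplacian_nonneg_of_isMax (h.wien_ne_top hn) (fun k => (h k).symm) hx₀
  rw [ContinuousMap.smul_apply, charge_apply, smul_eq_mul] at h1
  have h2 := nonneg_of_mul_nonneg_right h1 (by positivity)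
  have h3 : Real.exp (β * φ x) ≤ Real.exp (β * φ x₀) :=
    Real.exp_le_exp.2 (mul_le_mul_of_nonneg_left (hx₀ x) hβ.le)
  linarith [hN x₀]

/-- The minimum principle: at a minimum point of `φ` the charge is nonpositive. -/
lemma IsPot.le_exp {β : ℝ} (hβ : 0 < β) {φ n : CT} (h : IsPot β φ n) (hn : wien 0 n ≠ ⊤) {a : ℝ}
    (ha : ∀ x, a ≤ n x) (x : T3) : a ≤ Real.exp (β * φ x) := by
  obtain ⟨x₀, hx₀⟩ := φ.continuous.exists_forall_le_of_hasCompactSupport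
    (HasCompactSupport.of_compactSpace _)
  have hw : wien 1 ((-1 : ℝ) • φ : CT) ≠ ⊤ := by
    rw [wien_smul]; exact ENNReal.mul_ne_top enorm_ne_top (h.wien_ne_top hn)
  have h1 := neg_laplacian_nonneg_of_isMax hw (fun k => (IsNegLap.smul h (-1) k).symm)
    (x₀ := x₀) (fun y => by simpa using hx₀ y)
  simp only [ContinuousMap.smul_apply, charge_apply, smul_eq_mul] at h1
  have h2 : n x₀ - Real.exp (β * φ x₀) ≤ 0 := by
    by_contra hc
    push Not at hc
    have : 0 < 4 * Real.pi * (n x₀ - Real.exp (β * φ x₀)) := by positivity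
    linarith
  have h3 : Real.exp (β * φ x₀) ≤ Real.exp (β * φ x) :=
    Real.exp_le_exp.2 (mul_le_mul_of_nonneg_left (hx₀ x) hβ.le)
  linarith [ha x₀]

lemma exp_sub_le (p q : ℝ) : Real.exp q - Real.exp p ≤ Real.exp q * (q - p) := by
  have h1 := Real.add_one_le_exp (p - q)
  have h2 : Real.exp p = Real.exp q * Real.exp (p - q) := by rw [← Real.exp_add]; congr 1; ring
  rw [h2]
  nlinarith [Real.exp_pos q]

lemma le_exp_sub (p q : ℝ) : Real.exp p * (q - p) ≤ Real.exp q - Real.exp p := by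
  linarith [exp_sub_le q p]

/-- The Lipschitz constant of `p ↦ e^b p - e^p` on `[a, b]`. -/
lemma abs_sub_exp_le {a b Λ p q : ℝ} (hp : a ≤ p) (hp' : p ≤ b) (hq : a ≤ q) (hq' : q ≤ b)
    (hl : Λ = Real.exp b) :
    |(Λ * q - Real.exp q) - (Λ * p - Real.exp p)| ≤ (Λ - Real.exp a) * |q - p| := by
  wlog h : p ≤ q generalizing p q
  · have := this hq hq' hp hp' (le_of_not_ge h)
    rwa [abs_sub_comm, abs_sub_comm p q] at this
  rw [abs_of_nonneg (sub_nonneg.2 h)]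
  have h1 := exp_sub_le p q
  have h2 := le_exp_sub p q
  have h3 : Real.exp q ≤ Λ := hl ▸ Real.exp_le_exp.2 hq'
  have h4 : Real.exp a ≤ Real.exp p := Real.exp_le_exp.2 hp
  rw [abs_le]
  constructor <;> nlinarith

/-- Truncation of a function to `[a,b]`. -/
def clampC (a b : ℝ) (u : CT) : CT :=
  ⟨fun x => max a (min b (u x)), continuous_const.max (continuous_const.min u.continuous)⟩

lemma clampC_apply (a b : ℝ) (u : CT) (x : T3) : clampC a b u x = max a (min b (u x)) := rfl

/-- The Poisson–Boltzmann equation has a solution. In terms of `ψ = βφ` and of `l = 4πβ max n`, it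
is the fixed point equation `ψ = (l - Δ)⁻¹ (lψ + 4πβ (n - e^ψ))`. The nonlinearity is increasing
on `[ln min n, ln max n]`, with slope at most `l - 4πβ min n`, so that after truncation to this
interval the right hand side is a contraction in the uniform norm, and positivity of the resolvent
shows that its fixed point takes values in the interval. -/
lemma exists_isPot {β : ℝ} (hβ : 0 < β) {n : CT} {c : ℝ} (hc : 0 < c) (hn : ∀ x, c ≤ n x) :
    ∃ φ : CT, IsPot β φ n := by
  set N := ‖n‖ with hN
  have hnN : ∀ x, n x ≤ N := fun x => (le_abs_self _).trans (n.norm_coe_le_norm x)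
  have hcN : c ≤ N := (hn 0).trans (hnN 0)
  have hN0 : 0 < N := hc.trans_le hcN
  set a := Real.log c
  set b := Real.log N
  have hea : Real.exp a = c := Real.exp_log hc
  have heb : Real.exp b = N := Real.exp_log hN0
  have hab : a ≤ b := Real.log_le_log hc hcN
  set κ := 4 * Real.pi * β with hκ
  have hκ0 : 0 < κ := by positivity
  have hl : 0 < κ * N := by positivity
  let S : CT → CT := fun ψ => κ • (N • clampC a b ψ + (n - expC (clampC a b ψ)))
  have hS : ∀ ψ x, S ψ x = κ * (N * max a (min b (ψ x)) + (n x - Real.exp (max a (min b (ψ x))))) :=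
    fun ψ x => rfl
  have hca : ∀ y, a ≤ max a (min b y) := fun y => le_max_left _ _
  have hcb : ∀ y, max a (min b y) ≤ b := fun y => max_le hab (min_le_left _ _)
  have hθ0 : 0 ≤ 1 - c / N := sub_nonneg.2 ((div_le_one hN0).2 hcN)
  have hcontr : ContractingWith (Real.toNNReal (1 - c / N)) fun ψ => res hl (S ψ) := by
    refine ⟨?_, LipschitzWith.of_dist_le_mul fun u w => ?_⟩
    · rw [← NNReal.coe_lt_coe, Real.coe_toNNReal _ hθ0, NNReal.coe_one]
      have : 0 < c / N := by positivity
      linarith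
    · rw [Real.coe_toNNReal _ hθ0, dist_eq_norm, ← map_sub, dist_eq_norm]
      refine (norm_res_apply_le hl _).trans ?_
      rw [div_le_iff₀ hl]
      refine (ContinuousMap.norm_le _ (by positivity)).2 fun x => ?_
      rw [ContinuousMap.sub_apply, hS, hS, Real.norm_eq_abs]
      have h1 := abs_sub_exp_le (hca (w x)) (hcb (w x)) (hca (u x)) (hcb (u x)) heb.symm
      have h2 : |max a (min b (u x)) - max a (min b (w x))| ≤ ‖u - w‖ := by
        refine (abs_max_sub_max_le_max _ _ _ _).trans ?_
        rw [sub_self, abs_zero]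
        refine max_le (norm_nonneg _) ((abs_min_sub_min_le_max _ _ _ _).trans ?_)
        rw [sub_self, abs_zero]
        exact max_le (norm_nonneg _) ((u - w).norm_coe_le_norm x)
      rw [hea] at h1
      have e : κ * (N * max a (min b (u x)) + (n x - Real.exp (max a (min b (u x))))) -
          κ * (N * max a (min b (w x)) + (n x - Real.exp (max a (min b (w x))))) =
          κ * ((N * max a (min b (u x)) - Real.exp (max a (min b (u x)))) -
            (N * max a (min b (w x)) - Real.exp (max a (min b (w x))))) := by ring
      rw [e, abs_mul, abs_of_pos hκ0]
      calc _ ≤ κ * ((N - c) * ‖u - w‖) := by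
            refine mul_le_mul_of_nonneg_left (h1.trans ?_) hκ0.le
            exact mul_le_mul_of_nonneg_left h2 (sub_nonneg.2 hcN)
        _ = _ := by field_simp
  obtain ⟨ψ, hψ⟩ : ∃ ψ, res hl (S ψ) = ψ := ⟨_, hcontr.fixedPoint_isFixedPt⟩
  have hub : ∀ x, ψ x ≤ b := fun x => by
    have := res_le hl (f := S ψ) (b := κ * N * b) (fun y => ?_) x
    · rw [hψ, mul_div_cancel_left₀ _ hl.ne'] at this
      exact this
    · rw [hS, mul_assoc κ N b]
      refine mul_le_mul_of_nonneg_left ?_ hκ0.le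
      have := exp_sub_le (max a (min b (ψ y))) b
      rw [heb] at this
      linarith [hnN y]
  have hlb : ∀ x, a ≤ ψ x := fun x => by
    have := le_res hl (f := S ψ) (a := κ * N * a) (fun y => ?_) x
    · rw [hψ, mul_div_cancel_left₀ _ hl.ne'] at this
      exact this
    · rw [hS, mul_assoc κ N a]
      refine mul_le_mul_of_nonneg_left ?_ hκ0.le
      have h1 := exp_sub_le a (max a (min b (ψ y)))
      rw [hea] at h1
      have h2 : Real.exp (max a (min b (ψ y))) ≤ N := heb ▸ Real.exp_le_exp.2 (hcb _)
      have h3 : 0 ≤ max a (min b (ψ y)) - a := sub_nonneg.2 (hca _)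
      nlinarith [hn y]
  have hcl : clampC a b ψ = ψ := by
    ext x; rw [clampC_apply, min_eq_right (hub x), max_eq_right (hlb x)]
  have hlap := isNegLap_res hl (S ψ)
  rw [hψ] at hlap
  refine ⟨β⁻¹ • ψ, ?_⟩
  have h1 := hlap.smul β⁻¹
  rw [IsPot]
  convert h1 using 1
  ext x
  simp only [S, hcl, charge, ContinuousMap.smul_apply, ContinuousMap.sub_apply,
    ContinuousMap.add_apply, expC_apply, smul_eq_mul]
  rw [mul_inv_cancel_left₀ hβ.ne', hκ]
  field_simp
  ring

/-! ### The energy identity for two solutions and `L²` stability -/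

/-- Reciprocity: the potential energy of one charge in the field of the other is symmetric. -/
lemma IsPot.symm_charge {β₁ β₂ : ℝ} {φ₁ φ₂ n₁ n₂ : CT} (h₁ : IsPot β₁ φ₁ n₁)
    (h₂ : IsPot β₂ φ₂ n₂) : ip φ₁ (charge β₂ φ₂ n₂) = ip φ₂ (charge β₁ φ₁ n₁) := by
  have h := IsNegLap.ip_eq h₁ h₂
  rw [ip_smul_right, ip_smul_left, ip_comm _ φ₂] at h
  exact mul_left_cancel₀ (by positivity) h

/-- The identity behind monotonicity, uniqueness and stability. For a fixed density the right hand
side is nonpositive, since the exponential is increasing and the Dirichlet form is positive: the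
field energy is decreasing in `β`. -/
lemma IsPot.energy_identity {β₁ β₂ : ℝ} {φ₁ φ₂ n₁ n₂ : CT} (h₁ : IsPot β₁ φ₁ n₁)
    (h₂ : IsPot β₂ φ₂ n₂) :
    (β₂ - β₁) * (potEnergy β₂ φ₂ n₂ - potEnergy β₁ φ₁ n₁) =
      ip (β₂ • φ₂ - β₁ • φ₁) (n₂ - n₁) -
        ip (β₂ • φ₂ - β₁ • φ₁) (expC (β₂ • φ₂) - expC (β₁ • φ₁)) -
        (β₁ + β₂) / 2 * ip (φ₂ - φ₁) (charge β₂ φ₂ n₂ - charge β₁ φ₁ n₁) := by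
  have hs := h₁.symm_charge h₂
  have e : ip (β₂ • φ₂ - β₁ • φ₁) (n₂ - n₁) -
      ip (β₂ • φ₂ - β₁ • φ₁) (expC (β₂ • φ₂) - expC (β₁ • φ₁)) =
      ip (β₂ • φ₂ - β₁ • φ₁) (charge β₂ φ₂ n₂ - charge β₁ φ₁ n₁) := by
    rw [← ip_sub_right]; congr 1; simp only [charge]; abel
  rw [e]
  simp only [potEnergy, ip_sub_left, ip_sub_right, ip_smul_left]
  rw [hs]; ring

lemma IsPot.potEnergy_nonneg {β : ℝ} {φ n : CT} (h : IsPot β φ n) : 0 ≤ potEnergy β φ n := by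
  have := IsNegLap.ip_nonneg h
  rw [ip_smul_right] at this
  exact mul_nonneg (by norm_num) (nonneg_of_mul_nonneg_right this (by positivity))

/-- The field energy of the difference of two solutions is nonnegative. -/
lemma IsPot.ip_charge_nonneg {β₁ β₂ : ℝ} {φ₁ φ₂ n₁ n₂ : CT} (h₁ : IsPot β₁ φ₁ n₁)
    (h₂ : IsPot β₂ φ₂ n₂) : 0 ≤ ip (φ₂ - φ₁) (charge β₂ φ₂ n₂ - charge β₁ φ₁ n₁) := by
  have := IsNegLap.ip_nonneg (IsNegLap.sub h₂ h₁)
  rw [← smul_sub, ip_smul_right] at this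
  exact nonneg_of_mul_nonneg_right this (by positivity)

/-- The field energy tends to zero as the temperature `1/β` does. -/
lemma IsPot.potEnergy_le {L β : ℝ} {φ n : CT} (hβ : 0 < β) (hL : 1 ≤ L) (h : IsPot β φ n)
    (hn : wien 0 n ≠ ⊤) (h1 : ∀ x, L⁻¹ ≤ n x) (h2 : ∀ x, n x ≤ L) :
    potEnergy β φ n ≤ L ^ 2 / β := by
  have hL0 : 0 < L := by linarith
  have hL1 : 0 < L⁻¹ := inv_pos.2 hL0
  have e1 := h.exp_le hβ hn h2
  have e2 := h.le_exp hβ hn h1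
  have a1 : ‖β • φ‖ ≤ L := by
    refine (ContinuousMap.norm_le _ hL0.le).2 fun x => ?_
    have h1 := (Real.le_log_iff_exp_le hL0).2 (e1 x)
    have h2 := (Real.log_le_iff_le_exp hL1).2 (e2 x)
    rw [Real.log_inv] at h2
    have h3 := Real.log_le_sub_one_of_pos hL0
    rw [ContinuousMap.smul_apply, smul_eq_mul, Real.norm_eq_abs, abs_le]
    constructor <;> linarith
  have a2 : ‖charge β φ n‖ ≤ L := by
    refine (ContinuousMap.norm_le _ hL0.le).2 fun x => ?_
    rw [charge_apply, Real.norm_eq_abs, abs_le]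
    constructor <;> linarith [e1 x, e2 x, h1 x, h2 x]
  have h3 := (abs_le.1 (abs_ip_le (β • φ) (charge β φ n))).2
  rw [ip_smul_left] at h3
  have h4 : nrm (β • φ) * nrm (charge β φ n) ≤ L * L :=
    mul_le_mul ((nrm_le_norm _).trans a1) ((nrm_le_norm _).trans a2) (nrm_nonneg _) hL0.le
  rw [le_div_iff₀ hβ, potEnergy]
  nlinarith [mul_self_nonneg L]

/-- A solution of the Poisson–Boltzmann equation whose data lie between `1/B` and `B`. -/
structure IsBddPot (B β : ℝ) (φ n : CT) : Prop where
  isPot : IsPot β φ n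
  one_le : 1 ≤ B
  inv_le : B⁻¹ ≤ β
  le : β ≤ B
  inv_le_density : ∀ x, B⁻¹ ≤ n x
  density_le : ∀ x, n x ≤ B
  wien_ne_top : wien 0 n ≠ ⊤

namespace IsBddPot

variable {B β β₁ β₂ : ℝ} {φ φ₁ φ₂ n n₁ n₂ : CT}

lemma B_pos (h : IsBddPot B β φ n) : 0 < B := zero_lt_one.trans_le h.one_le

lemma pos (h : IsBddPot B β φ n) : 0 < β := (inv_pos.2 h.B_pos).trans_le h.inv_le

lemma exp_le (h : IsBddPot B β φ n) (x : T3) : Real.exp (β * φ x) ≤ B :=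
  h.isPot.exp_le h.pos h.wien_ne_top h.density_le x

lemma inv_le_exp (h : IsBddPot B β φ n) (x : T3) : B⁻¹ ≤ Real.exp (β * φ x) :=
  h.isPot.le_exp h.pos h.wien_ne_top h.inv_le_density x

lemma abs_mul_le (h : IsBddPot B β φ n) (x : T3) : |β * φ x| ≤ B := by
  have h1 := (Real.le_log_iff_exp_le h.B_pos).2 (h.exp_le x)
  have h2 := (Real.log_le_iff_le_exp (inv_pos.2 h.B_pos)).2 (h.inv_le_exp x)
  rw [Real.log_inv] at h2
  have h3 := Real.log_le_sub_one_of_pos h.B_pos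
  rw [abs_le]; constructor <;> linarith

lemma abs_le (h : IsBddPot B β φ n) (x : T3) : |φ x| ≤ B ^ 2 := by
  have h1 := h.abs_mul_le x
  rw [abs_mul, abs_of_pos h.pos] at h1
  have h2 : B⁻¹ * |φ x| ≤ B := (mul_le_mul_of_nonneg_right h.inv_le (abs_nonneg _)).trans h1
  rw [inv_mul_le_iff₀ h.B_pos] at h2
  rw [sq]; exact h2

lemma abs_charge_le (h : IsBddPot B β φ n) (x : T3) : |charge β φ n x| ≤ B := by
  have := inv_pos.2 h.B_pos
  rw [charge_apply, _root_.abs_le]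
  constructor <;> linarith [h.exp_le x, h.inv_le_exp x, h.inv_le_density x, h.density_le x]

lemma norm_charge_le (h : IsBddPot B β φ n) : ‖charge β φ n‖ ≤ B :=
  (ContinuousMap.norm_le _ h.B_pos.le).2 h.abs_charge_le

lemma norm_le (h : IsBddPot B β φ n) : ‖φ‖ ≤ B ^ 2 :=
  (ContinuousMap.norm_le _ (by positivity)).2 h.abs_le

/-- The exponential is strongly monotone on bounded sets. -/
lemma ip_exp_ge (h₁ : IsBddPot B β₁ φ₁ n₁) (h₂ : IsBddPot B β₂ φ₂ n₂) :
    B⁻¹ * nrm (β₂ • φ₂ - β₁ • φ₁) ^ 2 ≤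
      ip (β₂ • φ₂ - β₁ • φ₁) (expC (β₂ • φ₂) - expC (β₁ • φ₁)) := by
  rw [nrm_sq, ← ip_smul_right]
  refine ip_mono fun x => ?_
  simp only [ContinuousMap.sub_apply, ContinuousMap.smul_apply, expC_apply, smul_eq_mul]
  set p := β₁ * φ₁ x
  set q := β₂ * φ₂ x
  have a1 := h₁.inv_le_exp x
  have a2 := h₂.inv_le_exp x
  rcases le_total p q with hpq | hpq
  · have := le_exp_sub p q
    have h3 : B⁻¹ * (q - p) ≤ Real.exp q - Real.exp p := by nlinarith
    exact mul_le_mul_of_nonneg_left h3 (sub_nonneg.2 hpq)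
  · have := le_exp_sub q p
    have h3 : B⁻¹ * (p - q) ≤ Real.exp p - Real.exp q := by nlinarith
    nlinarith [mul_le_mul_of_nonneg_left h3 (sub_nonneg.2 hpq)]

lemma abs_exp_sub_le (h₁ : IsBddPot B β₁ φ₁ n₁) (h₂ : IsBddPot B β₂ φ₂ n₂) (x : T3) :
    |(expC (β₂ • φ₂) - expC (β₁ • φ₁)) x| ≤ B * |(β₂ • φ₂ - β₁ • φ₁) x| := by
  simp only [ContinuousMap.sub_apply, ContinuousMap.smul_apply, expC_apply, smul_eq_mul]
  set p := β₁ * φ₁ x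
  set q := β₂ * φ₂ x
  have a1 : Real.exp p ≤ B := h₁.exp_le x
  have a2 : Real.exp q ≤ B := h₂.exp_le x
  rcases le_total p q with hpq | hpq
  · rw [abs_of_nonneg (sub_nonneg.2 hpq), abs_of_nonneg (sub_nonneg.2 (Real.exp_le_exp.2 hpq))]
    exact (exp_sub_le p q).trans (mul_le_mul_of_nonneg_right a2 (sub_nonneg.2 hpq))
  · rw [abs_sub_comm, abs_sub_comm q, abs_of_nonneg (sub_nonneg.2 hpq),
      abs_of_nonneg (sub_nonneg.2 (Real.exp_le_exp.2 hpq))]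
    exact (exp_sub_le q p).trans (mul_le_mul_of_nonneg_right a1 (sub_nonneg.2 hpq))

lemma nrm_sub_le (h₁ : IsBddPot B β₁ φ₁ n₁) (h₂ : IsBddPot B β₂ φ₂ n₂) :
    nrm (φ₂ - φ₁) ≤ B * nrm (β₂ • φ₂ - β₁ • φ₁) + B ^ 3 * |β₂ - β₁| := by
  have e : φ₂ - φ₁ = β₂⁻¹ • ((β₂ • φ₂ - β₁ • φ₁) + (β₁ - β₂) • φ₁) := by
    have : (β₂ • φ₂ - β₁ • φ₁) + (β₁ - β₂) • φ₁ = β₂ • (φ₂ - φ₁) := by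
      ext x; simp; ring
    rw [this, smul_smul, inv_mul_cancel₀ h₂.pos.ne', one_smul]
  have h1 : |β₂⁻¹| ≤ B := by
    rw [abs_of_pos (inv_pos.2 h₂.pos)]
    exact inv_le_of_inv_le₀ h₂.B_pos h₂.inv_le
  have h2 := nrm_add_le (β₂ • φ₂ - β₁ • φ₁) ((β₁ - β₂) • φ₁)
  rw [nrm_smul, abs_sub_comm] at h2
  have h3 : nrm φ₁ ≤ B ^ 2 := (nrm_le_norm _).trans h₁.norm_le
  rw [e, nrm_smul]
  calc _ ≤ B * (nrm (β₂ • φ₂ - β₁ • φ₁) + |β₂ - β₁| * B ^ 2) := by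
        refine mul_le_mul h1 (h2.trans ?_) (nrm_nonneg _) h₁.B_pos.le
        gcongr
    _ = _ := by ring

lemma abs_potEnergy_sub_le (h₁ : IsBddPot B β₁ φ₁ n₁) (h₂ : IsBddPot B β₂ φ₂ n₂) :
    |potEnergy β₂ φ₂ n₂ - potEnergy β₁ φ₁ n₁| ≤ B * nrm (φ₂ - φ₁) := by
  have hs := h₁.isPot.symm_charge h₂.isPot
  have e : potEnergy β₂ φ₂ n₂ - potEnergy β₁ φ₁ n₁ =
      1 / 2 * ip (charge β₁ φ₁ n₁ + charge β₂ φ₂ n₂) (φ₂ - φ₁) := by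
    rw [ip_comm, potEnergy, potEnergy, ip_sub_left, ip_add_right, ip_add_right, hs]; ring
  rw [e, abs_mul, abs_of_pos (by norm_num : (0 : ℝ) < 1 / 2)]
  have h1 := abs_ip_le (charge β₁ φ₁ n₁ + charge β₂ φ₂ n₂) (φ₂ - φ₁)
  have h2 : nrm (charge β₁ φ₁ n₁ + charge β₂ φ₂ n₂) ≤ B + B :=
    (nrm_add_le _ _).trans (add_le_add ((nrm_le_norm _).trans h₁.norm_charge_le)
      ((nrm_le_norm _).trans h₂.norm_charge_le))
  have h3 := mul_le_mul_of_nonneg_right h2 (nrm_nonneg (φ₂ - φ₁))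
  linarith

/-- The energy identity turned into an inequality: the exponential is strongly monotone, and the
Dirichlet form is nonnegative. -/
lemma energy_inequality (h₁ : IsBddPot B β₁ φ₁ n₁) (h₂ : IsBddPot B β₂ φ₂ n₂) :
    B⁻¹ * nrm (β₂ • φ₂ - β₁ • φ₁) ^ 2 +
        (β₂ - β₁) * (potEnergy β₂ φ₂ n₂ - potEnergy β₁ φ₁ n₁) ≤
      nrm (β₂ • φ₂ - β₁ • φ₁) * ‖n₂ - n₁‖ := by
  have h := h₁.isPot.energy_identity h₂.isPot
  have h3 := h₁.ip_exp_ge h₂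
  have h4 := h₁.isPot.ip_charge_nonneg h₂.isPot
  have h5 := (_root_.abs_le.1 (abs_ip_le (β₂ • φ₂ - β₁ • φ₁) (n₂ - n₁))).2
  have h6 := mul_le_mul_of_nonneg_left (nrm_le_norm (n₂ - n₁)) (nrm_nonneg (β₂ • φ₂ - β₁ • φ₁))
  have h7 : 0 ≤ (β₁ + β₂) / 2 := by linarith [h₁.pos, h₂.pos]
  have h8 := mul_nonneg h7 h4
  rw [h]
  linarith

end IsBddPot

/-- Stability of the Poisson–Boltzmann potential and of its energy under changes of the density
and of the inverse temperature. -/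
lemma exists_potential_stability (B : ℝ) : ∃ C : ℝ, 0 ≤ C ∧ ∀ (β₁ β₂ : ℝ) (φ₁ φ₂ n₁ n₂ : CT),
    IsBddPot B β₁ φ₁ n₁ → IsBddPot B β₂ φ₂ n₂ →
      nrm (β₂ • φ₂ - β₁ • φ₁) ≤ C * (‖n₂ - n₁‖ + |β₂ - β₁|) ∧
      |potEnergy β₂ φ₂ n₂ - potEnergy β₁ φ₁ n₁| ≤ C * (‖n₂ - n₁‖ + |β₂ - β₁|) := by
  by_cases hB : 1 ≤ B
  swap
  · exact ⟨0, le_rfl, fun _ _ _ _ _ _ h => absurd h.one_le hB⟩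
  have hB0 : 0 < B := by linarith
  set K := B + B ^ 3 + B ^ 3 with hK
  have hK0 : 0 < K := by positivity
  refine ⟨K + B * (B * K + B ^ 3), by positivity, fun β₁ β₂ φ₁ φ₂ n₁ n₂ h₁ h₂ => ?_⟩
  set q := nrm (β₂ • φ₂ - β₁ • φ₁) with hq
  set D := ‖n₂ - n₁‖ with hD
  set b := |β₂ - β₁| with hb
  set F := potEnergy β₂ φ₂ n₂ - potEnergy β₁ φ₁ n₁ with hF
  have hq0 : 0 ≤ q := nrm_nonneg _
  have hD0 : 0 ≤ D := norm_nonneg _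
  have hb0 : 0 ≤ b := abs_nonneg _
  have e1 := h₁.energy_inequality h₂
  have e2 := h₁.abs_potEnergy_sub_le h₂
  have e3 := h₁.nrm_sub_le h₂
  have e4 : |F| ≤ B * (B * q + B ^ 3 * b) := e2.trans (mul_le_mul_of_nonneg_left e3 hB0.le)
  have e5 : -(b * |F|) ≤ (β₂ - β₁) * F := by rw [hb, ← abs_mul]; exact neg_abs_le _
  have e6 : b * |F| ≤ b * (B * (B * q + B ^ 3 * b)) := mul_le_mul_of_nonneg_left e4 hb0
  have e7 : q ^ 2 ≤ B * (q * D + b * (B * (B * q + B ^ 3 * b))) := by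
    have : B⁻¹ * q ^ 2 ≤ q * D + b * (B * (B * q + B ^ 3 * b)) := by linarith
    rwa [inv_mul_le_iff₀ hB0] at this
  -- a quadratic inequality `q² ≤ q X + Y²` gives `q ≤ X + Y`
  have e8 : q ≤ K * (D + b) := by
    by_contra hc
    push Not at hc
    have hX : B * D + B ^ 3 * b + B ^ 3 * b < q := by
      have : B * D + B ^ 3 * b + B ^ 3 * b ≤ K * (D + b) := by
        have t1 : 0 ≤ B ^ 3 * D := by positivity
        have t2 : 0 ≤ B * b := by positivity
        rw [hK]; nlinarith
      linarith
    have t3 : 0 ≤ B ^ 3 * b := by positivity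
    have t4 : 0 ≤ B * D := by positivity
    have t5 : B ^ 5 * b ^ 2 ≤ (B ^ 3 * b) * (B ^ 3 * b) := by
      have : B ^ 5 * b ^ 2 * 1 ≤ B ^ 5 * b ^ 2 * B := by gcongr
      nlinarith
    have t6 : q ^ 2 ≤ q * (B * D + B ^ 3 * b) + (B ^ 3 * b) * (B ^ 3 * b) := by nlinarith
    have t7 : (B ^ 3 * b) * (B ^ 3 * b) ≤ q * (B ^ 3 * b) :=
      mul_le_mul_of_nonneg_right (by linarith) t3
    have t8 : q * (B * D + B ^ 3 * b + B ^ 3 * b) < q * q :=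
      mul_lt_mul_of_pos_left hX (by linarith)
    nlinarith
  have hDb : 0 ≤ D + b := by linarith
  constructor
  · refine e8.trans (mul_le_mul_of_nonneg_right ?_ hDb)
    have : 0 ≤ B * (B * K + B ^ 3) := by positivity
    linarith
  · have t1 : B * (B * q + B ^ 3 * b) ≤ B * (B * (K * (D + b)) + B ^ 3 * (D + b)) := by
      gcongr; linarith
    have t2 : 0 ≤ K * (D + b) := by positivity
    nlinarith

/-- The conserved energy, without the kinetic part. -/
def totEnergy (β : ℝ) (φ n : CT) : ℝ := 3 / (2 * β) + potEnergy β φ n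

/-- Stability of the pair `(β, φ)` under changes of the density and of the energy. -/
lemma exists_energy_stability (B : ℝ) : ∃ C : ℝ, 0 ≤ C ∧ ∀ (β₁ β₂ : ℝ) (φ₁ φ₂ n₁ n₂ : CT),
    IsBddPot B β₁ φ₁ n₁ → IsBddPot B β₂ φ₂ n₂ →
      nrm (β₂ • φ₂ - β₁ • φ₁) + |β₂ - β₁| ≤
        C * (‖n₂ - n₁‖ + |totEnergy β₂ φ₂ n₂ - totEnergy β₁ φ₁ n₁|) := by
  by_cases hB : 1 ≤ B
  swap
  · exact ⟨0, le_rfl, fun _ _ _ _ _ _ h => absurd h.one_le hB⟩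
  have hB0 : 0 < B := by linarith
  refine ⟨2 * B ^ 2, by positivity, fun β₁ β₂ φ₁ φ₂ n₁ n₂ h₁ h₂ => ?_⟩
  have e1 := h₁.energy_inequality h₂
  set q := nrm (β₂ • φ₂ - β₁ • φ₁) with hq
  set D := ‖n₂ - n₁‖ with hD
  set b := |β₂ - β₁| with hb
  set R := totEnergy β₂ φ₂ n₂ - totEnergy β₁ φ₁ n₁ with hR
  have hq0 : 0 ≤ q := nrm_nonneg _
  have hD0 : 0 ≤ D := norm_nonneg _
  have hb0 : 0 ≤ b := abs_nonneg _
  have hR0 : 0 ≤ |R| := abs_nonneg _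
  have e2 : (β₂ - β₁) * (potEnergy β₂ φ₂ n₂ - potEnergy β₁ φ₁ n₁) =
      (β₂ - β₁) * R + 3 / (2 * (β₁ * β₂)) * (β₂ - β₁) ^ 2 := by
    have p1 := h₁.pos.ne'
    have p2 := h₂.pos.ne'
    rw [hR, totEnergy, totEnergy]
    field_simp
    ring
  have e3 : -(b * |R|) ≤ (β₂ - β₁) * R := by rw [hb, ← abs_mul]; exact neg_abs_le _
  have e4 : (B ^ 2)⁻¹ * b ^ 2 ≤ 3 / (2 * (β₁ * β₂)) * (β₂ - β₁) ^ 2 := by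
    rw [hb, sq_abs]
    refine mul_le_mul_of_nonneg_right ?_ (sq_nonneg _)
    have p : 0 < β₁ * β₂ := mul_pos h₁.pos h₂.pos
    rw [inv_eq_one_div, div_le_div_iff₀ (by positivity) (by positivity)]
    have : β₁ * β₂ ≤ B * B := mul_le_mul h₁.le h₂.le h₂.pos.le hB0.le
    nlinarith
  have e5 : (B ^ 2)⁻¹ * q ^ 2 ≤ B⁻¹ * q ^ 2 := by
    refine mul_le_mul_of_nonneg_right ?_ (sq_nonneg _)
    exact inv_anti₀ hB0 (by nlinarith)
  have e6 : (B ^ 2)⁻¹ * (q ^ 2 + b ^ 2) ≤ q * D + b * |R| := by linarith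
  rw [inv_mul_le_iff₀ (by positivity)] at e6
  have e7 : q * D + b * |R| ≤ (q + b) * (D + |R|) := by nlinarith
  have e8 : (q + b) * (q + b) ≤ (q + b) * (2 * B ^ 2 * (D + |R|)) := by
    have : B ^ 2 * (q * D + b * |R|) ≤ B ^ 2 * ((q + b) * (D + |R|)) := by gcongr
    nlinarith [sq_nonneg (q - b)]
  rcases (add_nonneg hq0 hb0).eq_or_lt with h0 | h0
  · rw [← h0]; positivity
  · exact le_of_mul_le_mul_left e8 h0

/-! ### From `L²` stability to `H^{s+2}` stability -/

lemma sobSq_add_le {σ : ℝ} {u w z : T3 → ℝ} (h : ∀ k, coeffT z k = coeffT u k + coeffT w k) :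
    sobSq σ z ≤ 4 * (sobSq σ u + sobSq σ w) := by
  simp only [sobSq]
  rw [← ENNReal.tsum_add, ← ENNReal.tsum_mul_left]
  refine ENNReal.tsum_le_tsum fun k => ?_
  rw [h, ← mul_add, mul_left_comm]
  refine mul_le_mul_right ?_ _
  have h1 : ‖coeffT u k + coeffT w k‖ₑ ≤ ‖coeffT u k‖ₑ + ‖coeffT w k‖ₑ := enorm_add_le _ _
  refine (pow_le_pow_left₀ (zero_le) h1 2).trans ?_
  generalize ‖coeffT u k‖ₑ = a
  generalize ‖coeffT w k‖ₑ = b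
  rcases le_total a b with hab | hab
  · calc (a + b) ^ 2 ≤ (b + b) ^ 2 := by gcongr
      _ = 4 * b ^ 2 := by ring
      _ ≤ _ := by gcongr; exact le_add_self
  · calc (a + b) ^ 2 ≤ (a + a) ^ 2 := by gcongr
      _ = 4 * a ^ 2 := by ring
      _ ≤ _ := by gcongr; exact le_self_add

/-- A triangle inequality for the Sobolev norm, with a constant. -/
lemma sobNorm_add_le {σ : ℝ} {u w z : T3 → ℝ} (h : ∀ k, coeffT z k = coeffT u k + coeffT w k) :
    sobNorm σ z ≤ 2 * (sobNorm σ u + sobNorm σ w) := by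
  rw [← ENNReal.pow_le_pow_left_iff (two_ne_zero), sobNorm_sq]
  refine (sobSq_add_le h).trans ?_
  rw [← sobNorm_sq, ← sobNorm_sq, mul_pow]
  have : (2 : ℝ≥0∞) ^ 2 = 4 := by norm_num
  rw [this]
  gcongr
  rw [add_sq]
  generalize sobNorm σ u = a
  generalize sobNorm σ w = b
  calc a ^ 2 + b ^ 2 ≤ a ^ 2 + b ^ 2 + 2 * a * b := le_self_add
    _ = _ := by ring

lemma sobNorm_congr {σ : ℝ} {u w : T3 → ℝ} (h : ∀ k, coeffT u k = coeffT w k) :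
    sobNorm σ u = sobNorm σ w := by simp only [sobNorm, sobSq, h]

lemma sobNorm_smul_coeff {σ c : ℝ} {u w : T3 → ℝ} (h : ∀ k, coeffT w k = c * coeffT u k) :
    sobNorm σ w = ‖c‖ₑ * sobNorm σ u := by
  have e : sobSq σ w = ‖c‖ₑ ^ 2 * sobSq σ u := by
    simp only [sobSq]
    rw [← ENNReal.tsum_mul_left]
    refine tsum_congr fun k => ?_
    have : ‖(c : ℂ)‖ₑ = ‖c‖ₑ := by rw [← ofReal_norm, ← ofReal_norm, Complex.norm_real]
    rw [h, enorm_mul, this]; ring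
  rw [sobNorm, e, ENNReal.mul_rpow_of_nonneg _ _ (by norm_num), ← ENNReal.rpow_natCast,
    ← ENNReal.rpow_mul]
  norm_num [sobNorm]

lemma sobNorm_CT_add_le (σ : ℝ) (u w : CT) :
    sobNorm σ (u + w : CT) ≤ 2 * (sobNorm σ u + sobNorm σ w) :=
  sobNorm_add_le fun k => coeffT_add' u w k

lemma sobNorm_CT_smul (σ c : ℝ) (u : CT) : sobNorm σ (c • u : CT) = ‖c‖ₑ * sobNorm σ u :=
  sobNorm_smul_coeff fun k => coeffT_smul' c u k

lemma wien_sub_le (m : ℝ) (u w : CT) : wien m (u - w : CT) ≤ wien m u + wien m w := by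
  have : u - w = u + (-1 : ℝ) • w := by rw [neg_smul, one_smul, sub_eq_add_neg]
  rw [this]
  refine (wien_add_le _ _ _).trans ?_
  rw [wien_smul]; simp

lemma sobNorm_CT_sub_le (σ : ℝ) (u w : CT) :
    sobNorm σ (u - w : CT) ≤ 2 * (sobNorm σ u + sobNorm σ w) := by
  have : u - w = u + (-1 : ℝ) • w := by rw [neg_smul, one_smul, sub_eq_add_neg]
  rw [this]
  refine (sobNorm_CT_add_le _ _ _).trans ?_
  rw [sobNorm_CT_smul]; simp

lemma IsNegLap.sobNorm_add_two {u g : CT} (h : IsNegLap u g) (s : ℝ) :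
    sobNorm (s + 2) u = sobNorm s (u + g : CT) := by
  rw [sobNorm, h.sobSq_add_two, sobNorm]

namespace IsBddPot

variable {B β₁ β₂ : ℝ} {φ₁ φ₂ n₁ n₂ : CT}

lemma isNegLap_sub (h₁ : IsBddPot B β₁ φ₁ n₁) (h₂ : IsBddPot B β₂ φ₂ n₂) :
    IsNegLap (φ₂ - φ₁)
      ((4 * Real.pi) • ((n₂ - n₁) - (expC (β₂ • φ₂) - expC (β₁ • φ₁)))) := by
  have h := IsNegLap.sub h₂.isPot h₁.isPot
  rw [← smul_sub] at h
  convert h using 2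
  simp only [charge]; abel

lemma enorm_le (h : IsBddPot B β₁ φ₁ n₁) : ‖β₁‖ₑ ≤ (B.toNNReal : ℝ≥0∞) := by
  rw [Real.enorm_of_nonneg h.pos.le]
  exact ENNReal.ofReal_le_ofReal h.le

/-- An estimate of order `ε` for the potentials passes to the exponentials `e^{βφ}`, in the Wiener
algebra of order `m`. -/
lemma wien_expC_sub_le {m : ℝ} (hm : 0 ≤ m) (hm' : m ≤ 3 / 2) (B : ℝ) (K C : ℝ≥0) :
    ∃ C' : ℝ≥0, ∀ (β₁ β₂ : ℝ) (φ₁ φ₂ n₁ n₂ : CT) (ε : ℝ≥0), IsBddPot B β₁ φ₁ n₁ →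
      IsBddPot B β₂ φ₂ n₂ → wien (3 / 2) φ₁ ≤ K → ε ≤ K → |β₂ - β₁| ≤ ε →
      wien m (φ₂ - φ₁ : CT) ≤ C * ε →
        wien m (expC (β₂ • φ₂) - expC (β₁ • φ₁) : CT) ≤ C' * ε := by
  obtain ⟨C', hC'⟩ := PoincarePoisson.wien_expC_sub_le hm
    (max (B.toNNReal * K) ((B.toNNReal * C + K) * K))
  refine ⟨C' * (B.toNNReal * C + K), fun β₁ β₂ φ₁ φ₂ n₁ n₂ ε h₁ h₂ hφ hε hβ hd => ?_⟩
  have hφ' : wien m φ₁ ≤ K := (wien_mono hm' _).trans hφ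
  have hβ' : ‖β₂ - β₁‖ₑ ≤ ε := by
    rw [← ofReal_norm, Real.norm_eq_abs, ← ENNReal.ofReal_coe_nnreal]
    exact ENNReal.ofReal_le_ofReal hβ
  have e1 : wien m (β₁ • φ₁ : CT) ≤ (B.toNNReal : ℝ≥0∞) * K := by
    rw [wien_smul]
    exact mul_le_mul' h₁.enorm_le hφ'
  have e2 : wien m (β₂ • φ₂ - β₁ • φ₁ : CT) ≤ ((B.toNNReal * C + K : ℝ≥0) : ℝ≥0∞) * ε := by
    have : β₂ • φ₂ - β₁ • φ₁ = β₂ • (φ₂ - φ₁) + (β₂ - β₁) • φ₁ := by ext x; simp; ring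
    rw [this]
    refine (wien_add_le _ _ _).trans ?_
    rw [wien_smul, wien_smul]
    push_cast
    calc _ ≤ (B.toNNReal : ℝ≥0∞) * (C * ε) + ε * K :=
          add_le_add (mul_le_mul' h₂.enorm_le hd) (mul_le_mul' hβ' hφ')
      _ = _ := by ring
  refine (hC' _ _ (e1.trans ?_) (e2.trans ?_)).trans ?_
  · exact_mod_cast le_max_left _ _
  · have : (B.toNNReal * C + K) * ε ≤ (B.toNNReal * C + K) * K := mul_le_mul_right hε _
    exact_mod_cast this.trans (le_max_right _ _)
  · rw [ENNReal.coe_mul, mul_assoc]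
    exact mul_le_mul_right e2 _

/-- One elliptic bootstrap step in the Wiener scale. -/
lemma wien_bootstrap {s m : ℝ} (hm : 0 ≤ m) (hm' : m ≤ 1 / 2) (hs : 5 / 2 < s) (B : ℝ)
    (K C : ℝ≥0) :
    ∃ C' : ℝ≥0, ∀ (β₁ β₂ : ℝ) (φ₁ φ₂ n₁ n₂ : CT) (ε : ℝ≥0), IsBddPot B β₁ φ₁ n₁ →
      IsBddPot B β₂ φ₂ n₂ → wien (3 / 2) φ₁ ≤ K → ε ≤ K → |β₂ - β₁| ≤ ε →
      sobNorm s (n₂ - n₁ : CT) ≤ ε → wien m (φ₂ - φ₁ : CT) ≤ C * ε →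
        wien (m + 1) (φ₂ - φ₁ : CT) ≤ C' * ε := by
  obtain ⟨C₁, hC₁⟩ := wien_expC_sub_le hm (hm'.trans (by norm_num)) B K C
  refine ⟨C + (4 * Real.pi).toNNReal * (embConst m s + C₁),
    fun β₁ β₂ φ₁ φ₂ n₁ n₂ ε h₁ h₂ hφ hε hβ hn hd => ?_⟩
  rw [(h₁.isNegLap_sub h₂).wien_succ]
  refine (wien_add_le _ _ _).trans ?_
  rw [wien_smul]
  have e1 := hC₁ β₁ β₂ φ₁ φ₂ n₁ n₂ ε h₁ h₂ hφ hε hβ hd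
  have e2 := (wien_le_sobNorm (m := m) (σ := s) (by linarith) (n₂ - n₁ : CT)).trans
    (mul_le_mul_right hn _)
  have e3 : ‖4 * Real.pi‖ₑ = ((4 * Real.pi).toNNReal : ℝ≥0∞) :=
    Real.enorm_of_nonneg (by positivity)
  rw [e3]
  have e4 : wien m (φ₂ - φ₁ : CT) + ((4 * Real.pi).toNNReal : ℝ≥0∞) *
      wien m (n₂ - n₁ - (expC (β₂ • φ₂) - expC (β₁ • φ₁)) : CT) ≤
      C * ε + (4 * Real.pi).toNNReal * (embConst m s * ε + C₁ * ε) :=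
    add_le_add hd (mul_le_mul_right ((wien_sub_le _ _ _).trans (add_le_add e2 e1)) _)
  refine e4.trans (le_of_eq ?_)
  simp only [ENNReal.coe_add, ENNReal.coe_mul]
  ring

/-- The start of the bootstrap: an `L²` bound of the difference of two potentials bounds the
Laplacian of the difference in `L²`, and `H²` embeds into the Wiener algebra of order `0`. -/
lemma wien_zero_sub_le {s : ℝ} (hs : 5 / 2 < s) (B : ℝ) :
    ∃ C' : ℝ≥0, ∀ (β₁ β₂ : ℝ) (φ₁ φ₂ n₁ n₂ : CT) (ε : ℝ≥0), IsBddPot B β₁ φ₁ n₁ →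
      IsBddPot B β₂ φ₂ n₂ → nrm (β₂ • φ₂ - β₁ • φ₁) ≤ ε → |β₂ - β₁| ≤ ε →
      sobNorm s (n₂ - n₁ : CT) ≤ ε → wien 0 (φ₂ - φ₁ : CT) ≤ C' * ε := by
  refine ⟨embConst (-1) 0 * (B + B ^ 3 + 4 * Real.pi * (embConst 0 s + B)).toNNReal,
    fun β₁ β₂ φ₁ φ₂ n₁ n₂ ε h₁ h₂ hq hβ hn => ?_⟩
  have hw := (h₁.isNegLap_sub h₂).wien_succ (-1)
  rw [neg_add_cancel] at hw
  rw [hw]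
  refine (wien_le_sobNorm (m := -1) (σ := 0) (by norm_num) _).trans ?_
  rw [ENNReal.coe_mul, mul_assoc]
  refine mul_le_mul_right ?_ _
  rw [sobNorm_zero_eq_nrm, ← ENNReal.ofReal_coe_nnreal (p := ε)]
  have hB := h₁.B_pos
  have hB3 : 0 < B ^ 3 := by positivity
  change _ ≤ ENNReal.ofReal _ * _
  rw [← ENNReal.ofReal_mul (by positivity)]
  refine ENNReal.ofReal_le_ofReal ?_
  have hn1 : ‖n₂ - n₁‖ ≤ embConst 0 s * ε := by
    have := ((enorm_le_wien _).trans (wien_le_sobNorm (m := 0) (σ := s) (by linarith) _)).trans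
      (mul_le_mul_right hn _)
    rw [← ENNReal.coe_mul, ← ofReal_norm, ← ENNReal.ofReal_coe_nnreal,
      ENNReal.ofReal_le_ofReal_iff (by positivity)] at this
    simpa using this
  have e1 := h₁.nrm_sub_le h₂
  have e2 : nrm (expC (β₂ • φ₂) - expC (β₁ • φ₁)) ≤ B * nrm (β₂ • φ₂ - β₁ • φ₁) :=
    nrm_le_of_abs_le h₁.B_pos.le (h₁.abs_exp_sub_le h₂)
  have e3 : nrm ((n₂ - n₁) - (expC (β₂ • φ₂) - expC (β₁ • φ₁))) ≤
      nrm (n₂ - n₁) + nrm (expC (β₂ • φ₂) - expC (β₁ • φ₁)) := by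
    have := nrm_add_le (n₂ - n₁) ((-1 : ℝ) • (expC (β₂ • φ₂) - expC (β₁ • φ₁)))
    rw [nrm_smul] at this
    rwa [neg_smul, one_smul, ← sub_eq_add_neg, abs_neg, abs_one, one_mul] at this
  refine (nrm_add_le _ _).trans ?_
  rw [nrm_smul, abs_of_pos (by positivity)]
  have e4 := nrm_le_norm (n₂ - n₁)
  have e5 : B * nrm (β₂ • φ₂ - β₁ • φ₁) ≤ B * ε := mul_le_mul_of_nonneg_left hq hB.le
  have e6 : B ^ 3 * |β₂ - β₁| ≤ B ^ 3 * ε := mul_le_mul_of_nonneg_left hβ hB3.le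
  have e7 : 4 * Real.pi * nrm ((n₂ - n₁) - (expC (β₂ • φ₂) - expC (β₁ • φ₁))) ≤
      4 * Real.pi * (embConst 0 s * ε + B * ε) :=
    mul_le_mul_of_nonneg_left (by linarith) (by positivity)
  linarith

/-- Elliptic regularity for the difference of two solutions: the Wiener norms of order `0`, `1` and
`3/2` are controlled successively, and the last one controls `H^s` since `s ≤ 3`. -/
lemma sobNorm_sub_le {s : ℝ} (hs : 5 / 2 < s) (hs' : s ≤ 3) (B : ℝ) (K : ℝ≥0) :
    ∃ C : ℝ≥0, ∀ (β₁ β₂ : ℝ) (φ₁ φ₂ n₁ n₂ : CT) (ε : ℝ≥0), IsBddPot B β₁ φ₁ n₁ →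
      IsBddPot B β₂ φ₂ n₂ → wien (3 / 2) φ₁ ≤ K → ε ≤ K →
      nrm (β₂ • φ₂ - β₁ • φ₁) ≤ ε → |β₂ - β₁| ≤ ε → sobNorm s (n₂ - n₁ : CT) ≤ ε →
        wien (3 / 2) (φ₂ - φ₁ : CT) ≤ C * ε ∧ sobNorm (s + 2) (φ₂ - φ₁ : CT) ≤ C * ε := by
  obtain ⟨C₀, h0⟩ := wien_zero_sub_le hs B
  obtain ⟨C₁, h1⟩ := wien_bootstrap le_rfl (by norm_num) hs B K C₀
  obtain ⟨C₂, h2⟩ := wien_bootstrap (m := 1 / 2) (by norm_num) le_rfl hs B K C₁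
  obtain ⟨C₃, h3⟩ := wien_expC_sub_le (m := 3 / 2) (by norm_num) le_rfl B K C₂
  refine ⟨max C₂ (2 * (C₂ + (4 * Real.pi).toNNReal * (2 * (1 + C₃)))),
    fun β₁ β₂ φ₁ φ₂ n₁ n₂ ε h₁ h₂ hφ hε hq hβ hn => ?_⟩
  have e0 := h0 β₁ β₂ φ₁ φ₂ n₁ n₂ ε h₁ h₂ hq hβ hn
  have e1 := h1 β₁ β₂ φ₁ φ₂ n₁ n₂ ε h₁ h₂ hφ hε hβ hn e0
  rw [zero_add] at e1
  have e2 := h2 β₁ β₂ φ₁ φ₂ n₁ n₂ ε h₁ h₂ hφ hε hβ hn ((wien_mono (by norm_num) _).trans e1)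
  rw [show (1 / 2 + 1 : ℝ) = 3 / 2 by norm_num] at e2
  have e3 := h3 β₁ β₂ φ₁ φ₂ n₁ n₂ ε h₁ h₂ hφ hε hβ e2
  constructor
  · exact e2.trans (mul_le_mul_left (ENNReal.coe_le_coe.2 (le_max_left _ _)) _)
  · refine le_trans ?_ (mul_le_mul_left (ENNReal.coe_le_coe.2 (le_max_right _ _)) _)
    rw [(h₁.isNegLap_sub h₂).sobNorm_add_two]
    refine (sobNorm_CT_add_le _ _ _).trans ?_
    rw [sobNorm_CT_smul]
    have e4 : ‖4 * Real.pi‖ₑ = ((4 * Real.pi).toNNReal : ℝ≥0∞) :=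
      Real.enorm_of_nonneg (by positivity)
    rw [e4]
    have hs2 : s ≤ 2 * (3 / 2) := by linarith
    have e5 := (sobNorm_le_wien hs2 (φ₂ - φ₁ : CT)).trans e2
    have e6 := (sobNorm_le_wien hs2 (expC (β₂ • φ₂) - expC (β₁ • φ₁) : CT)).trans e3
    have e7 : sobNorm s (n₂ - n₁ - (expC (β₂ • φ₂) - expC (β₁ • φ₁)) : CT) ≤ 2 * (ε + C₃ * ε) :=
      (sobNorm_CT_sub_le _ _ _).trans (mul_le_mul_right (add_le_add hn e6) _)
    have e8 : 2 * (sobNorm s (φ₂ - φ₁ : CT) + ((4 * Real.pi).toNNReal : ℝ≥0∞) *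
        sobNorm s (n₂ - n₁ - (expC (β₂ • φ₂) - expC (β₁ • φ₁)) : CT)) ≤
        2 * (C₂ * ε + (4 * Real.pi).toNNReal * (2 * (ε + C₃ * ε))) :=
      mul_le_mul_right (add_le_add e5 (mul_le_mul_right e7 _)) _
    refine e8.trans (le_of_eq ?_)
    simp only [ENNReal.coe_add, ENNReal.coe_mul, ENNReal.coe_one, ENNReal.coe_ofNat]
    ring

end IsBddPot

/-! ### The stationary problem: existence, uniqueness, bounds, Lipschitz dependence -/

lemma isPot_zero_one (β : ℝ) : IsPot β 0 1 := fun k => by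
  have : charge β 0 1 = 0 := by ext x; simp [charge_apply]
  rw [this, smul_zero]
  have h0 : coeffT (0 : CT) k = 0 := (coeffL k).map_zero
  rw [h0, mul_zero]

lemma wien_zero_CT (m : ℝ) : wien m (0 : CT) = 0 := by
  have := wien_smul m 0 (0 : CT)
  simpa using this

/-- A priori bounds for the potential. They follow from the stability estimates, by comparison
with the trivial solution `φ = 0`, `n = 1`. -/
lemma exists_potential_bound {s : ℝ} (hs : 5 / 2 < s) (hs' : s ≤ 3) (B : ℝ) (K : ℝ≥0) :
    ∃ C : ℝ≥0, ∀ (β : ℝ) (φ n : CT), IsBddPot B β φ n → sobNorm s n ≤ K →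
      wien (3 / 2) φ ≤ C ∧ sobNorm (s + 2) φ ≤ C := by
  set K' : ℝ≥0 := B.toNNReal + 2 * (K + 1) with hK'
  obtain ⟨C, hC⟩ := IsBddPot.sobNorm_sub_le hs hs' B K'
  refine ⟨C * K', fun β φ n h hn => ?_⟩
  have hB1 : B⁻¹ ≤ 1 := inv_le_one_of_one_le₀ h.one_le
  have h0 : IsBddPot B β 0 1 := ⟨isPot_zero_one β, h.one_le, h.inv_le, h.le, fun _ => hB1,
    fun _ => h.one_le, by rw [wien_one]; exact ENNReal.one_ne_top⟩
  have hBK : B ≤ K' := by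
    rw [hK']; push_cast
    have := Real.le_coe_toNNReal B
    have := K.2
    have : (0 : ℝ) ≤ 2 * (K + 1) := by positivity
    linarith
  have := hC β β 0 φ 1 n K' h0 h (by rw [wien_zero_CT]; exact zero_le) le_rfl ?_ ?_ ?_
  · rw [sub_zero] at this
    exact_mod_cast this
  · rw [smul_zero, sub_zero]
    refine (nrm_le_norm _).trans (le_trans ?_ hBK)
    exact (ContinuousMap.norm_le _ h.B_pos.le).2 h.abs_mul_le
  · rw [sub_self, abs_zero]; exact K'.2
  · refine (sobNorm_CT_sub_le _ _ _).trans ?_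
    have h1 : sobNorm s (1 : CT) ≤ 1 :=
      (sobNorm_le_wien (m := 3 / 2) (by linarith) _).trans (wien_one _).le
    calc _ ≤ 2 * ((K : ℝ≥0∞) + 1) := mul_le_mul_right (add_le_add hn h1) _
      _ ≤ _ := by
        rw [hK']; push_cast
        exact le_add_self

/-- Lipschitz dependence of `(β, φ)` on the density and the energy. -/
lemma exists_lipschitz {s : ℝ} (hs : 5 / 2 < s) (hs' : s ≤ 3) (B : ℝ) (K : ℝ≥0) :
    ∃ C : ℝ≥0, ∀ (β₁ β₂ : ℝ) (φ₁ φ₂ n₁ n₂ : CT), IsBddPot B β₁ φ₁ n₁ → IsBddPot B β₂ φ₂ n₂ →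
      sobNorm s n₁ ≤ K → sobNorm s n₂ ≤ K →
      ‖β₂ - β₁‖ₑ + sobNorm (s + 2) (φ₂ - φ₁ : CT) ≤
        C * (sobNorm s (n₂ - n₁ : CT) + ‖totEnergy β₂ φ₂ n₂ - totEnergy β₁ φ₁ n₁‖ₑ) := by
  obtain ⟨C₁, hC₁⟩ := exists_potential_bound hs hs' B K
  obtain ⟨C₂, hC₂0, hC₂⟩ := exists_energy_stability B
  set K' : ℝ≥0 := C₁ + 1 with hK'
  obtain ⟨C₃, hC₃⟩ := IsBddPot.sobNorm_sub_le hs hs' B K'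
  set C₄ : ℝ≥0 := C₂.toNNReal * (embConst 0 s + 1) + 1 with hC₄
  refine ⟨C₄ + (C₃ + 4 * C₁) * C₄, fun β₁ β₂ φ₁ φ₂ n₁ n₂ h₁ h₂ hn₁ hn₂ => ?_⟩
  have hfin : sobNorm s (n₂ - n₁ : CT) ≠ ⊤ := by
    refine ne_top_of_le_ne_top ?_ (sobNorm_CT_sub_le _ _ _)
    exact ENNReal.mul_ne_top (by norm_num) (ENNReal.add_ne_top.2
      ⟨ne_top_of_le_ne_top ENNReal.coe_ne_top hn₂, ne_top_of_le_ne_top ENNReal.coe_ne_top hn₁⟩)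
  set d : ℝ≥0 := (sobNorm s (n₂ - n₁ : CT)).toNNReal with hd
  have hd' : sobNorm s (n₂ - n₁ : CT) = d := (ENNReal.coe_toNNReal hfin).symm
  set R : ℝ := totEnergy β₂ φ₂ n₂ - totEnergy β₁ φ₁ n₁ with hR
  set ρ : ℝ≥0 := ‖R‖₊ with hρ
  have hR' : ‖R‖ₑ = ρ := rfl
  have hRρ : |R| = ρ := rfl
  set ε : ℝ≥0 := C₄ * (d + ρ) with hε
  have hn : ‖n₂ - n₁‖ ≤ embConst 0 s * d := by
    have := (enorm_le_wien (n₂ - n₁)).trans (wien_le_sobNorm (m := 0) (σ := s) (by linarith) _)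
    rw [hd', ← ENNReal.coe_mul, ← ofReal_norm, ← ENNReal.ofReal_coe_nnreal,
      ENNReal.ofReal_le_ofReal_iff (by positivity)] at this
    simpa using this
  have h3 := hC₂ β₁ β₂ φ₁ φ₂ n₁ n₂ h₁ h₂
  have hεr : (ε : ℝ) = (C₂ * (embConst 0 s + 1) + 1) * (d + ρ) := by
    rw [hε, hC₄]; push_cast; rw [Real.coe_toNNReal _ hC₂0]
  have hbd : C₂ * (‖n₂ - n₁‖ + |R|) ≤ ε := by
    rw [hεr, hRρ]
    have hd0 : (0 : ℝ) ≤ d := d.2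
    have hρ0 : (0 : ℝ) ≤ ρ := ρ.2
    have he0 : (0 : ℝ) ≤ embConst 0 s := (embConst 0 s).2
    have : ‖n₂ - n₁‖ + ρ ≤ (embConst 0 s + 1) * (d + ρ) := by nlinarith
    have := mul_le_mul_of_nonneg_left this hC₂0
    nlinarith
  have hq : nrm (β₂ • φ₂ - β₁ • φ₁) ≤ ε := by
    have := abs_nonneg (β₂ - β₁); linarith
  have hβ : |β₂ - β₁| ≤ ε := by
    have := nrm_nonneg (β₂ • φ₂ - β₁ • φ₁); linarith
  have hdε : d ≤ ε := by
    rw [← NNReal.coe_le_coe, hεr]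
    have hd0 : (0 : ℝ) ≤ d := d.2
    have hρ0 : (0 : ℝ) ≤ ρ := ρ.2
    have : 0 ≤ C₂ * ((embConst 0 s : ℝ) + 1) := by positivity
    nlinarith
  have hφ : sobNorm (s + 2) (φ₂ - φ₁ : CT) ≤ (C₃ + 4 * C₁) * ε := by
    -- the bootstrap needs small differences; for large ones the a priori bounds suffice
    by_cases hεK : ε ≤ K'
    · have := (hC₃ β₁ β₂ φ₁ φ₂ n₁ n₂ ε h₁ h₂ (((hC₁ _ _ _ h₁ hn₁).1).trans
        (by rw [hK']; exact_mod_cast le_self_add)) hεK hq hβ (hd'.le.trans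
          (by exact_mod_cast hdε))).2
      exact this.trans (mul_le_mul_left le_self_add _)
    · have h1ε : (1 : ℝ≥0∞) ≤ ε := by
        push Not at hεK
        have : (1 : ℝ≥0) ≤ ε := le_trans (by rw [hK']; exact le_add_self) hεK.le
        exact_mod_cast this
      refine (sobNorm_CT_sub_le _ _ _).trans ?_
      calc _ ≤ 2 * ((C₁ : ℝ≥0∞) + C₁) :=
            mul_le_mul_right (add_le_add (hC₁ _ _ _ h₂ hn₂).2 (hC₁ _ _ _ h₁ hn₁).2) _
        _ = 4 * C₁ * 1 := by ring
        _ ≤ 4 * C₁ * ε := mul_le_mul_right h1ε _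
        _ ≤ _ := mul_le_mul_left le_add_self _
  have hβ' : ‖β₂ - β₁‖ₑ ≤ ε := by
    rw [← ofReal_norm, Real.norm_eq_abs, ← ENNReal.ofReal_coe_nnreal]
    exact ENNReal.ofReal_le_ofReal hβ
  rw [hd', hR']
  refine (add_le_add hβ' hφ).trans (le_of_eq ?_)
  rw [hε]
  push_cast
  ring

/-- The upper and lower bounds on `β` in terms of the energy. -/
lemma IsPot.isBddPot {L β : ℝ} {φ n : CT} (h : IsPot β φ n) (hβ : 0 < β) (hL : 1 ≤ L)
    (hn : wien 0 n ≠ ⊤) (h1 : ∀ x, L⁻¹ ≤ n x) (h2 : ∀ x, n x ≤ L)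
    (h3 : L⁻¹ ≤ totEnergy β φ n) (h4 : totEnergy β φ n ≤ L) :
    IsBddPot (L * (3 / 2 + L ^ 2)) β φ n := by
  have hL0 : 0 < L := by linarith
  have hL2 : 1 ≤ L ^ 2 := one_le_pow₀ hL
  have hF := h.potEnergy_le hβ hL hn h1 h2
  have hF0 := h.potEnergy_nonneg
  have hLB : L ≤ L * (3 / 2 + L ^ 2) := le_mul_of_one_le_right hL0.le (by linarith)
  refine ⟨h, hL.trans hLB, ?_, ?_, fun x => (inv_anti₀ hL0 hLB).trans (h1 x),
    fun x => (h2 x).trans hLB, hn⟩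
  · have e : 3 / (2 * β) ≤ L := by rw [totEnergy] at h4; linarith
    rw [div_le_iff₀ (by positivity)] at e
    refine inv_le_of_inv_le₀ hβ ?_
    rw [inv_le_iff_one_le_mul₀ hβ]
    nlinarith [mul_pos hL0 hβ]
  · have e : L⁻¹ ≤ (3 / 2 + L ^ 2) / β := by
      rw [totEnergy] at h3
      have : 3 / (2 * β) + L ^ 2 / β = (3 / 2 + L ^ 2) / β := by field_simp
      linarith
    rw [le_div_iff₀ hβ, inv_mul_le_iff₀ hL0] at e
    exact e

lemma exists_bound_CT {n : CT} {c : ℝ} (hc : 0 < c) (hn : ∀ x, c ≤ n x) :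
    ∃ L : ℝ, 1 ≤ L ∧ (∀ x, L⁻¹ ≤ n x) ∧ ∀ x, n x ≤ L := by
  refine ⟨max 1 (max c⁻¹ ‖n‖), le_max_left _ _, fun x => ?_, fun x => ?_⟩
  · exact (inv_le_of_inv_le₀ hc ((le_max_left _ _).trans (le_max_right _ _))).trans (hn x)
  · exact ((le_abs_self _).trans (n.norm_coe_le_norm x)).trans
      ((le_max_right _ _).trans (le_max_right _ _))

/-- For two solutions with the same density, a common bound. -/
lemma exists_isBddPot {n : CT} {c β₁ β₂ : ℝ} {φ₁ φ₂ : CT} (hc : 0 < c) (hn : ∀ x, c ≤ n x)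
    (hw : wien 0 n ≠ ⊤) (hβ₁ : 0 < β₁) (hβ₂ : 0 < β₂) (h₁ : IsPot β₁ φ₁ n) (h₂ : IsPot β₂ φ₂ n) :
    ∃ B, IsBddPot B β₁ φ₁ n ∧ IsBddPot B β₂ φ₂ n := by
  obtain ⟨L, hL, hL1, hL2⟩ := exists_bound_CT hc hn
  set B := L + β₁ + β₁⁻¹ + β₂ + β₂⁻¹ with hB
  have p1 := inv_pos.2 hβ₁
  have p2 := inv_pos.2 hβ₂
  have hLB : L ≤ B := by linarith
  have hL0 : 0 < L := by linarith
  exact ⟨B, ⟨h₁, by linarith, inv_le_of_inv_le₀ hβ₁ (by linarith), by linarith,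
    fun x => (inv_anti₀ hL0 hLB).trans (hL1 x), fun x => (hL2 x).trans hLB, hw⟩,
    ⟨h₂, by linarith, inv_le_of_inv_le₀ hβ₂ (by linarith), by linarith,
    fun x => (inv_anti₀ hL0 hLB).trans (hL1 x), fun x => (hL2 x).trans hLB, hw⟩⟩

lemma isPot_unique {n : CT} {c β : ℝ} {φ₁ φ₂ : CT} (hc : 0 < c) (hn : ∀ x, c ≤ n x)
    (hw : wien 0 n ≠ ⊤) (hβ : 0 < β) (h₁ : IsPot β φ₁ n) (h₂ : IsPot β φ₂ n) : φ₂ = φ₁ := by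
  obtain ⟨B, b₁, b₂⟩ := exists_isBddPot hc hn hw hβ hβ h₁ h₂
  obtain ⟨C, -, hC⟩ := exists_potential_stability B
  have h := (hC _ _ _ _ _ _ b₁ b₂).1
  rw [sub_self, sub_self, norm_zero, abs_zero, add_zero, mul_zero, ← smul_sub] at h
  have h' := eq_zero_of_nrm_eq_zero (le_antisymm h (nrm_nonneg _))
  rw [smul_eq_zero_iff_right hβ.ne'] at h'
  exact sub_eq_zero.1 h'

lemma energy_unique {n : CT} {c β₁ β₂ : ℝ} {φ₁ φ₂ : CT} (hc : 0 < c) (hn : ∀ x, c ≤ n x)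
    (hw : wien 0 n ≠ ⊤) (hβ₁ : 0 < β₁) (hβ₂ : 0 < β₂) (h₁ : IsPot β₁ φ₁ n) (h₂ : IsPot β₂ φ₂ n)
    (he : totEnergy β₁ φ₁ n = totEnergy β₂ φ₂ n) : β₂ = β₁ ∧ φ₂ = φ₁ := by
  obtain ⟨B, b₁, b₂⟩ := exists_isBddPot hc hn hw hβ₁ hβ₂ h₁ h₂
  obtain ⟨C, -, hC⟩ := exists_energy_stability B
  have h := hC _ _ _ _ _ _ b₁ b₂
  rw [he, sub_self, sub_self, norm_zero, abs_zero, add_zero, mul_zero] at h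
  have hβ : β₂ = β₁ := by
    have := abs_nonneg (β₂ - β₁)
    have := nrm_nonneg (β₂ • φ₂ - β₁ • φ₁)
    have h0 : |β₂ - β₁| = 0 := by linarith
    exact sub_eq_zero.1 (abs_eq_zero.1 h0)
  subst hβ
  exact ⟨rfl, isPot_unique hc hn hw hβ₂ h₁ h₂⟩

/-- For every density and every positive energy the stationary problem is solvable: the energy
depends continuously on `β`, is at least `3/(2β)`, and is at most a multiple of `1/β`. -/
lemma exists_stationary {n : CT} {c e : ℝ} (hc : 0 < c) (hn : ∀ x, c ≤ n x)
    (hw : wien 0 n ≠ ⊤) (he : 0 < e) :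
    ∃ (β : ℝ) (φ : CT), 0 < β ∧ IsPot β φ n ∧ totEnergy β φ n = e := by
  obtain ⟨L, hL, hL1, hL2⟩ := exists_bound_CT hc hn
  have hL0 : 0 < L := by linarith
  classical
  let Φ : ℝ → CT := fun β => if h : 0 < β then (exists_isPot h hc hn).choose else 0
  have hΦ : ∀ β, 0 < β → IsPot β (Φ β) n := fun β h => by
    simp only [Φ, dif_pos h]
    exact (exists_isPot h hc hn).choose_spec
  -- the values of `β` at which the lower bound `3/(2β)` and the upper bound `(3/2 + L²)/β` of the energy
  -- are equal to `e`
  set a := 3 / 2 / e with ha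
  set b := (3 / 2 + L ^ 2) / e with hb
  have ha0 : 0 < a := by positivity
  have hab : a ≤ b := by
    rw [ha, hb]; gcongr; nlinarith [sq_nonneg L]
  have hb0 : 0 < b := ha0.trans_le hab
  set B := L + a⁻¹ + b with hB
  have hai := inv_pos.2 ha0
  have hbd : ∀ β ∈ Icc a b, IsBddPot B β (Φ β) n := fun β hβ => by
    have hβ0 := ha0.trans_le hβ.1
    exact ⟨hΦ β hβ0, by linarith, (inv_le_of_inv_le₀ ha0 (by linarith)).trans hβ.1,
      hβ.2.trans (by linarith), fun x => (inv_anti₀ hL0 (by linarith)).trans (hL1 x),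
      fun x => (hL2 x).trans (by linarith), hw⟩
  obtain ⟨C, hC0, hC⟩ := exists_potential_stability B
  have hcF : ContinuousOn (fun β => potEnergy β (Φ β) n) (Icc a b) := by
    refine LipschitzOnWith.continuousOn (K := C.toNNReal) ?_
    refine LipschitzOnWith.of_dist_le_mul fun x hx y hy => ?_
    have := (hC _ _ _ _ _ _ (hbd y hy) (hbd x hx)).2
    rw [sub_self, norm_zero, zero_add] at this
    rw [Real.coe_toNNReal _ hC0]
    exact this
  have hcE : ContinuousOn (fun β => totEnergy β (Φ β) n) (Icc a b) := by
    refine ContinuousOn.add ?_ hcF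
    refine continuousOn_const.div (by fun_prop) fun β hβ => ?_
    have := ha0.trans_le hβ.1
    positivity
  have h1 : totEnergy b (Φ b) n ≤ e := by
    have := (hΦ b hb0).potEnergy_le hb0 hL hw hL1 hL2
    have e1 : 3 / (2 * b) + L ^ 2 / b = e := by
      rw [hb]; field_simp
    rw [totEnergy]; linarith
  have h2 : e ≤ totEnergy a (Φ a) n := by
    have := (hΦ a ha0).potEnergy_nonneg
    have e1 : 3 / (2 * a) = e := by rw [ha]; field_simp
    rw [totEnergy]; linarith
  obtain ⟨β, hβ, hβe⟩ := intermediate_value_Icc' hab hcE ⟨h1, h2⟩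
  exact ⟨β, Φ β, ha0.trans_le hβ.1, hΦ β (ha0.trans_le hβ.1), hβe⟩

/-! ### The weak formulation and Fourier coefficients -/

lemma continuous_proj : Continuous proj :=
  continuous_pi fun i => (AddCircle.continuous_mk' (1 : ℝ)).comp (by fun_prop)

lemma isOpenQuotientMap_proj : IsOpenQuotientMap proj := by
  have h1 : IsOpenQuotientMap (Pi.map fun (_ : Fin 3) (y : ℝ) => (y : UnitAddCircle)) :=
    IsOpenQuotientMap.piMap fun _ => QuotientAddGroup.isOpenQuotientMap_mk
  exact h1.comp (EuclideanSpace.equiv (Fin 3) ℝ).toHomeomorph.isOpenQuotientMap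

lemma proj_surjective (x : T3) : ∃ y, proj y = x := isOpenQuotientMap_proj.surjective x

lemma proj_add (y z : R3) : proj (y + z) = proj y + proj z := by
  ext i; simp [proj]

lemma proj_add_single (y : R3) (j : Fin 3) (h : ℝ) :
    proj (y + h • EuclideanSpace.single j (1 : ℝ)) =
      proj y + Pi.single j (h : UnitAddCircle) := by
  rw [proj_add]
  congr 1
  ext i
  by_cases hi : i = j
  · subst hi; simp [proj]
  · simp [proj, hi]

lemma SmoothOnTorus.continuous {χ : T3 → ℝ} (h : SmoothOnTorus χ) : Continuous χ :=
  isOpenQuotientMap_proj.isQuotientMap.continuous_iff.2 (ContDiff.continuous h)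

lemma SmoothOnTorus.hasDerivAt_proj {χ : T3 → ℝ} (h : SmoothOnTorus χ) (j : Fin 3) (y : R3) (t : ℝ) :
    HasDerivAt (fun t : ℝ => χ (proj y + Pi.single j (t : UnitAddCircle)))
      (fderiv ℝ (fun y => χ (proj y)) (y + t • EuclideanSpace.single j (1 : ℝ))
        (EuclideanSpace.single j (1 : ℝ))) t := by
  have h1 : HasDerivAt (fun t : ℝ => y + t • EuclideanSpace.single j (1 : ℝ))
      (EuclideanSpace.single j (1 : ℝ)) t := by
    simpa using ((hasDerivAt_id t).smul_const (EuclideanSpace.single j (1 : ℝ))).const_add y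
  have h2 := ((ContDiff.differentiable h (by simp)).differentiableAt
    (x := y + t • EuclideanSpace.single j (1 : ℝ))).hasFDerivAt.comp_hasDerivAt t h1
  refine h2.congr_of_eventuallyEq (Eventually.of_forall fun t => ?_)
  simp [proj_add_single]

lemma SmoothOnTorus.partialT_proj {χ : T3 → ℝ} (h : SmoothOnTorus χ) (j : Fin 3) (y : R3) :
    partialT j χ (proj y) = fderiv ℝ (fun y => χ (proj y)) y (EuclideanSpace.single j (1 : ℝ)) := by
  have := (h.hasDerivAt_proj j y 0).deriv
  rw [zero_smul, add_zero] at this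
  exact this

lemma SmoothOnTorus.partialT {χ : T3 → ℝ} (h : SmoothOnTorus χ) (j : Fin 3) :
    SmoothOnTorus (partialT j χ) := by
  have e : (fun y : R3 => PoincarePoisson.partialT j χ (proj y)) = fun y =>
      fderiv ℝ (fun y => χ (proj y)) y (EuclideanSpace.single j (1 : ℝ)) := by
    ext y; exact h.partialT_proj j y
  rw [SmoothOnTorus, e]
  exact (ContDiff.fderiv_right (m := ∞) h (by simp)).clm_apply contDiff_const

lemma SmoothOnTorus.hasDerivAt {χ : T3 → ℝ} (h : SmoothOnTorus χ) (j : Fin 3) (x : T3) (t : ℝ) :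
    HasDerivAt (fun t : ℝ => χ (x + Pi.single j (t : UnitAddCircle)))
      (PoincarePoisson.partialT j χ (x + Pi.single j (t : UnitAddCircle))) t := by
  obtain ⟨y, rfl⟩ := proj_surjective x
  rw [← proj_add_single, h.partialT_proj]
  exact h.hasDerivAt_proj j y t

/-- A smooth function as an element of the space of continuous functions. -/
def SmoothOnTorus.toCT {χ : T3 → ℝ} (h : SmoothOnTorus χ) : CT := ⟨χ, h.continuous⟩

lemma SmoothOnTorus.coeffT_partialT {χ : T3 → ℝ} (h : SmoothOnTorus χ) (j : Fin 3)
    (k : Fin 3 → ℤ) :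
    coeffT (PoincarePoisson.partialT j χ) k = (2 * Real.pi * k j : ℝ) * Complex.I * coeffT χ k := by
  -- differentiate in `t` the Fourier coefficient of the translate of `χ` by `t e_j`
  let F : ℝ → T3 → ℂ := fun t x => UnitAddTorus.mFourier (-k) x *
    (χ (x + Pi.single j (t : UnitAddCircle)) : ℂ)
  let F' : ℝ → T3 → ℂ := fun t x => UnitAddTorus.mFourier (-k) x *
    (PoincarePoisson.partialT j χ (x + Pi.single j (t : UnitAddCircle)) : ℂ)
  have hc : ∀ {g : T3 → ℝ} (_ : Continuous g) (t : ℝ), Continuous fun x : T3 =>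
      UnitAddTorus.mFourier (-k) x * (g (x + Pi.single j (t : UnitAddCircle)) : ℂ) := fun hg t =>
    (UnitAddTorus.mFourier (-k)).continuous.mul
      (Complex.continuous_ofReal.comp (hg.comp (continuous_add_const _)))
  have h1 := hasDerivAt_integral_of_dominated_loc_of_deriv_le (μ := dx) (F := F) (F' := F')
    (x₀ := 0) (s := univ) (bound := fun _ => ‖(h.partialT j).toCT‖) univ_mem
    (Eventually.of_forall fun t => (hc h.continuous t).aestronglyMeasurable)
    (((hc h.continuous 0).integrable_of_hasCompactSupport (HasCompactSupport.of_compactSpace _)))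
    ((hc (h.partialT j).continuous 0).aestronglyMeasurable)
    (Eventually.of_forall fun x t _ => by
      simp only [F']
      rw [norm_mul, norm_mFourier_apply, one_mul, Complex.norm_real]
      exact (h.partialT j).toCT.norm_coe_le_norm _)
    (integrable_const _)
    (Eventually.of_forall fun x t _ => by
      simp only [F, F']
      exact (h.hasDerivAt j x t).ofReal_comp.const_mul _)
  have h2 : (fun t => ∫ x, F t x ∂dx) = fun t : ℝ =>
      Complex.exp ((2 * Real.pi * k j * t : ℝ) * Complex.I) * coeffT χ k := by
    ext t
    have e : ∀ x, F t x = Complex.exp ((2 * Real.pi * k j * t : ℝ) * Complex.I) *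
        (UnitAddTorus.mFourier (-k) (x + Pi.single j (t : UnitAddCircle)) *
          (χ (x + Pi.single j (t : UnitAddCircle)) : ℂ)) := fun x => by
      simp only [F]
      rw [mFourier_add_apply, mFourier_single_apply]
      have : Complex.exp ((2 * Real.pi * k j * t : ℝ) * Complex.I) *
          Complex.exp ((2 * Real.pi * ((-k) j : ℤ) * t : ℝ) * Complex.I) = 1 := by
        rw [← Complex.exp_add, ← Complex.exp_zero]; congr 1; push_cast [Pi.neg_apply]; ring
      linear_combination (-(UnitAddTorus.mFourier (-k) x *
        (χ (x + Pi.single j (t : UnitAddCircle)) : ℂ))) * this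
    simp only [e]
    rw [integral_const_mul, integral_add_right_eq_self (μ := dx) (fun x =>
      UnitAddTorus.mFourier (-k) x * (χ x : ℂ))]
    rfl
  have h3 : HasDerivAt (fun t : ℝ =>
      Complex.exp ((2 * Real.pi * k j * t : ℝ) * Complex.I) * coeffT χ k)
      ((2 * Real.pi * k j : ℝ) * Complex.I * coeffT χ k) 0 := by
    have a : HasDerivAt (fun t : ℝ => ((2 * Real.pi * k j * t : ℝ) : ℂ) * Complex.I)
        ((2 * Real.pi * k j : ℝ) * Complex.I) 0 := by
      have := (((hasDerivAt_id (0 : ℝ)).const_mul (2 * Real.pi * (k j : ℝ))).ofReal_comp).mul_const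
        Complex.I
      simpa using this
    have b := a.cexp.mul_const (coeffT χ k)
    simpa using b
  rw [← h2] at h3
  have h4 := h1.2.unique h3
  rw [← h4, coeffT_eq]
  refine integral_congr_ae (Eventually.of_forall fun x => ?_)
  simp [F']

/-- The Laplacian of a smooth function, as a continuous function. -/
lemma SmoothOnTorus.exists_laplacian {χ : T3 → ℝ} (h : SmoothOnTorus χ) :
    ∃ w : CT, (∀ x, w x = laplacianT χ x) ∧ ∀ k, coeffT w k = -(lam k * coeffT χ k) := by
  refine ⟨∑ j, ((h.partialT j).partialT j).toCT, fun x => ?_, fun k => ?_⟩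
  · rw [ContinuousMap.sum_apply]; rfl
  · have h1 := map_sum (coeffL k) (fun j => ((h.partialT j).partialT j).toCT) Finset.univ
    simp only [coeffL_apply] at h1
    rw [h1]
    have h2 : ∀ j, coeffT ((h.partialT j).partialT j).toCT k =
        -(((2 * Real.pi * k j) ^ 2 : ℝ) * coeffT χ k) := fun j => by
      have a := (h.partialT j).coeffT_partialT j k
      rw [h.coeffT_partialT j k] at a
      refine a.trans ?_
      push_cast
      linear_combination ((2 * Real.pi * k j : ℂ)) ^ 2 * coeffT χ k * Complex.I_sq
    simp only [h2]
    rw [Finset.sum_neg_distrib, ← Finset.sum_mul, lam]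
    push_cast
    rfl

/-- The real trigonometric test functions `Re (c e^{2πik·x})`. -/
def trig (k : Fin 3 → ℤ) (c : ℂ) (x : T3) : ℝ := (c * UnitAddTorus.mFourier k x).re

lemma mFourier_proj (k : Fin 3 → ℤ) (y : R3) :
    UnitAddTorus.mFourier k (proj y) =
      Complex.exp (∑ i, (2 * Real.pi * k i * y i : ℝ) * Complex.I) := by
  rw [Complex.exp_sum]
  simp only [UnitAddTorus.mFourier, ContinuousMap.coe_mk, proj]
  refine Finset.prod_congr rfl fun i _ => ?_
  rw [fourier_coe_apply]
  congr 1; push_cast; ring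

lemma smoothOnTorus_trig (k : Fin 3 → ℤ) (c : ℂ) : SmoothOnTorus (trig k c) := by
  rw [SmoothOnTorus]
  simp only [trig, mFourier_proj]
  refine Complex.reCLM.contDiff.comp (contDiff_const.mul (Complex.contDiff_exp.comp ?_))
  refine ContDiff.sum fun i _ => ContDiff.mul (Complex.ofRealCLM.contDiff.comp ?_) contDiff_const
  exact contDiff_const.mul (EuclideanSpace.proj (𝕜 := ℝ) i).contDiff

lemma partialT_trig (k : Fin 3 → ℤ) (c : ℂ) (j : Fin 3) :
    partialT j (trig k c) = trig k (c * ((2 * Real.pi * k j : ℝ) * Complex.I)) := by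
  ext x
  have a : HasDerivAt (fun t : ℝ => ((2 * Real.pi * k j * t : ℝ) : ℂ) * Complex.I)
      ((2 * Real.pi * k j : ℝ) * Complex.I) 0 := by
    have := (((hasDerivAt_id (0 : ℝ)).const_mul (2 * Real.pi * (k j : ℝ))).ofReal_comp).mul_const
      Complex.I
    simpa using this
  have b := (a.cexp.const_mul (c * UnitAddTorus.mFourier k x))
  have d := Complex.reCLM.hasFDerivAt.comp_hasDerivAt (0 : ℝ) b
  have e : (fun h : ℝ => trig k c (x + Pi.single j (h : UnitAddCircle))) =
      Complex.reCLM ∘ fun t : ℝ => c * UnitAddTorus.mFourier k x *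
        Complex.exp (((2 * Real.pi * k j * t : ℝ) : ℂ) * Complex.I) := by
    ext t
    simp only [trig, Function.comp_apply, Complex.reCLM_apply]
    rw [mFourier_add_apply, mFourier_single_apply, ← mul_assoc c]
  rw [partialT, e, d.deriv]
  simp [trig]
  ring

lemma laplacianT_trig (k : Fin 3 → ℤ) (c : ℂ) (x : T3) :
    laplacianT (trig k c) x = -(lam k) * trig k c x := by
  simp only [laplacianT, partialT_trig]
  rw [lam, neg_mul, Finset.sum_mul, ← Finset.sum_neg_distrib]
  refine Finset.sum_congr rfl fun j _ => ?_
  have : c * ((2 * Real.pi * k j : ℝ) * Complex.I) * ((2 * Real.pi * k j : ℝ) * Complex.I) =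
      ((-(2 * Real.pi * k j) ^ 2 : ℝ) : ℂ) * c := by
    push_cast
    linear_combination (c * (2 * Real.pi * k j : ℂ) ^ 2) * Complex.I_sq
  rw [this, trig, trig, mul_assoc, Complex.re_ofReal_mul]
  ring

lemma integral_mul_trig {u : T3 → ℝ} (hu : Integrable u dx) (k : Fin 3 → ℤ) (c : ℂ) :
    ∫ x, u x * trig k c x ∂dx = (c * (starRingEnd ℂ) (coeffT u k)).re := by
  rw [← coeffT_neg_index, coeffT_eq, neg_neg, ← integral_const_mul]
  have h := (integrable_mFourier_mul hu k).const_mul c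
  have h1 := integral_re h
  rw [RCLike.re_eq_complex_re] at h1
  rw [← h1]
  refine integral_congr_ae (Eventually.of_forall fun x => ?_)
  simp only [trig]
  rw [← mul_assoc, mul_comm (c * _) (u x : ℂ), Complex.re_ofReal_mul]

/-- A complex number is determined by the numbers `Re (c * conj z)`. -/
lemma eq_of_forall_re_mul {z w : ℂ}
    (h : ∀ c : ℂ, (c * (starRingEnd ℂ) z).re = (c * (starRingEnd ℂ) w).re) : z = w := by
  apply Complex.ext
  · simpa using h 1
  · simpa using h Complex.I

/-- The weak Poisson equation on the Fourier side. -/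
lemma solvesPoisson_iff {u f : T3 → ℝ} (hu : MemLp u 2 dx) (hf : MemLp f 2 dx) :
    SolvesPoisson u f ↔ ∀ k, lam k * coeffT u k = coeffT f k := by
  constructor
  · intro h k
    refine eq_of_forall_re_mul fun c => ?_
    have h1 := h (trig k c) (smoothOnTorus_trig k c)
    simp only [laplacianT_trig] at h1
    have e : ∀ x, u x * (-(lam k) * trig k c x) = -(lam k) * (u x * trig k c x) := fun x => by ring
    simp only [e] at h1
    rw [integral_const_mul, integral_mul_trig (hu.integrable one_le_two),
      integral_mul_trig (hf.integrable one_le_two)] at h1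
    rw [← h1, map_mul, Complex.conj_ofReal, mul_left_comm, Complex.re_ofReal_mul]
    ring
  · intro h χ hχ
    obtain ⟨w, hw, hwk⟩ := hχ.exists_laplacian
    have h1 := hasSum_coeffT_mul hu w.memLp
    have h2 := hasSum_coeffT_mul hf hχ.toCT.memLp
    have h3 : HasSum (fun k => -((starRingEnd ℂ) (coeffT u k) * coeffT w k))
        ((∫ x, f x * χ x ∂dx : ℝ) : ℂ) := by
      refine h2.congr_fun fun k => ?_
      rw [← h k, hwk, map_mul, Complex.conj_ofReal]
      change _ = _ * coeffT χ k
      ring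
    have h4 := h1.neg.unique h3
    simp only [hw] at h4
    exact_mod_cast h4

lemma solvesPoisson_iff_isPot {u d : T3 → ℝ} {Φ N : CT} (hu : u =ᵐ[dx] Φ) (hd : d =ᵐ[dx] N)
    (β : ℝ) : SolvesPoisson u (fun x => 4 * Real.pi * (d x - Real.exp (β * u x))) ↔ IsPot β Φ N := by
  have hf : (fun x => 4 * Real.pi * (d x - Real.exp (β * u x))) =ᵐ[dx]
      ((4 * Real.pi) • charge β Φ N : CT) := by
    filter_upwards [hu, hd] with x h1 h2
    rw [h1, h2]; rfl
  rw [solvesPoisson_iff (Φ.memLp.ae_eq hu.symm) ((CT.memLp _).ae_eq hf.symm)]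
  simp only [coeffT_congr hu, coeffT_congr hf]
  rfl

/-- The field energy on the Fourier side. -/
lemma fieldEnergy_eq {u : T3 → ℝ} {Φ N : CT} {β : ℝ} (hu : u =ᵐ[dx] Φ) (h : IsPot β Φ N)
    (hN : wien 0 N ≠ ⊤) : fieldEnergy u = potEnergy β Φ N := by
  have hw := h.wien_ne_top hN
  have hu2 : MemLp u 2 dx := Φ.memLp.ae_eq hu.symm
  have hex : ∀ j, ∃ w, IsWeakPartial j u w := fun j => by
    have hs : Summable fun k => ‖((2 * Real.pi * k j : ℝ) : ℂ) * Complex.I * coeffT Φ k‖ := by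
      refine Summable.of_nonneg_of_le (fun _ => norm_nonneg _) (fun k => ?_)
        (ENNReal.summable_toReal hw)
      rw [ENNReal.toReal_mul, Real.rpow_one, ENNReal.toReal_ofReal (symbolX_pos k).le, toReal_enorm,
        norm_mul, norm_mul, Complex.norm_I, mul_one, Complex.norm_real]
      refine mul_le_mul_of_nonneg_right ?_ (norm_nonneg _)
      have h1 : (2 * Real.pi * k j) ^ 2 ≤ lam k :=
        Finset.single_le_sum (f := fun i => (2 * Real.pi * (k i : ℝ)) ^ 2)
          (fun i _ => sq_nonneg _) (Finset.mem_univ j)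
      rw [Real.norm_eq_abs, symbolX_eq, abs_le]
      constructor <;> nlinarith [sq_nonneg (2 * Real.pi * k j - 1), sq_nonneg (2 * Real.pi * k j + 1)]
    obtain ⟨w, hwk⟩ := exists_CT_of_coeff hs fun k => by
      rw [coeffT_neg_index, map_mul, map_mul, Complex.conj_I, Complex.conj_ofReal]
      push_cast [Pi.neg_apply]; ring
    refine ⟨w, w.memLp, fun χ hχ => ?_⟩
    have h1 := hasSum_coeffT_mul hu2 (hχ.partialT j).toCT.memLp
    have h2 := hasSum_coeffT_mul w.memLp hχ.toCT.memLp
    have h3 : HasSum (fun k => (starRingEnd ℂ) (coeffT u k) * coeffT (hχ.partialT j).toCT k)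
        (-((∫ x, w x * χ x ∂dx : ℝ) : ℂ)) := by
      refine h2.neg.congr_fun fun k => ?_
      have a := hχ.coeffT_partialT j k
      change _ * coeffT (partialT j χ) k = -(_ * coeffT χ k)
      rw [a, hwk, coeffT_congr hu, map_mul, map_mul, Complex.conj_I, Complex.conj_ofReal]
      ring
    have h4 := h1.unique h3
    exact_mod_cast h4
  have hwp : ∀ j, IsWeakPartial j u (weakPartial j u) := fun j => by
    rw [weakPartial, dif_pos (hex j)]; exact (hex j).choose_spec
  have hco : ∀ j k, coeffT (weakPartial j u) k =
      ((2 * Real.pi * k j : ℝ) : ℂ) * Complex.I * coeffT u k := fun j k => by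
    refine eq_of_forall_re_mul fun c => ?_
    have h1 := (hwp j).2 (trig k c) (smoothOnTorus_trig k c)
    rw [partialT_trig, integral_mul_trig (hu2.integrable one_le_two),
      integral_mul_trig ((hwp j).1.integrable one_le_two)] at h1
    rw [map_mul, map_mul, Complex.conj_I, Complex.conj_ofReal]
    have h2 := neg_eq_iff_eq_neg.2 h1
    rw [← h2, ← Complex.neg_re]
    congr 1; ring
  have h1 : HasSum (fun k => ∑ j, ‖coeffT (weakPartial j u) k‖ ^ 2)
      (∑ j, ∫ x, weakPartial j u x ^ 2 ∂dx) :=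
    hasSum_sum fun j _ => hasSum_sq_coeffT (hwp j).1
  have h2 := IsNegLap.hasSum h
  have h3 : ∑ j, ∫ x, weakPartial j u x ^ 2 ∂dx = ip Φ ((4 * Real.pi) • charge β Φ N) := by
    refine h1.unique (h2.congr_fun fun k => ?_)
    rw [lam, Finset.sum_mul]
    refine Finset.sum_congr rfl fun j _ => ?_
    rw [hco, coeffT_congr hu, norm_mul, norm_mul, Complex.norm_I, mul_one, Complex.norm_real, mul_pow,
      Real.norm_eq_abs, sq_abs]
  rw [fieldEnergy, integral_finsetSum _ fun j _ => (hwp j).1.integrable_sq, h3, ip_smul_right,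
    potEnergy]
  field_simp
  ring

/-! ### Continuous representatives -/

lemma exists_rep {σ : ℝ} (hσ : 3 / 2 < σ) {u : T3 → ℝ} (hu : MemSob σ u) :
    ∃ w : CT, u =ᵐ[dx] w := by
  have h1 : wien 0 u ≠ ⊤ := ne_top_of_le_ne_top
    (ENNReal.mul_ne_top ENNReal.coe_ne_top hu.2.ne) (wien_le_sobNorm (m := 0) (by linarith) u)
  obtain ⟨w, hw⟩ := exists_CT_of_coeff (summable_coeffT_of_wien le_rfl h1)
    fun k => coeffT_neg_index u k
  exact ⟨w, ae_eq_of_coeffT_eq hu.1 w.memLp fun k => (hw k).symm⟩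

open Classical in
/-- The continuous representative of a function on the torus (zero if there is none). -/
def rep (u : T3 → ℝ) : CT := if h : ∃ w : CT, u =ᵐ[dx] w then h.choose else 0

lemma ae_eq_rep {σ : ℝ} (hσ : 3 / 2 < σ) {u : T3 → ℝ} (hu : MemSob σ u) : u =ᵐ[dx] rep u := by
  have h := exists_rep hσ hu
  rw [rep, dif_pos h]
  exact h.choose_spec

lemma CT.ext_of_ae {u w : CT} (h : u =ᵐ[dx] w) : u = w :=
  DFunLike.coe_injective (u.continuous.ae_eq_iff_eq (μ := dx) w.continuous |>.1 h)

/-! ### Density and kinetic energy of functions of `(x, v)` -/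

/-- Measurability of a function of `(x, v)`. -/
def MeasXV (u : T3 → R3 → ℝ) : Prop :=
  AEStronglyMeasurable (fun z : T3 × R3 => u z.1 z.2) (dx.prod volume)

lemma weightSq_ne_zero (m : ℕ) (v : R3) : weightSq m v ≠ 0 := by
  rw [weightSq, ne_eq, ENNReal.ofReal_eq_zero, not_le]; positivity

lemma weightSq_ne_top (m : ℕ) (v : R3) : weightSq m v ≠ ⊤ := ENNReal.ofReal_ne_top

lemma measurable_weightSq (m : ℕ) : Measurable (weightSq m) := by
  unfold weightSq; fun_prop

lemma lintegral_weightSq_inv_lt_top {m : ℕ} (hm : 2 ≤ m) :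
    ∫⁻ v, (weightSq m v)⁻¹ < ⊤ := by
  have hr : (Module.finrank ℝ R3 : ℝ) < 2 * m := by
    rw [finrank_euclideanSpace_fin]
    have : (2 : ℝ) ≤ m := by exact_mod_cast hm
    push_cast; linarith
  have h := integrable_rpow_neg_one_add_norm_sq (E := R3) (μ := volume) hr
  have h2 := h.lintegral_lt_top
  refine lt_of_le_of_lt (lintegral_mono fun v => ?_) h2
  rw [weightSq, ← ENNReal.ofReal_inv_of_pos (by positivity)]
  refine ENNReal.ofReal_le_ofReal (le_of_eq ?_)
  rw [show -(2 * (m : ℝ)) / 2 = -(m : ℝ) by ring, Real.rpow_neg (by positivity), Real.rpow_natCast]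

lemma lintegral_mul_sq_le {α : Type*} [MeasurableSpace α] (μ : Measure α) {f g : α → ℝ≥0∞}
    (hf : AEMeasurable f μ) (hg : AEMeasurable g μ) :
    (∫⁻ a, f a * g a ∂μ) ^ 2 ≤ (∫⁻ a, f a ^ 2 ∂μ) * ∫⁻ a, g a ^ 2 ∂μ := by
  have h := ENNReal.lintegral_mul_le_Lp_mul_Lq μ Real.HolderConjugate.two_two hf hg
  simp only [Pi.mul_apply, ENNReal.rpow_two] at h
  calc _ ≤ _ := pow_le_pow_left₀ (zero_le) h 2
    _ = _ := by
      rw [mul_pow, ← ENNReal.rpow_natCast, ← ENNReal.rpow_natCast, ← ENNReal.rpow_mul,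
        ← ENNReal.rpow_mul]
      norm_num

/-- The weighted Cauchy–Schwarz inequality `(∫ |g|)² ≤ ∫ ⟨v⟩^{-2m} ∫ ⟨v⟩^{2m} |g|²`. -/
lemma lintegral_sq_le_weight (m : ℕ) {g : R3 → ℝ≥0∞} (hg : AEMeasurable g volume) :
    (∫⁻ v, g v) ^ 2 ≤ (∫⁻ v, (weightSq m v)⁻¹) * ∫⁻ v, weightSq m v * g v ^ 2 := by
  have hm := measurable_weightSq m
  have h := lintegral_mul_sq_le volume (f := fun v => ((weightSq m v) ^ (1 / 2 : ℝ))⁻¹)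
    (g := fun v => (weightSq m v) ^ (1 / 2 : ℝ) * g v) (hm.pow_const _).inv.aemeasurable
    ((hm.pow_const _).aemeasurable.mul hg)
  have e1 : ∀ v, ((weightSq m v) ^ (1 / 2 : ℝ))⁻¹ * ((weightSq m v) ^ (1 / 2 : ℝ) * g v) = g v :=
    fun v => by
      rw [← mul_assoc, ENNReal.inv_mul_cancel, one_mul]
      · rw [ne_eq, ENNReal.rpow_eq_zero_iff]
        simp [weightSq_ne_zero, weightSq_ne_top]
      · exact ENNReal.rpow_ne_top_of_nonneg (by norm_num) (weightSq_ne_top m v)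
  have e2 : ∀ v, ((weightSq m v) ^ (1 / 2 : ℝ)) ^ 2 = weightSq m v := fun v => by
    rw [← ENNReal.rpow_natCast, ← ENNReal.rpow_mul]; norm_num
  have e3 : ∀ v, (((weightSq m v) ^ (1 / 2 : ℝ))⁻¹) ^ 2 = (weightSq m v)⁻¹ := fun v => by
    rw [← ENNReal.inv_pow, e2]
  simpa only [e1, e3, mul_pow, e2] using h

lemma momentSq_le (s : ℝ) (u : T3 → R3 → ℝ) : momentSq (mExp 1) u ≤ normE' s u ^ 2 := by
  rw [normE', ← ENNReal.rpow_natCast, ← ENNReal.rpow_mul]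
  norm_num

lemma spaceDerivSq_le (s : ℝ) (u : T3 → R3 → ℝ) : spaceDerivSq (mExp 0) s u ≤ normE' s u ^ 2 := by
  rw [normE', ← ENNReal.rpow_natCast, ← ENNReal.rpow_mul]
  norm_num

lemma weightSq_mono {m n : ℕ} (h : m ≤ n) (v : R3) : weightSq m v ≤ weightSq n v :=
  ENNReal.ofReal_le_ofReal (pow_le_pow_right₀ (by nlinarith [sq_nonneg ‖v‖]) h)

lemma normE'_le_normE (s r : ℝ) (u : T3 → R3 → ℝ) : normE' s u ≤ normE s r u := by
  refine ENNReal.rpow_le_rpow ?_ (by norm_num)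
  refine le_trans (add_le_add ?_ ?_) le_self_add
  · exact lintegral_mono fun x => lintegral_mono fun v =>
      mul_le_mul_left (weightSq_mono (by norm_num [mExp]) v) _
  · exact lintegral_mono fun v => mul_le_mul_left (weightSq_mono (by norm_num [mExp]) v) _

lemma MeasXV.ae_slice {u : T3 → R3 → ℝ} (h : MeasXV u) :
    ∀ᵐ x ∂dx, AEStronglyMeasurable (u x) volume := h.prodMk_left

/-- The weighted `L¹` norm with weight `⟨v⟩²` is controlled by the norm of `𝔈'`. -/
lemma exists_lintegral_weight_le : ∃ C : ℝ≥0, 0 < C ∧ ∀ (s : ℝ) (u : T3 → R3 → ℝ), MeasXV u →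
    ∫⁻ z : T3 × R3, ‖(1 + ‖z.2‖ ^ 2) * u z.1 z.2‖ₑ ∂(dx.prod volume) ≤ C * normE' s u := by
  -- the available weight `⟨v⟩^20` is the square of the weight `⟨v⟩²` times `⟨v⟩^16`
  set c : ℝ≥0∞ := ∫⁻ v : R3, (weightSq 8 v)⁻¹ with hc
  have hct : c ≠ ⊤ := (lintegral_weightSq_inv_lt_top (by norm_num)).ne
  refine ⟨(c ^ (1 / 2 : ℝ)).toNNReal + 1, by positivity, fun s u hu => ?_⟩
  have hm : AEMeasurable (fun z : T3 × R3 => ‖(1 + ‖z.2‖ ^ 2) * u z.1 z.2‖ₑ) (dx.prod volume) := by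
    refine AEStronglyMeasurable.enorm (AEStronglyMeasurable.mul ?_ hu)
    exact Continuous.aestronglyMeasurable (by fun_prop)
  have h1 : (∫⁻ z : T3 × R3, ‖(1 + ‖z.2‖ ^ 2) * u z.1 z.2‖ₑ ∂(dx.prod volume)) ^ 2 ≤
      c * momentSq (mExp 1) u := by
    have e : ∀ x v, weightSq 8 v * ‖(1 + ‖v‖ ^ 2) * u x v‖ₑ ^ 2 =
        weightSq (mExp 1) v * ‖u x v‖ₑ ^ 2 := fun x v => by
      rw [enorm_mul, mul_pow, ← mul_assoc, Real.enorm_of_nonneg (by positivity),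
        ← ENNReal.ofReal_pow (by positivity), weightSq, weightSq,
        ← ENNReal.ofReal_mul (by positivity), ← pow_add]
      rfl
    calc _ = (∫⁻ x, 1 * ∫⁻ v, ‖(1 + ‖v‖ ^ 2) * u x v‖ₑ ∂volume ∂dx) ^ 2 := by
          rw [lintegral_prod _ hm]; simp only [one_mul]
      _ ≤ (∫⁻ _, 1 ^ 2 ∂dx) * ∫⁻ x, (∫⁻ v, ‖(1 + ‖v‖ ^ 2) * u x v‖ₑ ∂volume) ^ 2 ∂dx :=
          lintegral_mul_sq_le dx aemeasurable_const hm.lintegral_prod_right'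
      _ = ∫⁻ x, (∫⁻ v, ‖(1 + ‖v‖ ^ 2) * u x v‖ₑ ∂volume) ^ 2 ∂dx := by simp
      _ ≤ ∫⁻ x, c * ∫⁻ v, weightSq 8 v * ‖(1 + ‖v‖ ^ 2) * u x v‖ₑ ^ 2 ∂volume ∂dx := by
          refine lintegral_mono_ae ?_
          filter_upwards [hu.ae_slice] with x hx
          refine lintegral_sq_le_weight 8 ?_
          exact (AEStronglyMeasurable.mul
            (Continuous.aestronglyMeasurable (by fun_prop)) hx).enorm
      _ = _ := by
          rw [lintegral_const_mul' _ _ hct]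
          simp only [e]
          rfl
  have h2 := h1.trans (mul_le_mul_right (momentSq_le s u) c)
  have hc2 : c = (c ^ (1 / 2 : ℝ)) ^ 2 := by
    rw [← ENNReal.rpow_natCast, ← ENNReal.rpow_mul]; norm_num
  rw [hc2, ← mul_pow, ENNReal.pow_le_pow_left_iff two_ne_zero] at h2
  refine h2.trans (mul_le_mul_left ?_ _)
  push_cast
  rw [ENNReal.coe_toNNReal (ENNReal.rpow_ne_top_of_nonneg (by norm_num) hct)]
  exact le_self_add

/-- The kinetic energy is bounded on `𝔈'`. -/
lemma exists_kinetic_le : ∃ C : ℝ≥0, ∀ (s : ℝ) (u : T3 → R3 → ℝ), MeasXV u →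
    ‖kinetic u‖ₑ ≤ C * normE' s u := by
  obtain ⟨C, -, hC⟩ := exists_lintegral_weight_le
  refine ⟨C, fun s u hu => le_trans ?_ (hC s u hu)⟩
  refine (enorm_integral_le_lintegral_enorm _).trans (lintegral_mono fun z => ?_)
  rw [enorm_mul, enorm_mul]
  refine mul_le_mul_left ?_ _
  rw [Real.enorm_of_nonneg (by positivity), Real.enorm_of_nonneg (by positivity)]
  exact ENNReal.ofReal_le_ofReal (by nlinarith [sq_nonneg ‖z.2‖])

lemma MemE'.integrable_weight {s : ℝ} {u : T3 → R3 → ℝ} (h : MemE' s u) :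
    Integrable (fun z : T3 × R3 => (1 + ‖z.2‖ ^ 2) * u z.1 z.2) (dx.prod volume) := by
  obtain ⟨C, -, hC⟩ := exists_lintegral_weight_le
  refine ⟨AEStronglyMeasurable.mul (Continuous.aestronglyMeasurable (by fun_prop)) h.1, ?_⟩
  exact (hC s u h.1).trans_lt (ENNReal.mul_lt_top ENNReal.coe_lt_top h.2)

lemma MemE'.integrable {s : ℝ} {u : T3 → R3 → ℝ} (h : MemE' s u) :
    Integrable (fun z : T3 × R3 => u z.1 z.2) (dx.prod volume) := by
  refine h.integrable_weight.mono h.1 (Eventually.of_forall fun z => ?_)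
  rw [norm_mul]
  refine le_mul_of_one_le_left (norm_nonneg _) ?_
  rw [Real.norm_of_nonneg (by positivity)]
  nlinarith [sq_nonneg ‖z.2‖]

lemma MemE'.integrable_kinetic {s : ℝ} {u : T3 → R3 → ℝ} (h : MemE' s u) :
    Integrable (fun z : T3 × R3 => ‖z.2‖ ^ 2 / 2 * u z.1 z.2) (dx.prod volume) := by
  refine h.integrable_weight.mono
    (AEStronglyMeasurable.mul (Continuous.aestronglyMeasurable (by fun_prop)) h.1)
    (Eventually.of_forall fun z => ?_)
  rw [norm_mul, norm_mul]
  refine mul_le_mul_of_nonneg_right ?_ (norm_nonneg _)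
  rw [Real.norm_of_nonneg (by positivity), Real.norm_of_nonneg (by positivity)]
  nlinarith [sq_nonneg ‖z.2‖]

lemma kinetic_sub {s : ℝ} {u w : T3 → R3 → ℝ} (hu : MemE' s u) (hw : MemE' s w) :
    kinetic (u - w) = kinetic u - kinetic w := by
  rw [kinetic, kinetic, kinetic, ← integral_sub hu.integrable_kinetic hw.integrable_kinetic]
  congr 1; ext z; simp only [Pi.sub_apply]; ring

lemma density_sub {s : ℝ} {u w : T3 → R3 → ℝ} (hu : MemE' s u) (hw : MemE' s w) :
    density (u - w) =ᵐ[dx] fun x => density u x - density w x := by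
  filter_upwards [hu.integrable.prod_right_ae, hw.integrable.prod_right_ae] with x h1 h2
  exact integral_sub h1 h2

lemma coeffT_density {u : T3 → R3 → ℝ}
    (hu : Integrable (fun z : T3 × R3 => u z.1 z.2) (dx.prod volume)) (k : Fin 3 → ℤ) :
    coeffT (density u) k = ∫ v, coeffT (fun x => u x v) k := by
  have hF : Integrable (fun z : T3 × R3 => UnitAddTorus.mFourier (-k) z.1 * (u z.1 z.2 : ℂ))
      (dx.prod volume) := by
    refine (hu.ofReal (𝕜 := ℂ)).bdd_mul (c := 1) ?_ ?_
    · exact ((UnitAddTorus.mFourier (-k)).continuous.comp continuous_fst).aestronglyMeasurable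
    · exact Eventually.of_forall fun z => (norm_mFourier_apply _ z.1).le
  have h := integral_integral_swap (f := fun x v => UnitAddTorus.mFourier (-k) x * (u x v : ℂ)) hF
  simp only [coeffT_eq]
  rw [← h]
  refine integral_congr_ae (Eventually.of_forall fun x => ?_)
  simp only
  rw [integral_const_mul, density, integral_complex_ofReal]

lemma aestronglyMeasurable_coeffT {u : T3 → R3 → ℝ} (hu : MeasXV u) (k : Fin 3 → ℤ) :
    AEStronglyMeasurable (fun v => coeffT (fun x => u x v) k) volume := by
  have hF : AEStronglyMeasurable
      (fun z : T3 × R3 => UnitAddTorus.mFourier (-k) z.1 * (u z.1 z.2 : ℂ)) (dx.prod volume) :=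
    ((UnitAddTorus.mFourier (-k)).continuous.comp continuous_fst).aestronglyMeasurable.mul
      (Complex.continuous_ofReal.comp_aestronglyMeasurable hu)
  exact hF.prod_swap.integral_prod_right'

/-- The density is bounded from `𝔈'` to `H^s`. -/
lemma exists_density_le : ∃ C : ℝ≥0, ∀ (s : ℝ) (u : T3 → R3 → ℝ), MeasXV u →
    sobNorm s (density u) ≤ C * normE' s u := by
  set c : ℝ≥0∞ := ∫⁻ v : R3, (weightSq (mExp 0) v)⁻¹ with hc
  have hct : c ≠ ⊤ := (lintegral_weightSq_inv_lt_top (by norm_num [mExp])).ne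
  refine ⟨(c ^ (1 / 2 : ℝ)).toNNReal + 1, fun s u hu => ?_⟩
  by_cases htop : normE' s u = ⊤
  · rw [htop, ENNReal.mul_top (by simp)]; exact le_top
  have hmem : MemE' s u := ⟨hu, lt_top_iff_ne_top.2 htop⟩
  have h1 : sobSq s (density u) ≤ c * spaceDerivSq (mExp 0) s u := by
    calc sobSq s (density u) ≤ ∑' k : Fin 3 → ℤ, ENNReal.ofReal (symbolX k ^ s) *
          (c * ∫⁻ v, weightSq (mExp 0) v * ‖coeffT (fun x => u x v) k‖ₑ ^ 2) := by
          refine ENNReal.tsum_le_tsum fun k => mul_le_mul_right ?_ _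
          rw [coeffT_density hmem.integrable]
          refine (pow_le_pow_left₀ (zero_le) (enorm_integral_le_lintegral_enorm _) 2).trans ?_
          exact lintegral_sq_le_weight _ (aestronglyMeasurable_coeffT hu k).enorm
      _ = c * ∑' k : Fin 3 → ℤ, ∫⁻ v, weightSq (mExp 0) v *
          (ENNReal.ofReal (symbolX k ^ s) * ‖coeffT (fun x => u x v) k‖ₑ ^ 2) := by
          rw [← ENNReal.tsum_mul_left]
          refine tsum_congr fun k => ?_
          rw [mul_left_comm, ← lintegral_const_mul' _ _ ENNReal.ofReal_ne_top]
          congr 2; ext v; ring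
      _ = c * spaceDerivSq (mExp 0) s u := by
          rw [spaceDerivSq, ← lintegral_tsum]
          · simp only [sobSq, ENNReal.tsum_mul_left]
          · intro k
            refine (measurable_weightSq _).aemeasurable.mul (AEMeasurable.const_mul ?_ _)
            exact (aestronglyMeasurable_coeffT hu k).enorm.pow_const 2
  have h2 := h1.trans (mul_le_mul_right (spaceDerivSq_le s u) c)
  have hc2 : c = (c ^ (1 / 2 : ℝ)) ^ 2 := by
    rw [← ENNReal.rpow_natCast, ← ENNReal.rpow_mul]; norm_num
  rw [hc2, ← mul_pow, ← sobNorm_sq, ENNReal.pow_le_pow_left_iff two_ne_zero] at h2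
  refine h2.trans (mul_le_mul_left ?_ _)
  push_cast
  rw [ENNReal.coe_toNNReal (ENNReal.rpow_ne_top_of_nonneg (by norm_num) hct)]
  exact le_self_add

lemma MemE'.memLp_density {s : ℝ} {u : T3 → R3 → ℝ} (h : MemE' s u) : MemLp (density u) 2 dx := by
  refine ⟨h.1.integral_prod_right', ?_⟩
  rw [eLpNorm_lt_top_iff_lintegral_rpow_enorm_lt_top (by norm_num) (by norm_num)]
  set c : ℝ≥0∞ := ∫⁻ v : R3, (weightSq (mExp 1) v)⁻¹ with hc
  have hct : c ≠ ⊤ := (lintegral_weightSq_inv_lt_top (by norm_num [mExp])).ne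
  have h1 : ∫⁻ x, ‖density u x‖ₑ ^ (2 : ℝ≥0∞).toReal ∂dx ≤ c * momentSq (mExp 1) u := by
    rw [momentSq, ← lintegral_const_mul' _ _ hct]
    refine lintegral_mono_ae ?_
    filter_upwards [MeasXV.ae_slice h.1] with x hx
    rw [ENNReal.toReal_ofNat, ENNReal.rpow_two]
    exact (pow_le_pow_left₀ (zero_le) (enorm_integral_le_lintegral_enorm _) 2).trans
      (lintegral_sq_le_weight _ hx.enorm)
  refine h1.trans_lt (ENNReal.mul_lt_top (lt_top_iff_ne_top.2 hct) ?_)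
  exact (momentSq_le s u).trans_lt (ENNReal.pow_lt_top h.2)

lemma MemE'.memSob_density {s : ℝ} {u : T3 → R3 → ℝ} (h : MemE' s u) : MemSob s (density u) := by
  obtain ⟨C, hC⟩ := exists_density_le
  exact ⟨h.memLp_density, (hC s u h.1).trans_lt (ENNReal.mul_lt_top ENNReal.coe_lt_top h.2)⟩

/-! ### Densities and energies along a curve in `𝔈'` -/

/-- The continuous representative of the density at time `t`. -/
def dens (G : ℝ → T3 → R3 → ℝ) (t : ℝ) : CT := rep (density (G t))

lemma MemE'.density_ae {s : ℝ} (hs : 5 / 2 < s) {u : T3 → R3 → ℝ} (h : MemE' s u) :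
    density u =ᵐ[dx] rep (density u) := ae_eq_rep (by linarith) h.memSob_density

lemma MemE'.wien_rep_ne_top {s : ℝ} (hs : 5 / 2 < s) {u : T3 → R3 → ℝ} (h : MemE' s u) :
    wien 0 (rep (density u)) ≠ ⊤ := by
  refine ne_top_of_le_ne_top ?_ (wien_le_sobNorm (m := 0) (σ := s) (by linarith) _)
  rw [← sobNorm_congr fun k => coeffT_congr (h.density_ae hs) k]
  exact ENNReal.mul_ne_top ENNReal.coe_ne_top h.memSob_density.2.ne

/-- The constant in the bounds of density and kinetic energy by the norm of `𝔈'`. -/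
lemma exists_moment_const : ∃ C : ℝ≥0, ∀ (s : ℝ), 5 / 2 < s → ∀ u : T3 → R3 → ℝ, MemE' s u →
    (sobNorm s (rep (density u)) ≤ C * normE' s u ∧ ‖kinetic u‖ₑ ≤ C * normE' s u) ∧
    ∀ w : T3 → R3 → ℝ, MemE' s w →
      sobNorm s (rep (density u) - rep (density w) : CT) ≤ C * normE' s (u - w) ∧
      ‖kinetic u - kinetic w‖ₑ ≤ C * normE' s (u - w) := by
  obtain ⟨C₁, h₁⟩ := exists_density_le
  obtain ⟨C₂, h₂⟩ := exists_kinetic_le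
  have a1 : (C₁ : ℝ≥0∞) ≤ ((C₁ + C₂ : ℝ≥0) : ℝ≥0∞) := by push_cast; exact le_self_add
  have a2 : (C₂ : ℝ≥0∞) ≤ ((C₁ + C₂ : ℝ≥0) : ℝ≥0∞) := by push_cast; exact le_add_self
  refine ⟨C₁ + C₂, fun s hs u hu => ⟨⟨?_, ?_⟩, fun w hw => ⟨?_, ?_⟩⟩⟩
  · rw [← sobNorm_congr fun k => coeffT_congr (hu.density_ae hs) k]
    exact (h₁ s u hu.1).trans (mul_le_mul_left a1 _)
  · exact (h₂ s u hu.1).trans (mul_le_mul_left a2 _)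
  · have hd : density (u - w) =ᵐ[dx] (rep (density u) - rep (density w) : CT) := by
      filter_upwards [density_sub hu hw, hu.density_ae hs, hw.density_ae hs] with x e1 e2 e3
      rw [e1, e2, e3]; rfl
    rw [← sobNorm_congr fun k => coeffT_congr hd k]
    have hm : MeasXV (u - w) := hu.1.sub hw.1
    exact (h₁ s _ hm).trans (mul_le_mul_left a1 _)
  · rw [← kinetic_sub hu hw]
    have hm : MeasXV (u - w) := hu.1.sub hw.1
    exact (h₂ s _ hm).trans (mul_le_mul_left a2 _)

/-- A property that holds for almost every `t ∈ [0,T]` holds for some `t` arbitrarily close to a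
given time. -/
lemma frequently_of_ae {T : ℝ} (hT : 0 < T) {P : ℝ → Prop}
    (h : ∀ᵐ t ∂(volume.restrict (Icc 0 T)), P t) {t₀ : ℝ} (ht₀ : t₀ ∈ Icc 0 T) :
    ∃ᶠ t in 𝓝[Icc 0 T] t₀, P t := by
  intro hn
  rw [ae_restrict_iff' measurableSet_Icc] at h
  obtain ⟨δ, hδ, hball⟩ := Metric.mem_nhdsWithin_iff.1 hn
  have hsub : Ioo (max 0 (t₀ - δ)) (min T (t₀ + δ)) ⊆ {t | ¬(t ∈ Icc 0 T → P t)} := by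
    intro t ht hP
    have h1 := max_lt_iff.1 ht.1
    have h2 := lt_min_iff.1 ht.2
    have htI : t ∈ Icc 0 T := ⟨h1.1.le, h2.1.le⟩
    refine hball ⟨?_, htI⟩ (hP htI)
    rw [Metric.mem_ball, Real.dist_eq, abs_lt]
    constructor <;> linarith
  have h0 := measure_mono_null hsub h
  rw [Real.volume_Ioo, ENNReal.ofReal_eq_zero, sub_nonpos] at h0
  have : max 0 (t₀ - δ) < min T (t₀ + δ) := by
    rw [max_lt_iff, lt_min_iff, lt_min_iff]
    exact ⟨⟨hT, by linarith [ht₀.1]⟩, by linarith [ht₀.2], by linarith⟩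
  linarith

lemma ae_le_of_timeSup_le {T : ℝ} {f : ℝ → ℝ≥0∞} {c : ℝ≥0∞} (h : timeSup T f ≤ c) :
    ∀ᵐ t ∂(volume.restrict (Icc 0 T)), f t ≤ c := by
  filter_upwards [ENNReal.ae_le_essSup (μ := volume.restrict (Icc 0 T)) f] with t ht
  exact ht.trans h

lemma timeSup_le {T : ℝ} {f : ℝ → ℝ≥0∞} {c : ℝ≥0∞} (h : ∀ t ∈ Icc 0 T, f t ≤ c) :
    timeSup T f ≤ c := by
  refine essSup_le_of_ae_le c ?_
  filter_upwards [self_mem_ae_restrict (μ := volume) (s := Icc 0 T) measurableSet_Icc] with t ht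
  exact h t ht

/-- An almost everywhere bound on `[0,T]` extends to every time by continuity. The factor `2` is the
constant in the triangle inequality `sobNorm_add_le`. -/
lemma le_of_ae_le {T : ℝ} (hT : 0 < T) {f d : ℝ → ℝ≥0∞} {c : ℝ≥0∞}
    (h : ∀ᵐ t ∂(volume.restrict (Icc 0 T)), f t ≤ c) {t₀ : ℝ} (ht₀ : t₀ ∈ Icc 0 T)
    (hd : Tendsto d (𝓝[Icc 0 T] t₀) (𝓝 0)) (hf : ∀ t ∈ Icc 0 T, f t₀ ≤ 2 * (d t + f t)) :
    f t₀ ≤ 2 * c := by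
  refine ENNReal.le_of_forall_pos_le_add fun ε hε _ => ?_
  have hε2 : (0 : ℝ≥0∞) < (ε / 2 : ℝ≥0) := by exact_mod_cast half_pos hε
  have h1 := hd.eventually (gt_mem_nhds hε2)
  obtain ⟨t, ht1, ht2, ht3⟩ := ((frequently_of_ae hT h ht₀).and_eventually
    (h1.and self_mem_nhdsWithin)).exists
  refine (hf t ht3).trans ?_
  calc 2 * (d t + f t) ≤ 2 * (((ε / 2 : ℝ≥0) : ℝ≥0∞) + c) := by gcongr
    _ = 2 * c + ((2 * (ε / 2) : ℝ≥0) : ℝ≥0∞) := by push_cast; ring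
    _ = 2 * c + ε := by rw [mul_div_cancel₀ _ two_ne_zero]

lemma sobNorm_CT_le_two (σ : ℝ) (u w : CT) :
    sobNorm σ u ≤ 2 * (sobNorm σ (w - u : CT) + sobNorm σ w) := by
  have := sobNorm_CT_sub_le σ w (w - u)
  rw [sub_sub_cancel] at this
  rwa [add_comm]

lemma enorm_le_two (a b : ℝ) : ‖a‖ₑ ≤ 2 * (‖b - a‖ₑ + ‖b‖ₑ) := by
  have h : ‖a‖ₑ ≤ ‖b - a‖ₑ + ‖b‖ₑ := by
    have := enorm_sub_le (a := b) (b := b - a)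
    rw [sub_sub_cancel] at this
    rwa [add_comm]
  exact h.trans (le_mul_of_one_le_left zero_le (by norm_num))

section curves

variable {s T : ℝ} {G : ℝ → T3 → R3 → ℝ}

lemma ContE'.mono (h : ContE' s T G) {T' : ℝ} (hT : T' ≤ T) : ContE' s T' G :=
  ⟨fun t ht => h.1 t ⟨ht.1, ht.2.trans hT⟩, fun t ht =>
    (h.2 t ⟨ht.1, ht.2.trans hT⟩).mono_left (nhdsWithin_mono _ (Icc_subset_Icc_right hT))⟩

lemma ContE'.tendsto_dens (hs : 5 / 2 < s) (h : ContE' s T G) {t₀ : ℝ} (ht₀ : t₀ ∈ Icc 0 T) :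
    Tendsto (fun t => sobNorm s (dens G t - dens G t₀ : CT)) (𝓝[Icc 0 T] t₀) (𝓝 0) := by
  obtain ⟨C, hC⟩ := exists_moment_const
  have h1 := ENNReal.Tendsto.const_mul (a := (C : ℝ≥0∞)) (h.2 t₀ ht₀) (Or.inr ENNReal.coe_ne_top)
  rw [mul_zero] at h1
  refine tendsto_of_tendsto_of_tendsto_of_le_of_le' tendsto_const_nhds h1
    (Eventually.of_forall fun _ => zero_le) ?_
  filter_upwards [self_mem_nhdsWithin] with t ht
  exact ((hC s hs _ (h.1 t ht)).2 _ (h.1 t₀ ht₀)).1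

lemma ContE'.tendsto_kinetic (hs : 5 / 2 < s) (h : ContE' s T G) {t₀ : ℝ} (ht₀ : t₀ ∈ Icc 0 T) :
    Tendsto (fun t => ‖kinetic (G t) - kinetic (G t₀)‖ₑ) (𝓝[Icc 0 T] t₀) (𝓝 0) := by
  obtain ⟨C, hC⟩ := exists_moment_const
  have h1 := ENNReal.Tendsto.const_mul (a := (C : ℝ≥0∞)) (h.2 t₀ ht₀) (Or.inr ENNReal.coe_ne_top)
  rw [mul_zero] at h1
  refine tendsto_of_tendsto_of_tendsto_of_le_of_le' tendsto_const_nhds h1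
    (Eventually.of_forall fun _ => zero_le) ?_
  filter_upwards [self_mem_nhdsWithin] with t ht
  exact ((hC s hs _ (h.1 t ht)).2 _ (h.1 t₀ ht₀)).2

lemma norm_le_embConst (hs : 5 / 2 < s) (u : CT) : ‖u‖ₑ ≤ embConst 0 s * sobNorm s u :=
  (enorm_le_wien u).trans (wien_le_sobNorm (m := 0) (by linarith) _)

lemma tendsto_norm_of_sobNorm {σ : ℝ} (hs : 5 / 2 < σ) {f : ℝ → CT} {S : Set ℝ} {t₀ : ℝ}
    (h : Tendsto (fun t => sobNorm σ (f t - f t₀ : CT)) (𝓝[S] t₀) (𝓝 0)) :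
    Tendsto f (𝓝[S] t₀) (𝓝 (f t₀)) := by
  rw [tendsto_iff_edist_tendsto_0]
  have h1 := ENNReal.Tendsto.const_mul (a := (embConst 0 σ : ℝ≥0∞)) h
    (Or.inr ENNReal.coe_ne_top)
  rw [mul_zero] at h1
  refine tendsto_of_tendsto_of_tendsto_of_le_of_le tendsto_const_nhds h1 (fun _ => zero_le) ?_
  intro t
  simp only
  rw [edist_eq_enorm_sub]
  exact norm_le_embConst hs _

lemma ContE'.continuousOn_dens (hs : 5 / 2 < s) (h : ContE' s T G) :
    ContinuousOn (dens G) (Icc 0 T) := fun _ ht =>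
  tendsto_norm_of_sobNorm hs (h.tendsto_dens hs ht)

lemma ContE'.continuousOn_kinetic (hs : 5 / 2 < s) (h : ContE' s T G) :
    ContinuousOn (fun t => kinetic (G t)) (Icc 0 T) := fun t ht => by
  change Tendsto _ _ _
  rw [tendsto_iff_edist_tendsto_0]
  simpa only [edist_eq_enorm_sub] using h.tendsto_kinetic hs ht

end curves

/-! ### Solutions of the system in terms of the stationary problem -/

/-- The continuous representative of the potential of a solution. -/
def potRep (φ : ℝ → T3 → ℝ) (t : ℝ) : CT := rep (φ t)

lemma IsSolution.phi_ae {s T βin : ℝ} {G : ℝ → T3 → R3 → ℝ} {β : ℝ → ℝ} {φ : ℝ → T3 → ℝ}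
    (hs : 5 / 2 < s) (h : IsSolution s T G βin β φ) {t : ℝ} (ht : t ∈ Icc 0 T) :
    φ t =ᵐ[dx] potRep φ t := ae_eq_rep (σ := s + 2) (by linarith) (h.phi_cont.1 t ht)

lemma IsSolution.isPot {s T βin : ℝ} {G : ℝ → T3 → R3 → ℝ} {β : ℝ → ℝ} {φ : ℝ → T3 → ℝ}
    (hs : 5 / 2 < s) (hG : ContE' s T G) (h : IsSolution s T G βin β φ) {t : ℝ}
    (ht : t ∈ Icc 0 T) : IsPot (β t) (potRep φ t) (dens G t) :=
  (solvesPoisson_iff_isPot (h.phi_ae hs ht) ((hG.1 t ht).density_ae hs) (β t)).1 (h.poisson t ht)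

/-- The conservation law integrated in time: it prescribes the energy of the stationary problem at
time `t`. -/
lemma IsSolution.energy_eq {s T βin : ℝ} {G : ℝ → T3 → R3 → ℝ} {β : ℝ → ℝ} {φ : ℝ → T3 → ℝ}
    (hs : 5 / 2 < s) (hG : ContE' s T G) (h : IsSolution s T G βin β φ) {t : ℝ}
    (ht : t ∈ Icc 0 T) : totEnergy (β t) (potRep φ t) (dens G t) =
      totEnergy βin (potRep φ 0) (dens G 0) + kinetic (G 0) - kinetic (G t) := by
  have h0 : (0 : ℝ) ∈ Icc 0 T := ⟨le_rfl, ht.1.trans ht.2⟩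
  have hc := constant_of_derivWithin_zero
    (f := fun τ => 3 / (2 * β τ) + kinetic (G τ) + fieldEnergy (φ τ)) (a := 0) (b := T)
    (fun τ hτ => (h.energy τ hτ).differentiableWithinAt) (fun τ hτ => ?_) t ht
  · have e : ∀ τ ∈ Icc 0 T, fieldEnergy (φ τ) = potEnergy (β τ) (potRep φ τ) (dens G τ) :=
      fun τ hτ => fieldEnergy_eq (h.phi_ae hs hτ) (h.isPot hs hG hτ) ((hG.1 τ hτ).wien_rep_ne_top hs)
    rw [e t ht, e 0 h0] at hc
    have hb := h.init
    rw [totEnergy, totEnergy]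
    rw [hb] at hc
    linarith
  · exact (h.energy τ ⟨hτ.1, hτ.2.le⟩).derivWithin
      (uniqueDiffOn_Icc (hτ.1.trans_lt hτ.2) τ ⟨hτ.1, hτ.2.le⟩)

/-- Two-sided bounds on density and energy along `[0,T]`. The energy is the value prescribed by the
conservation law, for an initial energy `e₀`. -/
structure CurveBound (s T L : ℝ) (G : ℝ → T3 → R3 → ℝ) (e₀ : ℝ) : Prop where
  one_le : 1 ≤ L
  inv_le_dens : ∀ t ∈ Icc 0 T, ∀ x, L⁻¹ ≤ dens G t x
  dens_le : ∀ t ∈ Icc 0 T, ∀ x, dens G t x ≤ L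
  sob_le : ∀ t ∈ Icc 0 T, sobNorm s (dens G t) ≤ L.toNNReal
  inv_le_energy : ∀ t ∈ Icc 0 T, L⁻¹ ≤ e₀ + kinetic (G 0) - kinetic (G t)
  energy_le : ∀ t ∈ Icc 0 T, e₀ + kinetic (G 0) - kinetic (G t) ≤ L

/-- The bound for `β` in terms of the bound of the data. -/
def betaBound (L : ℝ) : ℝ := L * (3 / 2 + L ^ 2)

lemma CurveBound.isBddPot {s T L e₀ : ℝ} {G : ℝ → T3 → R3 → ℝ} (hs : 5 / 2 < s)
    (hG : ContE' s T G) (hb : CurveBound s T L G e₀) {t : ℝ} (ht : t ∈ Icc 0 T) {β : ℝ} {φ : CT}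
    (hβ : 0 < β) (h : IsPot β φ (dens G t))
    (he : totEnergy β φ (dens G t) = e₀ + kinetic (G 0) - kinetic (G t)) :
    IsBddPot (betaBound L) β φ (dens G t) :=
  h.isBddPot hβ hb.one_le ((hG.1 t ht).wien_rep_ne_top hs) (hb.inv_le_dens t ht) (hb.dens_le t ht)
    (he ▸ hb.inv_le_energy t ht) (he ▸ hb.energy_le t ht)

lemma tendsto_sobNorm_of_le {S : Set ℝ} {t₀ : ℝ} {C : ℝ≥0} {f g h : ℝ → ℝ≥0∞}
    (hg : Tendsto g (𝓝[S] t₀) (𝓝 0)) (hh : Tendsto h (𝓝[S] t₀) (𝓝 0))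
    (hf : ∀ t ∈ S, f t ≤ C * (g t + h t)) : Tendsto f (𝓝[S] t₀) (𝓝 0) := by
  have h1 := ENNReal.Tendsto.const_mul (a := (C : ℝ≥0∞)) (hg.add hh) (Or.inr ENNReal.coe_ne_top)
  rw [add_zero, mul_zero] at h1
  refine tendsto_of_tendsto_of_tendsto_of_le_of_le' tendsto_const_nhds h1
    (Eventually.of_forall fun _ => zero_le) ?_
  filter_upwards [self_mem_nhdsWithin] with t ht
  exact hf t ht

/-- Solvability of the system as long as the energy left for the electrons stays positive: one
solves the stationary problem at each time, and the Lipschitz estimate gives continuity in time. -/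
lemma exists_solution {s T L βin : ℝ} (hs : 5 / 2 < s) (hs' : s ≤ 3) (hT : 0 ≤ T)
    {G : ℝ → T3 → R3 → ℝ} (hG : ContE' s T G) (hβ : 0 < βin) {φin : CT}
    (hφ : IsPot βin φin (dens G 0))
    (hb : CurveBound s T L G (totEnergy βin φin (dens G 0))) :
    ∃ (β : ℝ → ℝ) (φ : ℝ → CT), IsSolution s T G βin β (fun t => φ t) ∧
      ∀ t ∈ Icc 0 T, IsBddPot (betaBound L) (β t) (φ t) (dens G t) := by
  set e₀ := totEnergy βin φin (dens G 0) with he₀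
  have hL : 0 < L := zero_lt_one.trans_le hb.one_le
  have hL1 := inv_pos.2 hL
  have hw : ∀ t ∈ Icc 0 T, wien 0 (dens G t) ≠ ⊤ := fun t ht => (hG.1 t ht).wien_rep_ne_top hs
  have hex : ∀ t, ∃ p : ℝ × CT, t ∈ Icc 0 T → 0 < p.1 ∧ IsPot p.1 p.2 (dens G t) ∧
      totEnergy p.1 p.2 (dens G t) = e₀ + kinetic (G 0) - kinetic (G t) := fun t => by
    by_cases ht : t ∈ Icc 0 T
    · obtain ⟨β, φ, h1, h2, h3⟩ := exists_stationary hL1 (hb.inv_le_dens t ht) (hw t ht)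
        (hL1.trans_le (hb.inv_le_energy t ht))
      exact ⟨(β, φ), fun _ => ⟨h1, h2, h3⟩⟩
    · exact ⟨(0, 0), fun h => absurd h ht⟩
  choose p hp using hex
  have hbd : ∀ t ∈ Icc 0 T, IsBddPot (betaBound L) (p t).1 (p t).2 (dens G t) := fun t ht =>
    hb.isBddPot hs hG ht (hp t ht).1 (hp t ht).2.1 (hp t ht).2.2
  have h0 : (0 : ℝ) ∈ Icc 0 T := ⟨le_rfl, hT⟩
  have hinit : (p 0).1 = βin := by
    refine (energy_unique hL1 (hb.inv_le_dens 0 h0) (hw 0 h0) hβ (hp 0 h0).1 hφ (hp 0 h0).2.1 ?_).1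
    rw [(hp 0 h0).2.2]; ring
  obtain ⟨C, hC⟩ := exists_lipschitz hs hs' (betaBound L) L.toNNReal
  have hlip : ∀ t₀ ∈ Icc 0 T, ∀ t ∈ Icc 0 T,
      ‖(p t).1 - (p t₀).1‖ₑ + sobNorm (s + 2) ((p t).2 - (p t₀).2 : CT) ≤
      C * (sobNorm s (dens G t - dens G t₀ : CT) + ‖kinetic (G t) - kinetic (G t₀)‖ₑ) := by
    intro t₀ ht₀ t ht
    have := hC _ _ _ _ _ _ (hbd t₀ ht₀) (hbd t ht) (hb.sob_le t₀ ht₀) (hb.sob_le t ht)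
    rw [(hp t ht).2.2, (hp t₀ ht₀).2.2] at this
    have e : e₀ + kinetic (G 0) - kinetic (G t) - (e₀ + kinetic (G 0) - kinetic (G t₀)) =
        -(kinetic (G t) - kinetic (G t₀)) := by ring
    rwa [e, enorm_neg] at this
  have hpot : ∀ t ∈ Icc 0 T, SolvesPoisson (p t).2 fun x =>
      4 * Real.pi * (density (G t) x - Real.exp ((p t).1 * (p t).2 x)) := fun t ht =>
    (solvesPoisson_iff_isPot (EventuallyEq.refl _ _) ((hG.1 t ht).density_ae hs) _).2
      (hp t ht).2.1
  obtain ⟨C', hC'⟩ := exists_potential_bound hs hs' (betaBound L) L.toNNReal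
  refine ⟨fun t => (p t).1, fun t => (p t).2, ⟨fun t ht => (hp t ht).1, fun t₀ ht₀ => ?_,
    ⟨fun t ht => ⟨(p t).2.memLp, ?_⟩, fun t₀ ht₀ => ?_⟩, fun t ht => ?_, hinit, hpot⟩, hbd⟩
  · change Tendsto _ _ _
    rw [tendsto_iff_edist_tendsto_0]
    simp only [edist_eq_enorm_sub]
    exact tendsto_sobNorm_of_le (hG.tendsto_dens hs ht₀) (hG.tendsto_kinetic hs ht₀)
      fun t ht => le_self_add.trans (hlip t₀ ht₀ t ht)
  · exact (hC' _ _ _ (hbd t ht) (hb.sob_le t ht)).2.trans_lt ENNReal.coe_lt_top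
  · exact tendsto_sobNorm_of_le (hG.tendsto_dens hs ht₀) (hG.tendsto_kinetic hs ht₀)
      fun t ht => le_add_self.trans (hlip t₀ ht₀ t ht)
  · have hconst : ∀ τ ∈ Icc 0 T, 3 / (2 * (p τ).1) + kinetic (G τ) + fieldEnergy (p τ).2 =
        e₀ + kinetic (G 0) := fun τ hτ => by
      rw [fieldEnergy_eq (EventuallyEq.refl _ _) (hp τ hτ).2.1 (hw τ hτ)]
      have := (hp τ hτ).2.2
      rw [totEnergy] at this
      linarith
    exact (hasDerivWithinAt_const t (Icc 0 T) (e₀ + kinetic (G 0))).congr hconst (hconst t ht)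

/-- Uniqueness for the system. The initial potential is determined by `β_in`, the initial energy
therefore too, and the energy determines the solution at each later time. -/
lemma solution_unique {s T βin : ℝ} (hs : 5 / 2 < s)
    {G : ℝ → T3 → R3 → ℝ} (hG : ContE' s T G) {c : ℝ} (hc : 0 < c)
    (hd : ∀ t ∈ Icc 0 T, ∀ x, c ≤ dens G t x)
    {β₁ β₂ : ℝ → ℝ} {φ₁ φ₂ : ℝ → T3 → ℝ} (h₁ : IsSolution s T G βin β₁ φ₁)
    (h₂ : IsSolution s T G βin β₂ φ₂) : ∀ t ∈ Icc 0 T, β₂ t = β₁ t ∧ φ₂ t =ᵐ[dx] φ₁ t := by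
  intro t ht
  have h0 : (0 : ℝ) ∈ Icc 0 T := ⟨le_rfl, ht.1.trans ht.2⟩
  have hw : ∀ t ∈ Icc 0 T, wien 0 (dens G t) ≠ ⊤ := fun t ht => (hG.1 t ht).wien_rep_ne_top hs
  have e1 := h₁.isPot hs hG h0
  have e2 := h₂.isPot hs hG h0
  rw [h₁.init] at e1
  rw [h₂.init] at e2
  have hβ : 0 < βin := h₁.init ▸ h₁.beta_pos 0 h0
  have e3 := isPot_unique hc (hd 0 h0) (hw 0 h0) hβ e1 e2
  have e4 := energy_unique hc (hd t ht) (hw t ht) (h₁.beta_pos t ht) (h₂.beta_pos t ht)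
    (h₁.isPot hs hG ht) (h₂.isPot hs hG ht)
    (by rw [h₁.energy_eq hs hG ht, h₂.energy_eq hs hG ht, e3])
  refine ⟨e4.1, ?_⟩
  filter_upwards [h₁.phi_ae hs ht, h₂.phi_ae hs ht] with x a1 a2
  rw [a1, a2, e4.2]

/-! ### Bounds from the hypotheses on the data -/

lemma CT.le_of_ae_le {u : CT} {S : Set ℝ} (hS : IsClosed S) (h : ∀ᵐ x ∂dx, u x ∈ S) (x : T3) :
    u x ∈ S := by
  have h1 := (Measure.dense_of_ae h).closure_eq
  have h2 : IsClosed {x | u x ∈ S} := hS.preimage u.continuous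
  rw [h2.closure_eq] at h1
  exact eq_univ_iff_forall.1 h1 x

/-- A density that has no zeros and that admits a potential is positive. This yields the sign of the
density when only its absolute value is bounded below. -/
lemma IsPot.density_pos {β : ℝ} {φ n : CT} (hβ : 0 < β) (hn : wien 0 n ≠ ⊤) (h : IsPot β φ n)
    (h0 : ∀ x, n x ≠ 0) (x : T3) : 0 < n x := by
  by_contra hx
  push Not at hx
  by_cases hy : ∃ y, 0 ≤ n y
  · obtain ⟨y, hy⟩ := hy
    obtain ⟨z, hz⟩ := mem_range_of_exists_le_of_exists_ge n.continuous ⟨x, hx⟩ ⟨y, hy⟩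
    exact h0 z hz
  · push Not at hy
    exact absurd (h.exp_le hβ hn (N := 0) (fun y => (hy y).le) x) (Real.exp_pos _).not_ge

lemma normE'_ae_le {s r T M βin : ℝ} {G : ℝ → T3 → R3 → ℝ} (hB : Bootstrap s r T M G βin) :
    ∀ᵐ t ∂(volume.restrict (Icc 0 T)), normE' s (G t) ≤ ENNReal.ofReal M := by
  have h : timeSup T (fun t => normE s r (G t)) ≤ ENNReal.ofReal M := le_add_self.trans hB
  filter_upwards [ae_le_of_timeSup_le h] with t ht
  exact (normE'_le_normE s r (G t)).trans ht

/-- The hypothesis on the data bounds the density away from zero, but says nothing about its sign. -/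
lemma inv_le_abs_dens {s r T M βin : ℝ} (hs : 5 / 2 < s) (hT : 0 < T) (hM : 0 < M)
    {G : ℝ → T3 → R3 → ℝ} (hG : ContE' s T G) (hB : Bootstrap s r T M G βin) {t : ℝ}
    (ht : t ∈ Icc 0 T) : ∀ x, M⁻¹ ≤ |dens G t x| := by
  have h : invDensitySup T G ≤ ENNReal.ofReal M := (le_add_self.trans le_self_add).trans hB
  have h1 : ∀ᵐ τ ∂(volume.restrict (Icc 0 T)), ∀ x, M⁻¹ ≤ |dens G τ x| := by
    filter_upwards [ae_le_of_timeSup_le h,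
      self_mem_ae_restrict (μ := volume) (s := Icc 0 T) measurableSet_Icc] with τ h1 h2
    refine CT.le_of_ae_le (S := {a | M⁻¹ ≤ |a|}) (isClosed_le continuous_const continuous_abs) ?_
    filter_upwards [ENNReal.ae_le_essSup (μ := dx) fun x => ‖density (G τ) x‖ₑ⁻¹,
      (hG.1 τ h2).density_ae hs] with x h3 h4
    have h5 := h3.trans h1
    rw [h4, ENNReal.inv_le_iff_inv_le, ← ENNReal.ofReal_inv_of_pos hM,
      Real.enorm_eq_ofReal_abs] at h5
    exact (ENNReal.ofReal_le_ofReal_iff (abs_nonneg _)).1 h5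
  intro x
  have h2 : Tendsto (fun τ => |dens G τ x|) (𝓝[Icc 0 T] t) (𝓝 |dens G t x|) :=
    (((continuous_eval_const (F := CT) x).tendsto _).comp
      (hG.continuousOn_dens hs t ht)).abs
  exact ge_of_tendsto_of_frequently h2 ((frequently_of_ae hT h1 ht).mono fun τ h => h x)

/-- The bounds that the hypothesis on the data gives, at every time. -/
lemma exists_bootstrap_bound (s r M : ℝ) (hs : 5 / 2 < s) (hM : 0 < M) :
    ∃ L : ℝ, 2 * Real.exp M ≤ L ∧ ∀ (T : ℝ) (G : ℝ → T3 → R3 → ℝ) (βin : ℝ), 0 < T → 0 < βin →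
      ContE' s T G → Bootstrap s r T M G βin →
      (Real.exp (-M) ≤ βin ∧ βin ≤ Real.exp M) ∧
      ∀ t ∈ Icc 0 T, (∀ x, L⁻¹ ≤ |dens G t x|) ∧ (∀ x, dens G t x ≤ L) ∧
        sobNorm s (dens G t) ≤ L.toNNReal ∧ |kinetic (G t)| ≤ L := by
  obtain ⟨C, hC⟩ := exists_moment_const
  set K : ℝ≥0 := 2 * (C * M.toNNReal) with hK
  have hK0 : (0 : ℝ) ≤ K := K.2
  have hE0 : (0 : ℝ) ≤ embConst 0 s * K := by positivity
  have hexp := Real.exp_pos M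
  refine ⟨2 * Real.exp M + M + K + embConst 0 s * K, by linarith,
    fun T G βin hT hβ hG hB => ⟨?_, fun t ht => ?_⟩⟩
  · have h : ‖Real.log βin‖ₑ ≤ ENNReal.ofReal M := (le_self_add.trans le_self_add).trans hB
    rw [Real.enorm_eq_ofReal_abs, ENNReal.ofReal_le_ofReal_iff hM.le, abs_le] at h
    exact ⟨(Real.le_log_iff_exp_le hβ).1 h.1, (Real.log_le_iff_le_exp hβ).1 h.2⟩
  set L := 2 * Real.exp M + M + K + embConst 0 s * K with hL
  have hbd := normE'_ae_le hB
  have hmem := self_mem_ae_restrict (μ := volume) (s := Icc 0 T) measurableSet_Icc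
  have hKe : 2 * ((C : ℝ≥0∞) * ENNReal.ofReal M) = (K : ℝ≥0∞) := by
    rw [hK]; push_cast; rfl
  have h1 : sobNorm s (dens G t) ≤ K := by
    rw [← hKe]
    refine le_of_ae_le hT (f := fun t => sobNorm s (dens G t)) ?_ ht (hG.tendsto_dens hs ht)
      fun τ _ => sobNorm_CT_le_two s _ _
    filter_upwards [hbd, hmem] with τ a1 a2
    exact ((hC s hs _ (hG.1 τ a2)).1.1).trans (mul_le_mul_right a1 _)
  have h2 : ‖kinetic (G t)‖ₑ ≤ K := by
    rw [← hKe]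
    refine le_of_ae_le hT (f := fun t => ‖kinetic (G t)‖ₑ) ?_ ht (hG.tendsto_kinetic hs ht)
      fun τ _ => enorm_le_two _ _
    filter_upwards [hbd, hmem] with τ a1 a2
    exact ((hC s hs _ (hG.1 τ a2)).1.2).trans (mul_le_mul_right a1 _)
  have hKL : (K : ℝ) ≤ L := by linarith
  refine ⟨fun x => ?_, fun x => ?_, h1.trans ?_, ?_⟩
  · refine (inv_anti₀ hM ?_).trans (inv_le_abs_dens hs hT hM hG hB ht x)
    linarith
  · have h3 : ‖dens G t‖ₑ ≤ (embConst 0 s * K : ℝ≥0) := by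
      refine (norm_le_embConst hs _).trans ?_
      push_cast
      gcongr
    rw [enorm_le_coe, ← NNReal.coe_le_coe, coe_nnnorm] at h3
    have h4 := (le_abs_self _).trans ((dens G t).norm_coe_le_norm x)
    push_cast at h3
    linarith
  · exact_mod_cast (Real.le_toNNReal_iff_coe_le (by linarith)).2 hKL
  · rw [enorm_le_coe, ← NNReal.coe_le_coe, coe_nnnorm, Real.norm_eq_abs] at h2
    exact h2.trans hKL

/-- The bound of density and energy along the curve, in terms of the bound of the data. -/
def curveConst (L : ℝ) : ℝ := L * (9 / 2 + L ^ 2)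

/-- Bounds of the data and a lower bound for the energy suffice for a bound along the curve. The
initial energy is at most `(3/2 + L²) L`, by the bound of the field energy, and the kinetic energies
change it by at most `2L`. -/
lemma curveBound_of_le {s T L βin : ℝ} (hT : 0 ≤ T) (hL : 1 ≤ L) {G : ℝ → T3 → R3 → ℝ} {φin : CT}
    (hw : wien 0 (dens G 0) ≠ ⊤)
    (hβ : L⁻¹ ≤ βin) (h : ∀ t ∈ Icc 0 T, (∀ x, L⁻¹ ≤ dens G t x) ∧ (∀ x, dens G t x ≤ L) ∧
        sobNorm s (dens G t) ≤ L.toNNReal ∧ |kinetic (G t)| ≤ L)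
    (hφ : IsPot βin φin (dens G 0))
    (he : ∀ t ∈ Icc 0 T, L⁻¹ ≤
      totEnergy βin φin (dens G 0) + kinetic (G 0) - kinetic (G t)) :
    CurveBound s T (curveConst L) G (totEnergy βin φin (dens G 0)) := by
  have hL0 : 0 < L := by linarith
  have hLL : L ≤ curveConst L := le_mul_of_one_le_right hL0.le (by nlinarith [sq_nonneg L])
  have hinv := inv_anti₀ hL0 hLL
  have h0 : (0 : ℝ) ∈ Icc 0 T := ⟨le_rfl, hT⟩
  have hβ0 : 0 < βin := (inv_pos.2 hL0).trans_le hβ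
  have hβL : βin⁻¹ ≤ L := inv_le_of_inv_le₀ hL0 hβ
  have hp := hφ.potEnergy_le hβ0 hL hw (h 0 h0).1 (h 0 h0).2.1
  have hup : totEnergy βin φin (dens G 0) ≤ (3 / 2 + L ^ 2) * L := by
    have e : 3 / (2 * βin) = 3 / 2 * βin⁻¹ := by field_simp
    rw [totEnergy, e]
    rw [div_eq_mul_inv] at hp
    nlinarith [sq_nonneg L]
  refine ⟨hL.trans hLL, fun t ht x => hinv.trans ((h t ht).1 x),
    fun t ht x => ((h t ht).2.1 x).trans hLL, fun t ht => (h t ht).2.2.1.trans ?_,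
    fun t ht => hinv.trans (he t ht), fun t ht => ?_⟩
  · exact_mod_cast Real.toNNReal_le_toNNReal hLL
  · have h1 := abs_le.1 (h t ht).2.2.2
    have h2 := abs_le.1 (h 0 h0).2.2.2
    rw [curveConst]
    linarith [h1.1, h2.2]

/-- The energy left for the electrons when the kinetic energy grows by little: at the start it is at
least `3/(2β_in) ≥ (3/2) e^{-M}`, and at most `e^{-M}` of it is lost. -/
lemma inv_le_energy_of_small {s T M L βin : ℝ} (hT : 0 ≤ T) (hL : 2 * Real.exp M ≤ L)
    {G : ℝ → T3 → R3 → ℝ} (hG : ContE' s T G) (hβ : 0 < βin) (hβM : βin ≤ Real.exp M) {φin : CT}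
    (hφ : IsPot βin φin (dens G 0)) (hK : SmallKineticChange T M G) {t : ℝ} (ht : t ∈ Icc 0 T) :
    L⁻¹ ≤ totEnergy βin φin (dens G 0) + kinetic (G 0) - kinetic (G t) := by
  have h0 : (0 : ℝ) ∈ Icc 0 T := ⟨le_rfl, hT⟩
  have h1 := hK t ht
  rw [kinetic_sub (hG.1 t ht) (hG.1 0 h0), Real.exp_neg] at h1
  have h2 := inv_anti₀ (by positivity) hL
  rw [mul_inv] at h2
  have h3 := inv_anti₀ hβ hβM
  have h4 := hφ.potEnergy_nonneg
  have e : 3 / (2 * βin) = 3 / 2 * βin⁻¹ := by field_simp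
  rw [totEnergy, e]
  linarith

lemma dens_pos_of_positiveDensity {s T : ℝ} (hs : 5 / 2 < s) {G : ℝ → T3 → R3 → ℝ}
    (hG : ContE' s T G) (hd : PositiveDensity T G) {t : ℝ} (ht : t ∈ Icc 0 T) :
    ∃ c > 0, ∀ x, c ≤ dens G t x := by
  obtain ⟨c, hc, h⟩ := hd t ht
  refine ⟨c, hc, CT.le_of_ae_le (S := Ici c) isClosed_Ici ?_⟩
  filter_upwards [h, (hG.1 t ht).density_ae hs] with x h1 h2
  rw [mem_Ici, ← show density (G t) x = dens G t x from h2]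
  exact h1

/-! ### Existence and uniqueness -/

/-- Short time existence and uniqueness: for a short time the density and the energy stay above half
of their initial lower bounds. -/
lemma exists_unique_short {s T βin : ℝ} (hs : 5 / 2 < s) (hs' : s ≤ 3) {G : ℝ → T3 → R3 → ℝ}
    (hT : 0 < T) (hβ : 0 < βin) (hG : ContE' s T G) (hd : PositiveDensity T G) :
    ∃ Tstar : ℝ, 0 < Tstar ∧ Tstar ≤ T ∧
      ExistsUniqueSolution s Tstar G βin fun _ _ => True := by
  have h0 : (0 : ℝ) ∈ Icc 0 T := ⟨le_rfl, hT.le⟩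
  obtain ⟨c, hc, hcd⟩ := dens_pos_of_positiveDensity hs hG hd h0
  obtain ⟨φ, hφ⟩ := exists_isPot hβ hc hcd
  set e₀ := totEnergy βin φ (dens G 0) with he₀
  have he : 0 < e₀ := by
    have := hφ.potEnergy_nonneg
    have : 0 < 3 / (2 * βin) := by positivity
    rw [he₀, totEnergy]; linarith
  have hsob0 : sobNorm s (dens G 0) ≠ ⊤ := by
    obtain ⟨C, hC⟩ := exists_moment_const
    exact ne_top_of_le_ne_top (ENNReal.mul_ne_top ENNReal.coe_ne_top (hG.1 0 h0).2.ne)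
      (hC s hs _ (hG.1 0 h0)).1.1
  have ev1 := (hG.tendsto_dens hs h0).eventually (gt_mem_nhds zero_lt_one)
  have ev2 := (Metric.tendsto_nhds.1 (hG.continuousOn_dens hs 0 h0)) (c / 2) (by positivity)
  have ev3 := (Metric.tendsto_nhds.1 (hG.continuousOn_kinetic hs 0 h0)) (e₀ / 2) (by positivity)
  obtain ⟨δ, hδ, hball⟩ := Metric.mem_nhdsWithin_iff.1 (ev1.and (ev2.and ev3))
  refine ⟨min T (δ / 2), by positivity, min_le_left _ _, ?_⟩
  have hG' := hG.mono (min_le_left T (δ / 2))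
  have hev : ∀ t ∈ Icc 0 (min T (δ / 2)), sobNorm s (dens G t - dens G 0 : CT) < 1 ∧
      dist (dens G t) (dens G 0) < c / 2 ∧ dist (kinetic (G t)) (kinetic (G 0)) < e₀ / 2 := by
    intro t ht
    have h1 := le_min_iff.1 ht.2
    refine hball ⟨?_, ht.1, h1.1⟩
    rw [Metric.mem_ball, Real.dist_eq, sub_zero, abs_of_nonneg ht.1]
    linarith
  have hdens : ∀ t ∈ Icc 0 (min T (δ / 2)), ∀ x, |dens G t x - dens G 0 x| < c / 2 :=
    fun t ht x => (ContinuousMap.dist_apply_le_dist x).trans_lt (hev t ht).2.1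
  have hlow : ∀ t ∈ Icc 0 (min T (δ / 2)), ∀ x, c / 2 ≤ dens G t x := fun t ht x => by
    have h1 := (abs_lt.1 (hdens t ht x)).1
    linarith [hcd x]
  set S := (2 * (1 + sobNorm s (dens G 0))).toReal with hS
  have hStop : 2 * (1 + sobNorm s (dens G 0)) ≠ ⊤ :=
    ENNReal.mul_ne_top (by simp) (ENNReal.add_ne_top.2 ⟨ENNReal.one_ne_top, hsob0⟩)
  have hS0 : 0 ≤ S := ENNReal.toReal_nonneg
  set L := 1 + (c / 2)⁻¹ + (‖dens G 0‖ + c / 2) + S + (e₀ / 2)⁻¹ + 2 * e₀ with hL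
  have p1 : 0 < (c / 2)⁻¹ := by positivity
  have p2 : 0 < (e₀ / 2)⁻¹ := by positivity
  have p3 := norm_nonneg (dens G 0)
  have hcb : CurveBound s (min T (δ / 2)) L G e₀ := by
    refine ⟨by linarith, fun t ht x => ?_, fun t ht x => ?_, fun t ht => ?_, fun t ht => ?_,
      fun t ht => ?_⟩
    · exact (inv_le_of_inv_le₀ (by positivity) (by linarith)).trans (hlow t ht x)
    · have h1 := (abs_lt.1 (hdens t ht x)).2
      have h2 := (le_abs_self _).trans ((dens G 0).norm_coe_le_norm x)
      linarith
    · have h1 : sobNorm s (dens G t) ≤ 2 * (1 + sobNorm s (dens G 0)) := by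
        have h2 := sobNorm_CT_add_le s (dens G t - dens G 0) (dens G 0)
        rw [sub_add_cancel] at h2
        refine h2.trans ?_
        gcongr
        exact (hev t ht).1.le
      rw [← ENNReal.ofReal_toReal hStop, ← hS] at h1
      exact h1.trans (ENNReal.ofReal_le_ofReal (by linarith))
    · have h1 := (abs_lt.1 (hev t ht).2.2).2
      have h2 : L⁻¹ ≤ e₀ / 2 := inv_le_of_inv_le₀ (by positivity) (by linarith)
      linarith
    · have h1 := (abs_lt.1 (hev t ht).2.2).1
      linarith
  obtain ⟨β, ψ, hsol, -⟩ := exists_solution hs hs' (by positivity) hG' hβ hφ hcb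
  exact ⟨β, fun t => ψ t, hsol, trivial, fun β' φ' h' =>
    solution_unique hs hG' (half_pos hc) hlow hsol h'⟩

lemma abs_log_le_of_bdd {B β : ℝ} (hB : 1 ≤ B) (h1 : B⁻¹ ≤ β) (h2 : β ≤ B) :
    |Real.log β| ≤ Real.log B := by
  have hB0 : 0 < B := by linarith
  have hβ : 0 < β := (inv_pos.2 hB0).trans_le h1
  have a1 := Real.log_le_log (inv_pos.2 hB0) h1
  rw [Real.log_inv] at a1
  exact abs_le.2 ⟨a1, Real.log_le_log hβ h2⟩

/-- Existence and uniqueness on the whole interval, with bounds. -/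
lemma exists_unique_long (s r : ℝ) (hs : 5 / 2 < s) (hs' : s ≤ 3) (M : ℝ) (hM : 0 < M) :
    ∃ C : ℝ≥0, ∀ (T : ℝ) (G : ℝ → T3 → R3 → ℝ) (βin : ℝ), 0 < T → 0 < βin →
      ContE' s T G → PositiveDensity T G → Bootstrap s r T M G βin → SmallKineticChange T M G →
        ExistsUniqueSolution s T G βin fun β φ =>
          timeSup T (fun t => ‖Real.log (β t)‖ₑ) +
            timeSup T (fun t => sobNorm (s + 2) (φ t)) ≤ C := by
  obtain ⟨L, hL, hbound⟩ := exists_bootstrap_bound s r M hs hM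
  obtain ⟨C, hC⟩ := exists_potential_bound hs hs' (betaBound (curveConst L)) (curveConst L).toNNReal
  refine ⟨(Real.log (betaBound (curveConst L))).toNNReal + C,
    fun T G βin hT hβ hG hd hB hK => ?_⟩
  obtain ⟨⟨b1, b2⟩, hb⟩ := hbound T G βin hT hβ hG hB
  have h0 : (0 : ℝ) ∈ Icc 0 T := ⟨le_rfl, hT.le⟩
  have hM1 : 1 < Real.exp M := Real.one_lt_exp_iff.2 hM
  have hL1 : 1 ≤ L := by linarith
  have hpos : ∀ t ∈ Icc 0 T, ∀ x, L⁻¹ ≤ dens G t x := fun t ht x => by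
    obtain ⟨c, hc, h⟩ := dens_pos_of_positiveDensity hs hG hd ht
    rw [← abs_of_pos (hc.trans_le (h x))]
    exact (hb t ht).1 x
  obtain ⟨φin, hφ⟩ := exists_isPot hβ (inv_pos.2 (zero_lt_one.trans_le hL1)) (hpos 0 h0)
  have hβL : L⁻¹ ≤ βin := by
    refine le_trans ?_ b1
    rw [Real.exp_neg]
    exact inv_anti₀ (Real.exp_pos M) (by linarith)
  have hcb := curveBound_of_le hT.le hL1 ((hG.1 0 h0).wien_rep_ne_top hs) hβL
    (fun t ht => ⟨hpos t ht, (hb t ht).2⟩) hφ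
    fun t ht => inv_le_energy_of_small hT.le hL hG hβ b2 hφ hK ht
  obtain ⟨β, ψ, hsol, hbd⟩ := exists_solution hs hs' hT.le hG hβ hφ hcb
  refine ⟨β, fun t => ψ t, hsol, ?_, fun β' φ' h' =>
    solution_unique hs hG (inv_pos.2 (zero_lt_one.trans_le hL1)) hpos hsol h'⟩
  push_cast
  refine add_le_add (timeSup_le fun t ht => ?_) (timeSup_le fun t ht => ?_)
  · rw [Real.enorm_eq_ofReal_abs]
    exact ENNReal.ofReal_le_ofReal
      (abs_log_le_of_bdd (hbd t ht).one_le (hbd t ht).inv_le (hbd t ht).le)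
  · exact (hC _ _ _ (hbd t ht) (hcb.sob_le t ht)).2

/-! ### Lipschitz dependence on the data -/

/-- The bounds for a given solution. A bound of `ln β` bounds the energy below by `3/(2β)`. -/
lemma exists_curveBound (s r : ℝ) (hs : 5 / 2 < s) (M : ℝ) (hM : 0 < M) :
    ∃ L : ℝ, ∀ (T : ℝ) (G : ℝ → T3 → R3 → ℝ) (βin : ℝ) (β : ℝ → ℝ) (φ : ℝ → T3 → ℝ), 0 < T →
      0 < βin → ContE' s T G → IsSolution s T G βin β φ → Bootstrap s r T M G βin →
      (SmallKineticChange T M G ∨ timeSup T (fun t => ‖Real.log (β t)‖ₑ) ≤ ENNReal.ofReal M) →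
      CurveBound s T L G (totEnergy βin (potRep φ 0) (dens G 0)) := by
  obtain ⟨L, hL, hbound⟩ := exists_bootstrap_bound s r M hs hM
  refine ⟨curveConst L, fun T G βin β φ hT hβ hG hsol hB hor => ?_⟩
  obtain ⟨⟨b1, b2⟩, hb⟩ := hbound T G βin hT hβ hG hB
  have h0 : (0 : ℝ) ∈ Icc 0 T := ⟨le_rfl, hT.le⟩
  have hM1 : 1 < Real.exp M := Real.one_lt_exp_iff.2 hM
  have hL1 : 1 ≤ L := by linarith
  have hL0 : 0 < L⁻¹ := inv_pos.2 (by linarith)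
  have hpos : ∀ t ∈ Icc 0 T, ∀ x, L⁻¹ ≤ dens G t x := fun t ht x => by
    have h1 : 0 < dens G t x := (hsol.isPot hs hG ht).density_pos (hsol.beta_pos t ht)
      ((hG.1 t ht).wien_rep_ne_top hs)
      (fun y => abs_pos.1 (hL0.trans_le ((hb t ht).1 y))) x
    rw [← abs_of_pos h1]
    exact (hb t ht).1 x
  have hβL : L⁻¹ ≤ βin := by
    refine le_trans ?_ b1
    rw [Real.exp_neg]
    exact inv_anti₀ (Real.exp_pos M) (by linarith)
  have hφ : IsPot βin (potRep φ 0) (dens G 0) := by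
    have := hsol.isPot hs hG h0
    rwa [hsol.init] at this
  refine curveBound_of_le hT.le hL1 ((hG.1 0 h0).wien_rep_ne_top hs) hβL
    (fun t ht => ⟨hpos t ht, (hb t ht).2⟩) hφ fun t ht => ?_
  rcases hor with hK | hlog
  · exact inv_le_energy_of_small hT.le hL hG hβ b2 hφ hK ht
  · have h1 : ∀ᵐ τ ∂(volume.restrict (Icc 0 T)), β τ ≤ Real.exp M := by
      filter_upwards [ae_le_of_timeSup_le hlog,
        self_mem_ae_restrict (μ := volume) (s := Icc 0 T) measurableSet_Icc] with τ a1 a2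
      rw [Real.enorm_eq_ofReal_abs, ENNReal.ofReal_le_ofReal_iff hM.le] at a1
      exact (Real.log_le_iff_le_exp (hsol.beta_pos τ a2)).1 ((le_abs_self _).trans a1)
    have h2 : β t ≤ Real.exp M :=
      le_of_tendsto_of_frequently (hsol.beta_cont t ht) (frequently_of_ae hT h1 ht)
    have h3 := inv_anti₀ (hsol.beta_pos t ht) h2
    have h4 := (hsol.isPot hs hG ht).potEnergy_nonneg
    have h5 := inv_anti₀ (by positivity) hL
    rw [mul_inv] at h5
    have e : 3 / (2 * β t) = 3 / 2 * (β t)⁻¹ := by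
      have := (hsol.beta_pos t ht).ne'
      field_simp
    have h6 := inv_pos.2 (Real.exp_pos M)
    rw [← hsol.energy_eq hs hG ht, totEnergy, e]
    linarith

/-- The differences of densities and of kinetic energies, at every time. -/
lemma exists_data_sub_le (s : ℝ) (hs : 5 / 2 < s) : ∃ C : ℝ≥0, ∀ (T : ℝ)
    (G₁ G₂ : ℝ → T3 → R3 → ℝ), 0 < T → ContE' s T G₁ → ContE' s T G₂ → ∀ t ∈ Icc 0 T,
      sobNorm s (dens G₂ t - dens G₁ t : CT) ≤ C * timeSup T (fun t => normE' s (G₂ t - G₁ t)) ∧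
      ‖kinetic (G₂ t) - kinetic (G₁ t)‖ₑ ≤ C * timeSup T (fun t => normE' s (G₂ t - G₁ t)) := by
  obtain ⟨C, hC⟩ := exists_moment_const
  refine ⟨2 * C, fun T G₁ G₂ hT h₁ h₂ t ht => ?_⟩
  set Y := timeSup T (fun t => normE' s (G₂ t - G₁ t)) with hY
  have hbd := ae_le_of_timeSup_le (le_refl Y)
  have hmem := self_mem_ae_restrict (μ := volume) (s := Icc 0 T) measurableSet_Icc
  push_cast
  rw [mul_assoc]
  constructor
  · refine le_of_ae_le hT (f := fun t => sobNorm s (dens G₂ t - dens G₁ t : CT))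
      (d := fun τ => sobNorm s ((dens G₂ τ - dens G₁ τ) - (dens G₂ t - dens G₁ t) : CT)) ?_ ht
      (tendsto_sobNorm_of_le (C := 2) (h₂.tendsto_dens hs ht) (h₁.tendsto_dens hs ht)
        fun τ _ => ?_) fun τ _ => sobNorm_CT_le_two s _ _
    · filter_upwards [hbd, hmem] with τ a1 a2
      exact ((hC s hs _ (h₂.1 τ a2)).2 _ (h₁.1 τ a2)).1.trans (mul_le_mul_right a1 _)
    · rw [show dens G₂ τ - dens G₁ τ - (dens G₂ t - dens G₁ t) =
        (dens G₂ τ - dens G₂ t) - (dens G₁ τ - dens G₁ t) by abel]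
      exact sobNorm_CT_sub_le s _ _
  · refine le_of_ae_le hT (f := fun t => ‖kinetic (G₂ t) - kinetic (G₁ t)‖ₑ)
      (d := fun τ => ‖(kinetic (G₂ τ) - kinetic (G₁ τ)) - (kinetic (G₂ t) - kinetic (G₁ t))‖ₑ) ?_ ht
      (tendsto_sobNorm_of_le (C := 1) (h₂.tendsto_kinetic hs ht) (h₁.tendsto_kinetic hs ht)
        fun τ _ => ?_) fun τ _ => enorm_le_two _ _
    · filter_upwards [hbd, hmem] with τ a1 a2
      exact ((hC s hs _ (h₂.1 τ a2)).2 _ (h₁.1 τ a2)).2.trans (mul_le_mul_right a1 _)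
    · rw [show kinetic (G₂ τ) - kinetic (G₁ τ) - (kinetic (G₂ t) - kinetic (G₁ t)) =
        (kinetic (G₂ τ) - kinetic (G₂ t)) - (kinetic (G₁ τ) - kinetic (G₁ t)) by abel]
      rw [ENNReal.coe_one, one_mul]
      exact enorm_sub_le

/-- The energy at a given temperature is a Lipschitz function of the data. -/
lemma exists_totEnergy_stability (B : ℝ) : ∃ C : ℝ≥0, ∀ (β₁ β₂ : ℝ) (φ₁ φ₂ n₁ n₂ : CT),
    IsBddPot B β₁ φ₁ n₁ → IsBddPot B β₂ φ₂ n₂ →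
      ‖totEnergy β₂ φ₂ n₂ - totEnergy β₁ φ₁ n₁‖ₑ ≤ C * (‖n₂ - n₁‖ₑ + ‖β₂ - β₁‖ₑ) := by
  obtain ⟨C, hC0, hC⟩ := exists_potential_stability B
  refine ⟨(3 / 2 * B ^ 2 + C).toNNReal, fun β₁ β₂ φ₁ φ₂ n₁ n₂ h₁ h₂ => ?_⟩
  have h := (hC _ _ _ _ _ _ h₁ h₂).2
  have hB := h₁.B_pos
  have e : 3 / (2 * β₂) - 3 / (2 * β₁) = -(3 / 2 * (β₁⁻¹ * β₂⁻¹) * (β₂ - β₁)) := by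
    have := h₁.pos.ne'
    have := h₂.pos.ne'
    field_simp
    ring
  have h3 : β₁⁻¹ * β₂⁻¹ ≤ B ^ 2 := by
    rw [sq]
    exact mul_le_mul (inv_le_of_inv_le₀ hB h₁.inv_le) (inv_le_of_inv_le₀ hB h₂.inv_le)
      (inv_pos.2 h₂.pos).le hB.le
  have h4 : |3 / (2 * β₂) - 3 / (2 * β₁)| ≤ 3 / 2 * B ^ 2 * |β₂ - β₁| := by
    have := mul_nonneg (inv_pos.2 h₁.pos).le (inv_pos.2 h₂.pos).le
    rw [e, abs_neg, abs_mul, abs_of_nonneg (by linarith)]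
    gcongr
  have h5 : |totEnergy β₂ φ₂ n₂ - totEnergy β₁ φ₁ n₁| ≤
      (3 / 2 * B ^ 2 + C) * (‖n₂ - n₁‖ + |β₂ - β₁|) := by
    have h6 := abs_add_le (3 / (2 * β₂) - 3 / (2 * β₁))
      (potEnergy β₂ φ₂ n₂ - potEnergy β₁ φ₁ n₁)
    rw [totEnergy, totEnergy, add_sub_add_comm]
    have h7 : 0 ≤ 3 / 2 * B ^ 2 * ‖n₂ - n₁‖ := by positivity
    linarith
  rw [← ofReal_norm, ← ofReal_norm, ← ofReal_norm,
    ← ENNReal.ofReal_add (norm_nonneg _) (norm_nonneg _)]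
  change _ ≤ ENNReal.ofReal _ * _
  rw [← ENNReal.ofReal_mul (by positivity)]
  exact ENNReal.ofReal_le_ofReal h5

/-- Lipschitz dependence of the solution on the data. The energies at time `t` differ by the
difference of the initial energies, which depend on `β_in` and on the initial densities in a Lipschitz
way, and by the differences of the kinetic energies. -/
lemma exists_lipschitz_data (s r : ℝ) (hs : 5 / 2 < s) (hs' : s ≤ 3) (M : ℝ) (hM : 0 < M) :
    ∃ C : ℝ≥0,
      ∀ (T : ℝ) (G : Fin 2 → ℝ → T3 → R3 → ℝ) (βin : Fin 2 → ℝ)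
        (β : Fin 2 → ℝ → ℝ) (φ : Fin 2 → ℝ → T3 → ℝ), 0 < T →
        (∀ a, 0 < βin a ∧ ContE' s T (G a) ∧ IsSolution s T (G a) (βin a) (β a) (φ a) ∧
          Bootstrap s r T M (G a) (βin a) ∧
          (SmallKineticChange T M (G a) ∨
            timeSup T (fun t => ‖Real.log (β a t)‖ₑ) ≤ ENNReal.ofReal M)) →
          timeSup T (fun t => ‖β 1 t - β 0 t‖ₑ) +
              timeSup T (fun t => sobNorm (s + 2) (φ 1 t - φ 0 t)) ≤
            C * (timeSup T (fun t => normE' s (G 1 t - G 0 t)) + ‖βin 1 - βin 0‖ₑ) := by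
  obtain ⟨L, hL⟩ := exists_curveBound s r hs M hM
  obtain ⟨C₁, hC₁⟩ := exists_lipschitz hs hs' (betaBound L) L.toNNReal
  obtain ⟨C₂, hC₂⟩ := exists_data_sub_le s hs
  obtain ⟨C₃, hC₃⟩ := exists_totEnergy_stability (betaBound L)
  set C := C₁ * (C₂ + C₃ * (embConst 0 s * C₂ + 1) + C₂ + C₂) with hCdef
  refine ⟨2 * C, fun T G βin β φ hT h => ?_⟩
  have hcb := fun a => hL T (G a) (βin a) (β a) (φ a) hT (h a).1 (h a).2.1 (h a).2.2.1
    (h a).2.2.2.1 (h a).2.2.2.2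
  have hbd : ∀ a, ∀ t ∈ Icc 0 T, IsBddPot (betaBound L) (β a t) (potRep (φ a) t)
      (dens (G a) t) := fun a t ht =>
    (hcb a).isBddPot hs (h a).2.1 ht ((h a).2.2.1.beta_pos t ht) ((h a).2.2.1.isPot hs (h a).2.1 ht)
      ((h a).2.2.1.energy_eq hs (h a).2.1 ht)
  set Y := timeSup T (fun t => normE' s (G 1 t - G 0 t)) with hY
  set Z := ‖βin 1 - βin 0‖ₑ with hZ
  have h0 : (0 : ℝ) ∈ Icc 0 T := ⟨le_rfl, hT.le⟩
  have hdata := hC₂ T (G 0) (G 1) hT (h 0).2.1 (h 1).2.1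
  have henergy0 : ‖totEnergy (βin 1) (potRep (φ 1) 0) (dens (G 1) 0) -
      totEnergy (βin 0) (potRep (φ 0) 0) (dens (G 0) 0)‖ₑ ≤
      C₃ * (embConst 0 s * (C₂ * Y) + Z) := by
    have h1 := hC₃ _ _ _ _ _ _ (hbd 0 0 h0) (hbd 1 0 h0)
    rw [(h 0).2.2.1.init, (h 1).2.2.1.init] at h1
    refine h1.trans ?_
    gcongr
    exact (norm_le_embConst hs _).trans (by gcongr; exact (hdata 0 h0).1)
  have key : ∀ t ∈ Icc 0 T, ‖β 1 t - β 0 t‖ₑ +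
      sobNorm (s + 2) (φ 1 t - φ 0 t) ≤ C * (Y + Z) := by
    intro t ht
    have h1 := hC₁ _ _ _ _ _ _ (hbd 0 t ht) (hbd 1 t ht) ((hcb 0).sob_le t ht)
      ((hcb 1).sob_le t ht)
    rw [(h 0).2.2.1.energy_eq hs (h 0).2.1 ht, (h 1).2.2.1.energy_eq hs (h 1).2.1 ht] at h1
    have hae : φ 1 t - φ 0 t =ᵐ[dx] (potRep (φ 1) t - potRep (φ 0) t : CT) := by
      filter_upwards [(h 0).2.2.1.phi_ae hs ht, (h 1).2.2.1.phi_ae hs ht] with x a1 a2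
      rw [Pi.sub_apply, a1, a2]; rfl
    rw [sobNorm_congr fun k => coeffT_congr hae k]
    refine h1.trans ?_
    set E₁ := totEnergy (βin 1) (potRep (φ 1) 0) (dens (G 1) 0)
    set E₀ := totEnergy (βin 0) (potRep (φ 0) 0) (dens (G 0) 0)
    have e : E₁ + kinetic (G 1 0) - kinetic (G 1 t) - (E₀ + kinetic (G 0 0) - kinetic (G 0 t)) =
        (E₁ - E₀) + (kinetic (G 1 0) - kinetic (G 0 0)) - (kinetic (G 1 t) - kinetic (G 0 t)) := by
      ring
    have h2 : ‖E₁ + kinetic (G 1 0) - kinetic (G 1 t) -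
        (E₀ + kinetic (G 0 0) - kinetic (G 0 t))‖ₑ ≤
        C₃ * (embConst 0 s * (C₂ * Y) + Z) + C₂ * Y + C₂ * Y := by
      rw [e]
      refine enorm_sub_le.trans (add_le_add ((enorm_add_le _ _).trans ?_) (hdata t ht).2)
      exact add_le_add henergy0 (hdata 0 h0).2
    calc _ ≤ (C₁ : ℝ≥0∞) * (C₂ * Y + (C₃ * (embConst 0 s * (C₂ * Y) + Z) + C₂ * Y + C₂ * Y)) := by
          gcongr
          exact (hdata t ht).1
      _ = (C₁ : ℝ≥0∞) * (C₂ + C₃ * (embConst 0 s * C₂) + C₂ + C₂) * Y + C₁ * C₃ * Z := by ring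
      _ ≤ (C : ℝ≥0∞) * Y + C * Z := by
          gcongr
          · rw [hCdef]
            push_cast
            gcongr
            exact le_self_add
          · rw [hCdef]
            push_cast
            gcongr
            calc (C₃ : ℝ≥0∞) ≤ C₃ * (embConst 0 s * C₂ + 1) :=
                  le_mul_of_one_le_right zero_le le_add_self
              _ ≤ _ := le_add_self.trans (le_self_add.trans le_self_add)
      _ = _ := by ring
  calc _ ≤ (C : ℝ≥0∞) * (Y + Z) + C * (Y + Z) :=
        add_le_add (timeSup_le fun t ht => le_self_add.trans (key t ht))
          (timeSup_le fun t ht => le_add_self.trans (key t ht))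
    _ = _ := by push_cast; ring

/-! ### Smooth dependence of moments on time and space -/

/-- The domain `[0,T] × ℝ³ × ℝ³` of the lifts of functions of `(t, x, v)`. -/
abbrev phaseDom (T : ℝ) : Set (ℝ × R3 × R3) := Icc 0 T ×ˢ univ

/-- The domain `[0,T] × ℝ³` of the lifts of functions of `(t, x)`. -/
abbrev slab (T : ℝ) : Set (ℝ × R3) := Icc 0 T ×ˢ univ

lemma uniqueDiffOn_phaseDom {T : ℝ} (hT : 0 < T) : UniqueDiffOn ℝ (phaseDom T) :=
  (uniqueDiffOn_Icc hT).prod uniqueDiffOn_univ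

lemma uniqueDiffOn_slab {T : ℝ} (hT : 0 < T) : UniqueDiffOn ℝ (slab T) :=
  (uniqueDiffOn_Icc hT).prod uniqueDiffOn_univ

lemma convex_slab (T : ℝ) : Convex ℝ (slab T) := (convex_Icc 0 T).prod convex_univ

section moments

variable {F : Type} [NormedAddCommGroup F] [NormedSpace ℝ F]

/-- Smooth functions of `(t, x, v)`, periodic in `x`, with Gaussian decay in `v` of all
derivatives. Values in a normed space are allowed in order to include the derivatives. -/
structure RapidDecay (T : ℝ) (g : ℝ × R3 × R3 → F) : Prop where
  contDiffOn : ContDiffOn ℝ ∞ g (phaseDom T)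
  periodic : ∀ t ∈ Icc 0 T, ∀ y m v, proj m = 0 → g (t, y + m, v) = g (t, y, v)
  bound : ∀ q : ℕ, ∃ C : ℝ, ∀ p ∈ phaseDom T,
    ‖iteratedFDerivWithin ℝ q g (phaseDom T) p‖ ≤ C * Real.exp (-‖p.2.2‖ ^ 2)

/-- The inclusion of the `(t, x)` directions into the `(t, x, v)` directions. -/
def inclTX : ℝ × R3 →L[ℝ] ℝ × R3 × R3 :=
  (ContinuousLinearMap.fst ℝ ℝ R3).prod ((ContinuousLinearMap.snd ℝ ℝ R3).prod 0)

/-- The derivative in the variables `(t, x)`. -/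
def derivTX (T : ℝ) (g : ℝ × R3 × R3 → F) (p : ℝ × R3 × R3) : ℝ × R3 →L[ℝ] F :=
  (ContinuousLinearMap.compL ℝ (ℝ × R3) (ℝ × R3 × R3) F).flip inclTX
    (fderivWithin ℝ g (phaseDom T) p)

variable {T : ℝ} {g : ℝ × R3 × R3 → F}

open scoped Pointwise in
/-- The class is closed under differentiation in `(t, x)`, which permits induction on the order of
smoothness of the moments. -/
lemma RapidDecay.derivTX (hT : 0 < T) (h : RapidDecay T g) : RapidDecay T (derivTX T g) := by
  have hu := uniqueDiffOn_phaseDom hT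
  set L := (ContinuousLinearMap.compL ℝ (ℝ × R3) (ℝ × R3 × R3) F).flip inclTX with hL
  have hfd : ContDiffOn ℝ ∞ (fderivWithin ℝ g (phaseDom T)) (phaseDom T) :=
    h.contDiffOn.fderivWithin hu le_rfl
  refine ⟨L.contDiff.comp_contDiffOn hfd, fun t ht y m v hm => ?_, fun q => ?_⟩
  · rw [PoincarePoisson.derivTX, PoincarePoisson.derivTX]
    congr 1
    have h1 := fderivWithin_comp_add_right (𝕜 := ℝ) (f := g) (s := phaseDom T) (x := (t, y, v))
      ((0, m, 0) : ℝ × R3 × R3)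
    have h2 : ((0, m, 0) : ℝ × R3 × R3) +ᵥ phaseDom T = phaseDom T := by
      ext p
      rw [mem_vadd_set_iff_neg_vadd_mem]
      simp [phaseDom]
    rw [h2] at h1
    have e : ((t, y, v) : ℝ × R3 × R3) + (0, m, 0) = (t, y + m, v) := by simp
    rw [e] at h1
    rw [← h1]
    refine fderivWithin_congr (fun p hp => ?_) ?_
    · have := h.periodic p.1 hp.1 p.2.1 m p.2.2 hm
      rw [← this]
      congr 1
      ext <;> simp
    · rw [e]
      exact h.periodic t ht y m v hm
  · obtain ⟨C, hC⟩ := h.bound (q + 1)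
    refine ⟨‖L‖ * C, fun p hp => ?_⟩
    have h1 := L.norm_iteratedFDerivWithin_comp_left (hfd p hp) hu hp (n := q)
      (by exact_mod_cast le_top)
    refine h1.trans ?_
    rw [norm_iteratedFDerivWithin_fderivWithin hu hp, mul_assoc]
    exact mul_le_mul_of_nonneg_left (hC p hp) (norm_nonneg _)

lemma RapidDecay.exists_le (h : RapidDecay T g) : ∃ C : ℝ, 0 ≤ C ∧ ∀ z ∈ slab T, ∀ v,
    ‖g (z.1, z.2, v)‖ ≤ C * Real.exp (-‖v‖ ^ 2) := by
  obtain ⟨C, hC⟩ := h.bound 0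
  refine ⟨max C 0, le_max_right _ _, fun z hz v => ?_⟩
  have := hC (z.1, z.2, v) ⟨hz.1, mem_univ _⟩
  rw [norm_iteratedFDerivWithin_zero] at this
  exact this.trans (mul_le_mul_of_nonneg_right (le_max_left _ _) (Real.exp_pos _).le)

lemma RapidDecay.hasFDerivWithinAt (h : RapidDecay T g) (v : R3) {z : ℝ × R3} (hz : z ∈ slab T) :
    HasFDerivWithinAt (fun z : ℝ × R3 => g (z.1, z.2, v))
      (PoincarePoisson.derivTX T g (z.1, z.2, v)) (slab T) z := by
  have h1 : HasFDerivWithinAt (fun z : ℝ × R3 => ((z.1, z.2, v) : ℝ × R3 × R3)) inclTX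
      (slab T) z :=
    (hasFDerivAt_fst.prodMk (hasFDerivAt_snd.prodMk (hasFDerivAt_const v z))).hasFDerivWithinAt
  have hp : ((z.1, z.2, v) : ℝ × R3 × R3) ∈ phaseDom T := ⟨hz.1, mem_univ _⟩
  have hm : MapsTo (fun z : ℝ × R3 => ((z.1, z.2, v) : ℝ × R3 × R3)) (slab T) (phaseDom T) :=
    fun w hw => ⟨hw.1, mem_univ _⟩
  exact HasFDerivWithinAt.comp z
    ((h.contDiffOn.differentiableOn (by simp) _ hp).hasFDerivWithinAt) h1 hm

lemma RapidDecay.exists_lipschitz (hT : 0 < T) (h : RapidDecay T g) :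
    ∃ C : ℝ, 0 ≤ C ∧ ∀ z ∈ slab T, ∀ w ∈ slab T, ∀ v,
      ‖g (w.1, w.2, v) - g (z.1, z.2, v)‖ ≤ C * Real.exp (-‖v‖ ^ 2) * ‖w - z‖ := by
  obtain ⟨C, hC0, hC⟩ := (h.derivTX hT).exists_le
  refine ⟨C, hC0, fun z hz w hw v => ?_⟩
  exact Convex.norm_image_sub_le_of_norm_hasFDerivWithin_le
    (f := fun z : ℝ × R3 => g (z.1, z.2, v)) (fun x hx => h.hasFDerivWithinAt v hx)
    (fun x hx => hC x hx v) (convex_slab T) hz hw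

/-- A Taylor expansion in `(t, x)` whose remainder is integrable in `v`. The slab is convex, so that
no boundary regularity in time enters. -/
lemma RapidDecay.exists_taylor (hT : 0 < T) (h : RapidDecay T g) :
    ∃ C : ℝ, 0 ≤ C ∧ ∀ z ∈ slab T, ∀ w ∈ slab T, ∀ v,
      ‖g (w.1, w.2, v) - g (z.1, z.2, v) - PoincarePoisson.derivTX T g (z.1, z.2, v) (w - z)‖ ≤
        C * ‖w - z‖ ^ 2 * Real.exp (-‖v‖ ^ 2) := by
  obtain ⟨C, hC0, hC⟩ := (h.derivTX hT).exists_lipschitz hT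
  refine ⟨C, hC0, fun z hz w hw v => ?_⟩
  have hseg : segment ℝ z w ⊆ slab T := (convex_slab T).segment_subset hz hw
  have h1 := Convex.norm_image_sub_le_of_norm_hasFDerivWithin_le'
    (f := fun z : ℝ × R3 => g (z.1, z.2, v)) (s := segment ℝ z w)
    (φ := PoincarePoisson.derivTX T g (z.1, z.2, v)) (C := C * Real.exp (-‖v‖ ^ 2) * ‖w - z‖)
    (fun x hx => (h.hasFDerivWithinAt v (hseg hx)).mono hseg)
    (fun x hx => (hC z hz x (hseg hx) v).trans (mul_le_mul_of_nonneg_left ?_ (by positivity)))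
    (convex_segment z w) (left_mem_segment ℝ z w) (right_mem_segment ℝ z w)
  · refine h1.trans (le_of_eq ?_)
    ring
  · obtain ⟨a, b, ha, hb, hab, rfl⟩ := hx
    have e : a • z + b • w - z = b • (w - z) := by
      rw [eq_sub_of_add_eq hab]; module
    rw [e, norm_smul, Real.norm_of_nonneg hb]
    exact mul_le_of_le_one_left (norm_nonneg _) (by linarith)

/-- The moment `∫ g(t, y, v) dμ(v)`. -/
def moment (μ : Measure R3) (g : ℝ × R3 × R3 → F) (z : ℝ × R3) : F := ∫ v, g (z.1, z.2, v) ∂μ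

variable {μ : Measure R3}

lemma RapidDecay.integrable (hμ : Integrable (fun v : R3 => Real.exp (-‖v‖ ^ 2)) μ)
    (h : RapidDecay T g) {z : ℝ × R3} (hz : z ∈ slab T) :
    Integrable (fun v => g (z.1, z.2, v)) μ := by
  obtain ⟨C, -, hC⟩ := h.exists_le
  refine (hμ.const_mul C).mono' ?_ (Eventually.of_forall fun v => hC z hz v)
  have : Continuous fun v : R3 => g (z.1, z.2, v) :=
    h.contDiffOn.continuousOn.comp_continuous (by fun_prop) fun v => ⟨hz.1, mem_univ _⟩
  exact this.aestronglyMeasurable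

lemma RapidDecay.exists_moment_lipschitz (hT : 0 < T)
    (hμ : Integrable (fun v : R3 => Real.exp (-‖v‖ ^ 2)) μ) (h : RapidDecay T g) :
    ∃ C : ℝ, 0 ≤ C ∧ ∀ z ∈ slab T, ∀ w ∈ slab T,
      ‖moment μ g w - moment μ g z‖ ≤ C * ‖w - z‖ := by
  obtain ⟨C, hC0, hC⟩ := h.exists_lipschitz hT
  have hI : 0 ≤ ∫ v, Real.exp (-‖v‖ ^ 2) ∂μ := integral_nonneg fun _ => (Real.exp_pos _).le
  refine ⟨C * ∫ v, Real.exp (-‖v‖ ^ 2) ∂μ, by positivity, fun z hz w hw => ?_⟩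
  rw [moment, moment, ← integral_sub (h.integrable hμ hw) (h.integrable hμ hz),
    ← integral_const_mul, ← integral_mul_const]
  exact norm_integral_le_of_norm_le ((hμ.const_mul C).mul_const _)
    (Eventually.of_forall fun v => hC z hz w hw v)

lemma RapidDecay.exists_moment_taylor [CompleteSpace F] (hT : 0 < T)
    (hμ : Integrable (fun v : R3 => Real.exp (-‖v‖ ^ 2)) μ) (h : RapidDecay T g) :
    ∃ C : ℝ, 0 ≤ C ∧ ∀ z ∈ slab T, ∀ w ∈ slab T,
      ‖moment μ g w - moment μ g z - moment μ (PoincarePoisson.derivTX T g) z (w - z)‖ ≤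
        C * ‖w - z‖ ^ 2 := by
  obtain ⟨C, hC0, hC⟩ := h.exists_taylor hT
  have hI : 0 ≤ ∫ v, Real.exp (-‖v‖ ^ 2) ∂μ := integral_nonneg fun _ => (Real.exp_pos _).le
  refine ⟨C * ∫ v, Real.exp (-‖v‖ ^ 2) ∂μ, by positivity, fun z hz w hw => ?_⟩
  have hd := (h.derivTX hT).integrable hμ hz
  have e1 := integral_sub (h.integrable hμ hw) (h.integrable hμ hz)
  have e2 := integral_sub ((h.integrable hμ hw).sub (h.integrable hμ hz))
    (hd.apply_continuousLinearMap (w - z))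
  simp only [Pi.sub_apply] at e2
  rw [moment, moment, moment, ContinuousLinearMap.integral_apply hd, ← e1, ← e2]
  refine (norm_integral_le_of_norm_le (hμ.const_mul (C * ‖w - z‖ ^ 2))
    (Eventually.of_forall fun v => hC z hz w hw v)).trans (le_of_eq ?_)
  rw [integral_const_mul]; ring

lemma RapidDecay.moment_periodic (h : RapidDecay T g) {t : ℝ} (ht : t ∈ Icc 0 T) {y y' : R3}
    (hy : proj y = proj y') : moment μ g (t, y) = moment μ g (t, y') := by
  have hm : proj (y - y') = 0 := by
    have := proj_add y' (y - y')
    rw [add_sub_cancel, hy] at this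
    exact left_eq_add.1 this
  refine integral_congr_ae (Eventually.of_forall fun v => ?_)
  have := h.periodic t ht y' (y - y') v hm
  rwa [add_sub_cancel] at this

/-- A choice of lifts of the points of the torus. -/
def liftT (x : T3) : R3 := (proj_surjective x).choose

lemma proj_liftT (x : T3) : proj (liftT x) = x := (proj_surjective x).choose_spec

open Classical in
/-- The moment of the function translated by `y`, as a continuous function on the torus:
`x ↦ ∫ g(t, y + x, v) dμ(v)`. It is set to zero where this is not continuous, which does not happen
for functions of rapid decay. -/
def momentC (μ : Measure R3) (g : ℝ × R3 × R3 → F) (z : ℝ × R3) : C(T3, F) :=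
  if h : Continuous fun x => moment μ g (z.1, z.2 + liftT x) then ⟨_, h⟩ else 0

lemma RapidDecay.momentC_apply (hT : 0 < T)
    (hμ : Integrable (fun v : R3 => Real.exp (-‖v‖ ^ 2)) μ) (h : RapidDecay T g) {z : ℝ × R3}
    (hz : z ∈ slab T) (x : T3) : momentC μ g z x = moment μ g (z.1, z.2 + liftT x) := by
  have hc : Continuous fun x => moment μ g (z.1, z.2 + liftT x) := by
    refine isOpenQuotientMap_proj.isQuotientMap.continuous_iff.2 ?_
    have e : (fun x => moment μ g (z.1, z.2 + liftT x)) ∘ proj =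
        fun y => moment μ g (z.1, z.2 + y) := by
      ext y
      exact h.moment_periodic hz.1 (by rw [proj_add, proj_add, proj_liftT])
    rw [e]
    obtain ⟨C, hC0, hC⟩ := h.exists_moment_lipschitz hT hμ
    refine (LipschitzWith.of_dist_le_mul (K := C.toNNReal) fun y y' => ?_).continuous
    rw [dist_eq_norm, dist_eq_norm, Real.coe_toNNReal C hC0]
    refine (hC (z.1, z.2 + y') ⟨hz.1, mem_univ _⟩ (z.1, z.2 + y) ⟨hz.1, mem_univ _⟩).trans
      (le_of_eq ?_)
    simp [Prod.norm_def]
  rw [momentC, dif_pos hc]; rfl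

/-- A continuous family of linear maps, applied pointwise. -/
def evalFamily (E F : Type) [NormedAddCommGroup E] [NormedSpace ℝ E] [NormedAddCommGroup F]
    [NormedSpace ℝ F] : C(T3, E →L[ℝ] F) →L[ℝ] E →L[ℝ] C(T3, F) :=
  LinearMap.mkContinuous₂
    (LinearMap.mk₂ ℝ (fun (u : C(T3, E →L[ℝ] F)) (e : E) =>
      (⟨fun x => u x e, u.continuous.clm_apply continuous_const⟩ : C(T3, F)))
      (fun _ _ _ => by ext; simp) (fun _ _ _ => by ext; simp) (fun _ _ _ => by ext; simp)
      (fun _ _ _ => by ext; simp)) 1 fun u e => by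
    rw [one_mul]
    refine (ContinuousMap.norm_le _ (by positivity)).2 fun x => ?_
    exact ((u x).le_opNorm e).trans
      (mul_le_mul_of_nonneg_right (u.norm_coe_le_norm x) (norm_nonneg _))

lemma evalFamily_apply {E F : Type} [NormedAddCommGroup E] [NormedSpace ℝ E]
    [NormedAddCommGroup F] [NormedSpace ℝ F] (u : C(T3, E →L[ℝ] F)) (e : E) (x : T3) :
    evalFamily E F u e x = u x e := rfl

lemma RapidDecay.hasFDerivWithinAt_momentC [CompleteSpace F] (hT : 0 < T)
    (hμ : Integrable (fun v : R3 => Real.exp (-‖v‖ ^ 2)) μ) (h : RapidDecay T g) {z : ℝ × R3}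
    (hz : z ∈ slab T) :
    HasFDerivWithinAt (momentC μ g)
      (evalFamily _ _ (momentC μ (PoincarePoisson.derivTX T g) z)) (slab T) z := by
  obtain ⟨C, hC0, hC⟩ := h.exists_moment_taylor hT hμ
  refine .of_isLittleO (Asymptotics.IsBigO.trans_isLittleO (g := fun w => ‖w - z‖ ^ 2) ?_
    ((Asymptotics.isLittleO_pow_sub_sub z one_lt_two).mono nhdsWithin_le_nhds))
  refine Asymptotics.IsBigO.of_bound C ?_
  filter_upwards [self_mem_nhdsWithin] with w hw
  rw [norm_pow, norm_norm]
  refine (ContinuousMap.norm_le _ (by positivity)).2 fun x => ?_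
  rw [ContinuousMap.sub_apply, ContinuousMap.sub_apply, evalFamily_apply,
    h.momentC_apply hT hμ hw, h.momentC_apply hT hμ hz, (h.derivTX hT).momentC_apply hT hμ hz]
  have := hC (z.1, z.2 + liftT x) ⟨hz.1, mem_univ _⟩ (w.1, w.2 + liftT x) ⟨hw.1, mem_univ _⟩
  have e : ((w.1, w.2 + liftT x) : ℝ × R3) - (z.1, z.2 + liftT x) = w - z := by
    ext1 <;> simp
  rwa [e] at this

end moments

lemma RapidDecay.contDiffOn_momentC_nat {T : ℝ} (hT : 0 < T) {μ : Measure R3}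
    (hμ : Integrable (fun v : R3 => Real.exp (-‖v‖ ^ 2)) μ) (n : ℕ) :
    ∀ {F : Type} [NormedAddCommGroup F] [NormedSpace ℝ F] [CompleteSpace F]
      {g : ℝ × R3 × R3 → F}, RapidDecay T g → ContDiffOn ℝ n (momentC μ g) (slab T) := by
  induction n with
  | zero =>
    intro F _ _ _ g h
    exact contDiffOn_zero.2 fun z hz => (h.hasFDerivWithinAt_momentC hT hμ hz).continuousWithinAt
  | succ n ih =>
    intro F _ _ _ g h
    push_cast
    rw [contDiffOn_succ_iff_hasFDerivWithinAt_of_uniqueDiffOn (uniqueDiffOn_slab hT)]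
    have hE : ContDiff ℝ n fun u : C(T3, ℝ × R3 →L[ℝ] F) => evalFamily (ℝ × R3) F u :=
      ContinuousLinearMap.contDiff _
    exact ⟨by simp, fun z => evalFamily (ℝ × R3) F (momentC μ (PoincarePoisson.derivTX T g) z),
      hE.comp_contDiffOn (ih (h.derivTX hT)), fun z hz => h.hasFDerivWithinAt_momentC hT hμ hz⟩

/-- Moments depend smoothly on time and on translations in space, in the uniform norm. -/
lemma RapidDecay.contDiffOn_momentC {T : ℝ} (hT : 0 < T) {μ : Measure R3}
    (hμ : Integrable (fun v : R3 => Real.exp (-‖v‖ ^ 2)) μ) {g : ℝ × R3 × R3 → ℝ}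
    (h : RapidDecay T g) : ContDiffOn ℝ ∞ (momentC μ g) (slab T) :=
  contDiffOn_infty.2 fun n => RapidDecay.contDiffOn_momentC_nat hT hμ n h

/-! ### The stationary problem as a smooth equation in the space of continuous functions -/

/-- The mean of a continuous function on the torus. -/
def meanC : CT →L[ℝ] ℝ :=
  LinearMap.mkContinuous
    { toFun := fun u => ∫ x, u x ∂dx
      map_add' := fun u w => integral_add u.integrable w.integrable
      map_smul' := fun c u => integral_const_mul c _ } 1 fun u => by
    rw [one_mul]
    have := norm_integral_le_of_norm_le_const (μ := dx) (f := u) (C := ‖u‖)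
      (Eventually.of_forall fun x => u.norm_coe_le_norm x)
    simpa using this

lemma ip_eq_meanC (u w : CT) : ip u w = meanC (u * w) := rfl

/-- With `φ = (l - Δ)⁻¹ g`, the Poisson–Boltzmann equation and the energy become an explicit map
`(β, g) ↦ (n, e)`. It does not involve unbounded operators. -/
def stationaryMap {l : ℝ} (hl : 0 < l) (p : ℝ × CT) : CT × ℝ :=
  ((1 / (4 * Real.pi)) • (p.2 - l • res hl p.2) + NormedSpace.exp (p.1 • res hl p.2),
    3 / 2 * p.1⁻¹ + 1 / (8 * Real.pi) * meanC (res hl p.2 * (p.2 - l • res hl p.2)))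

lemma IsPot.eq_res {l β : ℝ} (hl : 0 < l) {φ n : CT} (h : IsPot β φ n) :
    φ = res hl (l • φ + (4 * Real.pi) • charge β φ n) := eq_res_of_coeff hl h

/-- A solution is recovered as the preimage of its density and energy, with `g = lφ - Δφ`. -/
lemma IsPot.stationaryMap_eq {l β : ℝ} (hl : 0 < l) {φ n : CT} (h : IsPot β φ n) :
    stationaryMap hl (β, l • φ + (4 * Real.pi) • charge β φ n) = (n, totEnergy β φ n) := by
  have hpi := Real.pi_pos
  rw [stationaryMap]
  simp only [← h.eq_res hl, add_sub_cancel_left]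
  rw [← expC_eq_exp, smul_smul, ← ip_eq_meanC, ip_smul_right, totEnergy, potEnergy]
  congr 1
  · rw [one_div_mul_cancel (by positivity), one_smul, charge, sub_add_cancel]
  · have e : 3 / (2 * β) = 3 / 2 * β⁻¹ := by rw [div_mul_eq_div_div, div_eq_mul_inv]
    rw [e]; field_simp; ring

lemma contDiff_exp_CT : ContDiff ℝ ∞ (NormedSpace.exp : CT → CT) :=
  contDiff_iff_contDiffAt.2 fun u => (NormedSpace.exp_analytic (𝕂 := ℝ) u).contDiffAt

lemma contDiffAt_stationaryMap {l : ℝ} (hl : 0 < l) {p : ℝ × CT} (hp : p.1 ≠ 0) :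
    ContDiffAt ℝ ∞ (stationaryMap hl) p := by
  have hR : ContDiffAt ℝ ∞ (fun p : ℝ × CT => res hl p.2) p :=
    (res hl).contDiff.contDiffAt.comp p contDiffAt_snd
  have hA : ContDiffAt ℝ ∞ (fun p : ℝ × CT => p.2 - l • res hl p.2) p :=
    contDiffAt_snd.sub (hR.const_smul l)
  refine ((hA.const_smul _).add (contDiff_exp_CT.contDiffAt.comp p
    (contDiffAt_fst.smul hR))).prodMk ?_
  exact (contDiffAt_const.mul (contDiffAt_fst.inv hp)).add
    (contDiffAt_const.mul (meanC.contDiff.contDiffAt.comp p (hR.mul hA)))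

lemma exists_hasFDerivAt_stationaryMap {l : ℝ} (hl : 0 < l) {p : ℝ × CT} (hp : p.1 ≠ 0) :
    ∃ D : ℝ × CT →L[ℝ] CT × ℝ, HasFDerivAt (stationaryMap hl) D p ∧ ∀ q : ℝ × CT,
      D q = ((1 / (4 * Real.pi)) • (q.2 - l • res hl q.2) +
          expC (p.1 • res hl p.2) * (p.1 • res hl q.2 + q.1 • res hl p.2),
        3 / 2 * (-(p.1 ^ 2)⁻¹ * q.1) + 1 / (8 * Real.pi) *
          (ip (res hl p.2) (q.2 - l • res hl q.2) + ip (res hl q.2) (p.2 - l • res hl p.2))) := by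
  have hR : HasFDerivAt (fun p : ℝ × CT => res hl p.2) ((res hl).comp
      (ContinuousLinearMap.snd ℝ ℝ CT)) p := (res hl).hasFDerivAt.comp p hasFDerivAt_snd
  have hA := (hasFDerivAt_snd (𝕜 := ℝ) (p := p)).sub (hR.const_smul l)
  have h1 := (hA.const_smul (1 / (4 * Real.pi))).add
    ((hasFDerivAt_exp (𝕂 := ℝ) (x := p.1 • res hl p.2)).comp p (hasFDerivAt_fst.smul hR))
  have h2 := ((hasDerivAt_inv hp).comp_hasFDerivAt p
    (hasFDerivAt_fst (𝕜 := ℝ) (E := ℝ) (F := CT))).const_mul (3 / 2)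
  have h3 := ((meanC.hasFDerivAt.comp p (hR.mul hA))).const_mul (1 / (8 * Real.pi))
  refine ⟨_, h1.prodMk (h2.add h3), fun q => ?_⟩
  simp only [ip_eq_meanC, expC_eq_exp]
  rw [← map_add, mul_comm (res hl q.2)]
  rfl

section linearized

variable {l β m : ℝ} (hl : 0 < l) (g : CT)

/-- The equation for `h` at a fixed temperature is uniquely solvable by a Neumann series, if `l` is
large enough. -/
lemma existsUnique_linear (hm : 0 < m) (hβ : 0 < β)
    (h1 : ∀ x, m ≤ expC (β • res hl g) x) (h2 : ∀ x, 4 * Real.pi * β * expC (β • res hl g) x ≤ l)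
    (k : CT) : ∃! h : CT, (1 / (4 * Real.pi)) • (h - l • res hl h) +
      expC (β • res hl g) * (β • res hl h) = k := by
  have hpi := Real.pi_pos
  set E := expC (β • res hl g) with hE
  set V : CT := ContinuousMap.const T3 l - (4 * Real.pi * β) • E with hV
  set K : CT →L[ℝ] CT := (ContinuousLinearMap.mul ℝ CT V).comp (res hl) with hK
  set θ := (l - 4 * Real.pi * β * m) / l with hθ
  have hθ0 : 0 ≤ l - 4 * Real.pi * β * m := by
    have := mul_le_mul_of_nonneg_left (h1 0) (by positivity : 0 ≤ 4 * Real.pi * β)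
    linarith [h2 0]
  have hθ1 : θ < 1 := by
    rw [hθ, div_lt_one hl]
    have : 0 < 4 * Real.pi * β * m := by positivity
    linarith
  have hKn : ‖K‖ < 1 := by
    refine lt_of_le_of_lt (ContinuousLinearMap.opNorm_le_bound _ (div_nonneg hθ0 hl.le)
      fun h => ?_) hθ1
    have hVn : ‖V‖ ≤ l - 4 * Real.pi * β * m := by
      refine (ContinuousMap.norm_le _ hθ0).2 fun x => ?_
      have a1 := mul_le_mul_of_nonneg_left (h1 x) (by positivity : 0 ≤ 4 * Real.pi * β)
      have a2 : V x = l - 4 * Real.pi * β * E x := rfl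
      rw [a2, Real.norm_of_nonneg (by linarith [h2 x])]
      linarith
    calc ‖V * res hl h‖ ≤ ‖V‖ * ‖res hl h‖ := norm_mul_le _ _
      _ ≤ (l - 4 * Real.pi * β * m) * (‖h‖ / l) :=
        mul_le_mul hVn (norm_res_apply_le hl h) (norm_nonneg _) hθ0
      _ = θ * ‖h‖ := by rw [hθ]; ring
  obtain ⟨U, hU⟩ := isUnit_one_sub_of_norm_lt_one (R := CT →L[ℝ] CT) (x := K) hKn
  have key : ∀ h : CT, (1 / (4 * Real.pi)) • (h - l • res hl h) + E * (β • res hl h) =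
      (1 / (4 * Real.pi)) • (U : CT →L[ℝ] CT) h := fun h => by
    rw [hU]
    ext x
    change 1 / (4 * Real.pi) * (h x - l * res hl h x) + E x * (β * res hl h x) =
      1 / (4 * Real.pi) * (h x - (l - 4 * Real.pi * β * E x) * res hl h x)
    field_simp
    ring
  have u1 : ∀ h, (U : CT →L[ℝ] CT) ((U⁻¹ : (CT →L[ℝ] CT)ˣ).1 h) = h := fun h => by
    rw [← mul_apply_eq_comp, U.mul_inv]; rfl
  have u2 : ∀ h, (U⁻¹ : (CT →L[ℝ] CT)ˣ).1 ((U : CT →L[ℝ] CT) h) = h := fun h => by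
    rw [← mul_apply_eq_comp, U.inv_mul]; rfl
  refine ⟨(U⁻¹ : (CT →L[ℝ] CT)ˣ).1 ((4 * Real.pi) • k), ?_, fun h hh => ?_⟩
  · simp only
    rw [key, u1, smul_smul, one_div_mul_cancel (by positivity), one_smul]
  · simp only at hh
    rw [key] at hh
    rw [← hh, smul_smul, mul_one_div_cancel (by positivity), one_smul, u2]

/-- Injectivity of the linearization, the infinitesimal form of the monotonicity of the field
energy in `β`. -/
lemma linearized_injective (hβ : 0 < β) {b : ℝ} {h : CT}
    (e1 : (1 / (4 * Real.pi)) • (h - l • res hl h) +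
      expC (β • res hl g) * (β • res hl h + b • res hl g) = 0)
    (e2 : 3 / 2 * (-(β ^ 2)⁻¹ * b) + 1 / (8 * Real.pi) *
      (ip (res hl g) (h - l • res hl h) + ip (res hl h) (g - l • res hl g)) = 0) : b = 0 := by
  have hpi := Real.pi_pos
  have hp : (0 : ℝ) < 1 / (4 * Real.pi) := by positivity
  set f := (1 / (4 * Real.pi)) • (h - l • res hl h) with hf
  set w := β • res hl h + b • res hl g with hw
  have s1 : ip (res hl h) (g - l • res hl g) = ip (res hl g) (h - l • res hl h) := by
    rw [(isNegLap_res hl h).ip_eq (isNegLap_res hl g), ip_comm]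
  have s2 : 0 ≤ ip (res hl h) f := by
    rw [hf, ip_smul_right]
    exact mul_nonneg hp.le (isNegLap_res hl h).ip_nonneg
  have s3 : ip (res hl g) f = 3 / 2 * ((β ^ 2)⁻¹ * b) := by
    rw [hf, ip_smul_right]
    rw [s1] at e2
    have : 1 / (8 * Real.pi) = 1 / 2 * (1 / (4 * Real.pi)) := by field_simp; norm_num
    rw [this] at e2
    linarith
  have s4 : ip w f ≤ 0 := by
    have e3 : f = -(expC (β • res hl g) * w) := eq_neg_of_add_eq_zero_left e1
    have : ip w f ≤ ip 0 0 := ip_mono fun x => by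
      rw [e3]
      change w x * -(Real.exp _ * w x) ≤ 0 * 0
      nlinarith [mul_nonneg (Real.exp_pos ((β • res hl g) x)).le (mul_self_nonneg (w x))]
    simpa [ip] using this
  have s5 : ip w f = β * ip (res hl h) f + b * ip (res hl g) f := by
    rw [hw, ip_add_left, ip_smul_left, ip_smul_left]
  rw [s3] at s5
  have s6 : 0 ≤ β * ip (res hl h) f := mul_nonneg hβ.le s2
  have s7 : 0 < (β ^ 2)⁻¹ := by positivity
  have s8 : (β ^ 2)⁻¹ * (b * b) ≤ 0 := by nlinarith
  have s9 : b * b ≤ 0 := nonpos_of_mul_nonpos_right s8 s7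
  exact mul_self_eq_zero.1 (le_antisymm s9 (mul_self_nonneg b))

end linearized

/-- The potential and the temperature are smooth functions of the density and of the energy, near
each solution of the stationary problem. -/
lemma exists_smooth_solution_map {β₀ : ℝ} {φ₀ n₀ : CT} (hβ : 0 < β₀) (h₀ : IsPot β₀ φ₀ n₀) :
    ∃ Ψ : CT × ℝ → ℝ × CT, ContDiffAt ℝ ∞ Ψ (n₀, totEnergy β₀ φ₀ n₀) ∧
      ∀ᶠ p in 𝓝 ((β₀, φ₀, n₀) : ℝ × CT × CT), IsPot p.1 p.2.1 p.2.2 →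
        Ψ (p.2.2, totEnergy p.1 p.2.1 p.2.2) = (p.1, p.2.1) := by
  have hpi := Real.pi_pos
  have hb : ∀ x, |β₀ * φ₀ x| ≤ ‖β₀ • φ₀‖ := fun x => (β₀ • φ₀).norm_coe_le_norm x
  set l := 4 * Real.pi * β₀ * Real.exp ‖β₀ • φ₀‖ with hl'
  have hl : 0 < l := by positivity
  set source : ℝ × CT × CT → ℝ × CT := fun p =>
    (p.1, l • p.2.1 + (4 * Real.pi) • charge p.1 p.2.1 p.2.2) with hsource
  have hs : Continuous source := by
    have e : source = fun p : ℝ × CT × CT => (p.1, l • p.2.1 + (4 * Real.pi) •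
        (p.2.2 - NormedSpace.exp (p.1 • p.2.1))) := by
      ext1 p; rw [← expC_eq_exp]; rfl
    rw [e]
    have hexp : Continuous (NormedSpace.exp : CT → CT) := contDiff_exp_CT.continuous
    fun_prop
  set g := l • φ₀ + (4 * Real.pi) • charge β₀ φ₀ n₀ with hg
  have hφ : res hl g = φ₀ := (h₀.eq_res hl).symm
  have hcd : ContDiffAt ℝ ∞ (stationaryMap hl) (β₀, g) := contDiffAt_stationaryMap hl hβ.ne'
  obtain ⟨D, hD, hDq⟩ := exists_hasFDerivAt_stationaryMap hl (p := (β₀, g)) hβ.ne'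
  have hex := existsUnique_linear (m := Real.exp (-‖β₀ • φ₀‖)) hl g (Real.exp_pos _) hβ
    (fun x => by
      rw [hφ]; exact Real.exp_le_exp.2 (neg_le_of_abs_le (hb x)))
    (fun x => by
      rw [hφ]
      exact mul_le_mul_of_nonneg_left (Real.exp_le_exp.2 (le_of_abs_le (hb x))) (by positivity))
  have hinj : ∀ q, D q = 0 → q = 0 := by
    intro q hq
    rw [hDq, Prod.mk_eq_zero] at hq
    -- injectivity: first the temperature, then the Neumann series
    have hb0 : q.1 = 0 := linearized_injective hl g hβ hq.1 hq.2
    have hq1 := hq.1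
    rw [hb0, zero_smul, add_zero] at hq1
    refine Prod.ext hb0 ((hex 0).unique hq1 ?_)
    simp
  have hsurj : ∀ y, ∃ q, D q = y := by
    rintro ⟨k, c⟩
    obtain ⟨h₁, hh₁, -⟩ := hex k
    obtain ⟨h₂, hh₂, -⟩ := hex (-(expC (β₀ • res hl g) * res hl g))
    have a1 : (D (0, h₁)).1 = k := by rw [hDq]; simpa using hh₁
    have a2 : (D (1, h₂)).1 = 0 := by
      rw [hDq]
      simp only [one_smul, mul_add]
      rw [← add_assoc, hh₂, neg_add_cancel]
    have a3 : (D (1, h₂)).2 ≠ 0 := fun h =>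
      one_ne_zero (congrArg Prod.fst (hinj (1, h₂) (Prod.ext a2 h)))
    refine ⟨(0, h₁) + ((c - (D (0, h₁)).2) / (D (1, h₂)).2) • (1, h₂), ?_⟩
    rw [map_add, map_smul]
    refine Prod.ext ?_ ?_
    · rw [Prod.fst_add, Prod.smul_fst, a1, a2, smul_zero, add_zero]
    · rw [Prod.snd_add, Prod.smul_snd, smul_eq_mul, div_mul_cancel₀ _ a3]
      simp
  set D' := ContinuousLinearEquiv.ofBijective D (LinearMap.ker_eq_bot'.2 hinj)
    (LinearMap.range_eq_top.2 hsurj) with hD'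
  have hDD : HasFDerivAt (stationaryMap hl) (D' : ℝ × CT →L[ℝ] CT × ℝ) (β₀, g) := by
    rw [hD', ContinuousLinearEquiv.coe_ofBijective]; exact hD
  set inv := hcd.localInverse hDD (by simp) with hinv
  have hval : stationaryMap hl (β₀, g) = (n₀, totEnergy β₀ φ₀ n₀) := h₀.stationaryMap_eq hl
  have hi1 : ContDiffAt ℝ ∞ inv (n₀, totEnergy β₀ φ₀ n₀) := hval ▸ hcd.to_localInverse hDD (by simp)
  have hi2 : ∀ᶠ p in 𝓝 ((β₀, g) : ℝ × CT), inv (stationaryMap hl p) = p :=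
    (hcd.hasStrictFDerivAt' hDD (by simp)).eventually_left_inverse
  refine ⟨fun y => ((inv y).1, res hl (inv y).2), ?_, ?_⟩
  · exact (contDiffAt_fst.comp _ hi1).prodMk
      ((res hl).contDiff.contDiffAt.comp _ (contDiffAt_snd.comp _ hi1))
  · have h3 : Tendsto source (𝓝 (β₀, φ₀, n₀)) (𝓝 (β₀, g)) := hs.tendsto _
    filter_upwards [h3.eventually hi2] with p hp hpot
    rw [← hpot.stationaryMap_eq hl]
    change inv (stationaryMap hl (source p)) = source p at hp
    change ((inv (stationaryMap hl (source p))).1, res hl (inv (stationaryMap hl (source p))).2) = _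
    rw [hp]
    exact Prod.ext rfl (hpot.eq_res hl).symm

/-! ### Translations -/

/-- The translate `x ↦ u(a + x)`. -/
def trans (a : T3) (u : CT) : CT := u.comp ⟨fun x => a + x, by fun_prop⟩

lemma trans_apply (a : T3) (u : CT) (x : T3) : trans a u x = u (a + x) := rfl

lemma coeffT_trans (a : T3) (u : CT) (k : Fin 3 → ℤ) :
    coeffT (trans a u) k = UnitAddTorus.mFourier k a * coeffT u k := by
  rw [coeffT_eq, coeffT_eq, ← integral_const_mul]
  have h := integral_add_left_eq_self (μ := dx)
    (fun x => UnitAddTorus.mFourier k a * (UnitAddTorus.mFourier (-k) x * (u x : ℂ))) a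
  rw [← h]
  congr 1
  ext x
  have e : UnitAddTorus.mFourier k a * UnitAddTorus.mFourier (-k) a = 1 := by
    rw [UnitAddTorus.mFourier_neg, Complex.mul_conj', norm_mFourier_apply]
    norm_num
  rw [mFourier_add_apply, trans_apply, ← mul_assoc, ← mul_assoc, e, one_mul]

lemma IsPot.trans {β : ℝ} {φ n : CT} (h : IsPot β φ n) (a : T3) :
    IsPot β (trans a φ) (trans a n) := fun k => by
  have e : (4 * Real.pi) • charge β (PoincarePoisson.trans a φ) (PoincarePoisson.trans a n) =
      PoincarePoisson.trans a ((4 * Real.pi) • charge β φ n) := rfl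
  rw [e, coeffT_trans, coeffT_trans, ← h k]; ring

lemma totEnergy_trans (β : ℝ) (φ n : CT) (a : T3) :
    totEnergy β (trans a φ) (trans a n) = totEnergy β φ n := by
  rw [totEnergy, totEnergy, potEnergy, potEnergy, ip, ip,
    ← integral_add_left_eq_self (μ := dx) (fun x => φ x * charge β φ n x) a]
  rfl

lemma continuous_trans : Continuous fun p : T3 × CT => trans p.1 p.2 := by
  have h : Continuous fun a : T3 => (⟨fun x => a + x, by fun_prop⟩ : C(T3, T3)) :=
    ContinuousMap.continuous_of_continuous_uncurry _ (by
      simp only [Function.uncurry_def, ContinuousMap.coe_mk]; fun_prop)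
  exact continuous_snd.compCM (h.comp continuous_fst)

/-! ### Smoothness of the data -/

lemma exp_neg_le (a : ℝ) (ha : 0 ≤ a) :
    Real.exp (-a) ≤ 6 * Real.exp 1 * ((1 + a) ^ 3)⁻¹ := by
  have h := Real.pow_div_factorial_le_exp (1 + a) (by linarith) 3
  rw [Real.exp_add] at h
  have h2 : (Nat.factorial 3 : ℝ) = 6 := by norm_num [Nat.factorial]
  rw [h2, div_le_iff₀ (by norm_num)] at h
  rw [Real.exp_neg, ← div_eq_mul_inv, le_div_iff₀ (by positivity), inv_mul_le_iff₀ (Real.exp_pos a)]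
  linarith

lemma integrable_of_le_weight {f : R3 → ℝ} (hf : Continuous f) {C : ℝ}
    (h : ∀ v, |f v| ≤ C * ((1 + ‖v‖ ^ 2) ^ 2)⁻¹) : Integrable f := by
  have hr : (Module.finrank ℝ R3 : ℝ) < 4 := by
    rw [finrank_euclideanSpace_fin]; norm_num
  refine ((integrable_rpow_neg_one_add_norm_sq (E := R3) (μ := volume) hr).const_mul C).mono'
    hf.aestronglyMeasurable (Eventually.of_forall fun v => (h v).trans (le_of_eq ?_))
  rw [show (-4 / 2 : ℝ) = -((2 : ℕ) : ℝ) by norm_num, Real.rpow_neg (by positivity),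
    Real.rpow_natCast]

lemma integrable_gaussian : Integrable fun v : R3 => Real.exp (-‖v‖ ^ 2) := by
  refine integrable_of_le_weight (by fun_prop) (C := 6 * Real.exp 1) fun v => ?_
  rw [abs_of_pos (Real.exp_pos _)]
  refine (exp_neg_le _ (sq_nonneg ‖v‖)).trans ?_
  gcongr
  · nlinarith [sq_nonneg ‖v‖]
  · norm_num

/-- The measure `(|v|²/2) dv`. -/
def kineticMeasure : Measure R3 :=
  (volume : Measure R3).withDensity fun v => ((‖v‖ ^ 2 / 2).toNNReal : ℝ≥0)

lemma measurable_kineticWeight : Measurable fun v : R3 => (‖v‖ ^ 2 / 2).toNNReal := by fun_prop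

lemma integral_kineticMeasure (f : R3 → ℝ) :
    ∫ v, f v ∂kineticMeasure = ∫ v, ‖v‖ ^ 2 / 2 * f v := by
  rw [kineticMeasure, integral_withDensity_eq_integral_smul measurable_kineticWeight]
  congr 1
  ext v
  rw [NNReal.smul_def, Real.coe_toNNReal _ (by positivity), smul_eq_mul]

lemma integrable_gaussian_kinetic :
    Integrable (fun v : R3 => Real.exp (-‖v‖ ^ 2)) kineticMeasure := by
  rw [kineticMeasure, integrable_withDensity_iff_integrable_smul measurable_kineticWeight]
  have e : (fun v : R3 => (‖v‖ ^ 2 / 2).toNNReal • Real.exp (-‖v‖ ^ 2)) =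
      fun v : R3 => ‖v‖ ^ 2 / 2 * Real.exp (-‖v‖ ^ 2) := by
    ext v
    rw [NNReal.smul_def, Real.coe_toNNReal _ (by positivity), smul_eq_mul]
  rw [e]
  refine integrable_of_le_weight (by fun_prop) (C := 6 * Real.exp 1) fun v => ?_
  rw [abs_of_nonneg (by positivity)]
  have h := exp_neg_le _ (sq_nonneg ‖v‖)
  set a := ‖v‖ ^ 2
  have ha : 0 ≤ a := sq_nonneg _
  calc a / 2 * Real.exp (-a) ≤ (1 + a) * (6 * Real.exp 1 * ((1 + a) ^ 3)⁻¹) :=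
        mul_le_mul (by linarith) h (Real.exp_pos _).le (by linarith)
    _ = 6 * Real.exp 1 * ((1 + a) ^ 2)⁻¹ := by
        have : 1 + a ≠ 0 := by linarith
        field_simp

lemma GaussianDecay.rapidDecay {T : ℝ} {G : ℝ → T3 → R3 → ℝ} (h : GaussianDecay T G) :
    RapidDecay T fun z : ℝ × R3 × R3 => G z.1 (proj z.2.1) z.2.2 := by
  refine ⟨h.1, fun t _ y m v hm => ?_, fun q => ?_⟩
  · simp only
    rw [proj_add, hm, add_zero]
  · obtain ⟨C, hC⟩ := h.2 1 q zero_le_one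
    refine ⟨C, fun p hp => ?_⟩
    have := hC p hp
    rw [one_mul] at this
    rw [Real.exp_neg, ← div_eq_mul_inv, le_div_iff₀ (Real.exp_pos _), mul_comm]
    exact this

section smooth

variable {s T : ℝ} {G : ℝ → T3 → R3 → ℝ}

/-- The translates of the density are moments of `G` in the sense of `momentC`. At each time the
moment is the continuous representative of the density, hence equal to `dens`. -/
lemma contDiffOn_trans_dens (hs : 5 / 2 < s) (hT : 0 < T) (hG : ContE' s T G)
    (h : GaussianDecay T G) :
    ContDiffOn ℝ ∞ (fun z : ℝ × R3 => trans (proj z.2) (dens G z.1)) (slab T) := by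
  have hr := h.rapidDecay
  refine (hr.contDiffOn_momentC hT integrable_gaussian).congr fun z hz => ?_
  set g : ℝ × R3 × R3 → ℝ := fun z => G z.1 (proj z.2.1) z.2.2
  have e1 : ∀ w ∈ slab T, ∀ x, momentC volume g w x = density (G w.1) (proj w.2 + x) :=
    fun w hw x => by
      rw [hr.momentC_apply hT integrable_gaussian hw]
      simp only [moment, g, density, proj_add, proj_liftT]
  have h0 : ((z.1, 0) : ℝ × R3) ∈ slab T := ⟨hz.1, mem_univ _⟩
  have hp0 : proj 0 = 0 := by
    have := proj_add 0 0
    rw [add_zero] at this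
    exact left_eq_add.1 this
  have e2 : momentC volume g (z.1, 0) = dens G z.1 := by
    refine CT.ext_of_ae ?_
    filter_upwards [(hG.1 z.1 hz.1).density_ae hs] with x hx
    rw [e1 _ h0, hp0, zero_add]
    exact hx
  ext x
  rw [e1 z hz, trans_apply, ← e2, e1 _ h0, hp0, zero_add]

lemma contDiffOn_kinetic (hT : 0 < T) (hG : ContE' s T G)
    (h : GaussianDecay T G) : ContDiffOn ℝ ∞ (fun t => kinetic (G t)) (Icc 0 T) := by
  have hr := h.rapidDecay
  set g : ℝ × R3 × R3 → ℝ := fun z => G z.1 (proj z.2.1) z.2.2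
  have h1 : ContDiffOn ℝ ∞ (fun t : ℝ => momentC kineticMeasure g (t, 0)) (Icc 0 T) :=
    (hr.contDiffOn_momentC hT integrable_gaussian_kinetic).comp
      (contDiff_id.prodMk contDiff_const).contDiffOn fun t ht => ⟨ht, mem_univ _⟩
  refine (meanC.contDiff.comp_contDiffOn h1).congr fun t ht => ?_
  rw [kinetic, integral_prod _ (hG.1 t ht).integrable_kinetic]
  refine integral_congr_ae (Eventually.of_forall fun x => ?_)
  simp only
  rw [hr.momentC_apply hT integrable_gaussian_kinetic ⟨ht, mem_univ _⟩, moment,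
    integral_kineticMeasure]
  simp only [g, zero_add, proj_liftT]

lemma IsSolution.continuousOn_potRep {βin : ℝ} {β : ℝ → ℝ} {φ : ℝ → T3 → ℝ} (hs : 5 / 2 < s)
    (h : IsSolution s T G βin β φ) : ContinuousOn (potRep φ) (Icc 0 T) := fun t₀ ht₀ => by
  refine tendsto_norm_of_sobNorm (σ := s + 2) (by linarith) ((h.phi_cont.2 t₀ ht₀).congr' ?_)
  filter_upwards [self_mem_nhdsWithin] with t ht
  refine sobNorm_congr fun k => coeffT_congr ?_ k
  filter_upwards [h.phi_ae hs ht, h.phi_ae hs ht₀] with x a1 a2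
  rw [Pi.sub_apply, a1, a2]; rfl

/-- Smoothness of the solution, jointly with its translates in space. Translation turns smoothness
in `x` into smoothness of a curve in the space of continuous functions, where the local inverse of
the stationary map is available. -/
lemma IsSolution.contDiffOn_trans {βin : ℝ} {β : ℝ → ℝ} {φ : ℝ → T3 → ℝ} (hs : 5 / 2 < s)
    (hT : 0 < T) (hG : ContE' s T G) (hd : GaussianDecay T G) (h : IsSolution s T G βin β φ) :
    ContDiffOn ℝ ∞ (fun z : ℝ × R3 => (β z.1, trans (proj z.2) (potRep φ z.1))) (slab T) := by
  intro z₀ hz₀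
  set N : ℝ × R3 → CT := fun z => trans (proj z.2) (dens G z.1) with hN
  set Φ : ℝ × R3 → CT := fun z => trans (proj z.2) (potRep φ z.1) with hΦ
  set e : ℝ × R3 → ℝ := fun z =>
    totEnergy βin (potRep φ 0) (dens G 0) + kinetic (G 0) - kinetic (G z.1) with he
  have hpot : ∀ z ∈ slab T, IsPot (β z.1) (Φ z) (N z) := fun z hz =>
    (h.isPot hs hG hz.1).trans _
  have hen : ∀ z ∈ slab T, totEnergy (β z.1) (Φ z) (N z) = e z := fun z hz => by
    rw [hΦ, hN, he]
    simp only
    rw [totEnergy_trans, h.energy_eq hs hG hz.1]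
  have hNs : ContDiffOn ℝ ∞ N (slab T) := contDiffOn_trans_dens hs hT hG hd
  have hes : ContDiffOn ℝ ∞ e (slab T) :=
    contDiffOn_const.sub ((contDiffOn_kinetic hT hG hd).comp contDiff_fst.contDiffOn
      fun z hz => hz.1)
  have hΦc : ContinuousOn Φ (slab T) := by
    have h1 : ContinuousOn (fun z : ℝ × R3 => (proj z.2, potRep φ z.1)) (slab T) :=
      (continuous_proj.comp continuous_snd).continuousOn.prodMk
        ((h.continuousOn_potRep hs).comp continuous_fst.continuousOn fun z hz => hz.1)
    exact continuous_trans.comp_continuousOn h1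
  have hβc : ContinuousOn (fun z : ℝ × R3 => β z.1) (slab T) :=
    h.beta_cont.comp continuous_fst.continuousOn fun z hz => hz.1
  obtain ⟨Ψ, hΨ, hev⟩ := exists_smooth_solution_map (h.beta_pos z₀.1 hz₀.1) (hpot z₀ hz₀)
  rw [hen z₀ hz₀] at hΨ
  have ht : Tendsto (fun z => (β z.1, Φ z, N z)) (𝓝[slab T] z₀) (𝓝 (β z₀.1, Φ z₀, N z₀)) :=
    (hβc z₀ hz₀).prodMk_nhds ((hΦc z₀ hz₀).prodMk_nhds (hNs.continuousOn z₀ hz₀))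
  have heq : ∀ᶠ z in 𝓝[slab T] z₀, (β z.1, Φ z) = Ψ (N z, e z) := by
    filter_upwards [ht.eventually hev, self_mem_nhdsWithin] with z h1 h2
    rw [← hen z h2, h1 (hpot z h2)]
  exact (hΨ.comp_contDiffWithinAt z₀ ((hNs z₀ hz₀).prodMk (hes z₀ hz₀))).congr_of_eventuallyEq
    heq (heq.self_of_nhdsWithin hz₀)

/-- Smooth data with Gaussian decay have smooth solutions. -/
lemma IsSolution.smooth {βin : ℝ} {β : ℝ → ℝ} {φ : ℝ → T3 → ℝ} (hs : 5 / 2 < s)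
    (hT : 0 < T) (hG : ContE' s T G) (hd : GaussianDecay T G) (h : IsSolution s T G βin β φ) :
    ContDiffOn ℝ ∞ β (Icc 0 T) ∧ SmoothPotential T φ := by
  have h1 := h.contDiffOn_trans hs hT hG hd
  refine ⟨?_, fun t => potRep φ t, ?_, fun t ht => h.phi_ae hs ht⟩
  · exact (contDiff_fst.comp_contDiffOn h1).comp
      (contDiff_id.prodMk (contDiff_const (c := (0 : R3)))).contDiffOn fun t ht => ⟨ht, mem_univ _⟩
  · refine ((ContinuousMap.evalCLM ℝ (0 : T3)).contDiff.comp_contDiffOn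
      (contDiff_snd.comp_contDiffOn h1)).congr fun z _ => ?_
    change potRep φ z.1 (proj z.2) = potRep φ z.1 (proj z.2 + 0)
    rw [add_zero]

end smooth

end PoincarePoisson

end

open PoincarePoisson in
theorem lemma3p2 (s r : ℝ) (hs : 5 / 2 < s) (hs' : s ≤ 3) (hr : 0 < r) (hr' : r ≤ 1) :
    -- (i), existence and uniqueness for a short time
    (∀ (T : ℝ) (G : ℝ → T3 → R3 → ℝ) (βin : ℝ), 0 < T → 0 < βin →
      ContE' s T G → PositiveDensity T G →
        ∃ Tstar : ℝ, 0 < Tstar ∧ Tstar ≤ T ∧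
          ExistsUniqueSolution s Tstar G βin fun _ _ => True) ∧
    -- (i), existence on the whole interval, with the quantitative bound
    (∀ M : ℝ, 0 < M → ∃ C : ℝ≥0,
      ∀ (T : ℝ) (G : ℝ → T3 → R3 → ℝ) (βin : ℝ), 0 < T → 0 < βin →
        ContE' s T G → PositiveDensity T G →
        Bootstrap s r T M G βin → SmallKineticChange T M G →
          ExistsUniqueSolution s T G βin fun β φ =>
            timeSup T (fun t => ‖Real.log (β t)‖ₑ) +
              timeSup T (fun t => sobNorm (s + 2) (φ t)) ≤ C) ∧
    -- (ii), Lipschitz dependence on the data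
    (∀ M : ℝ, 0 < M → ∃ C : ℝ≥0,
      ∀ (T : ℝ) (G : Fin 2 → ℝ → T3 → R3 → ℝ) (βin : Fin 2 → ℝ)
        (β : Fin 2 → ℝ → ℝ) (φ : Fin 2 → ℝ → T3 → ℝ), 0 < T →
        (∀ a, 0 < βin a ∧ ContE' s T (G a) ∧ IsSolution s T (G a) (βin a) (β a) (φ a) ∧
          Bootstrap s r T M (G a) (βin a) ∧
          (SmallKineticChange T M (G a) ∨
            timeSup T (fun t => ‖Real.log (β a t)‖ₑ) ≤ ENNReal.ofReal M)) →
          timeSup T (fun t => ‖β 1 t - β 0 t‖ₑ) +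
              timeSup T (fun t => sobNorm (s + 2) (φ 1 t - φ 0 t)) ≤
            C * (timeSup T (fun t => normE' s (G 1 t - G 0 t)) + ‖βin 1 - βin 0‖ₑ)) ∧
    -- (iii), smoothness
    (∀ (T : ℝ) (G : ℝ → T3 → R3 → ℝ) (βin : ℝ) (β : ℝ → ℝ) (φ : ℝ → T3 → ℝ), 0 < T → 0 < βin →
      ContE' s T G → PositiveDensity T G → GaussianDecay T G →
      IsSolution s T G βin β φ →
        ContDiffOn ℝ ∞ β (Icc 0 T) ∧ SmoothPotential T φ) := by
  exact ⟨fun _ _ _ hT hβ hG hd => exists_unique_short hs hs' hT hβ hG hd,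
    exists_unique_long s r hs hs', exists_lipschitz_data s r hs hs',
    fun _ _ _ _ _ hT _ hG _ hd h => h.smooth hs hT hG hd⟩
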